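/- **Setting.** Let $\widetilde M$ be a compact smooth manifold with boundary $\partial M$, with interior $M=\widetilde M\setminus\partial M$. Assume that $\phi:\partial M\to B$ is a smooth fibre bundle over a closed manifold $B$ of dimension $b\ge 0$, with fibre a closed manifold $F$ of dimension $n\geq 1$ (so $\dim M=b+n+1$), and fix a collar $\mathscr U\cong[0,1)\times\partial M$ of the boundary, with radial function $x:\mathscr U\to[0,1)$ and $\partial M=\{x=0\}$. A Riemannian metric $g$ on $M$ is an *incomplete edge metric* if $g=g_0+h$ on $\mathscr U\setminus\partial M$, where $g_0=dx^2+x^2g^F+\phi^*g^B$, $g^B$ is a Riemannian metric on $B$, $g^F$ is a smooth symmetric $2$-tensor on $\partial M$ which restricts to Riemannian metrics on the fibres of $\phi$ that are isospectral for the Laplacian, and $h$ is smooth up to $\partial M$ with $|h|_{g_0}\to 0$ uniformly as $x\to0$. It is *feasible* if moreover 1. $|h|_{g_0}=O(x^2)$ as $x\to 0$; 2. $\phi:(\partial M,g^F+\phi^*g^B)\to(B,g^B)$ is a Riemannian submersion; 3. every non-zero eigenvalue $\lambda$ of (minus) the Laplacian of each fibre satisfies $\lambda>n$. Let $\Delta$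 be the (negative) Laplace–Beltrami operator of $g$, and let $d_M$ be the distance on $\widetilde M$ defined by $g$ (the infimum of the $g$-lengths of $C^1$ curves in $\widetilde M$, where $g$ is extended smoothly, as a degenerate tensor, to $\partial M$). For $\alpha\in(0,1)$ let $\mathcal C^{\alpha}_{\rm ie}$ be the space of real functions $u$ that are continuous on $\widetilde M$ with $\sup_{p\ne p'}|u(p)-u(p')|/d_M(p,p')^{\alpha}<\infty$ (that is, $|u(p)-u(p')|\le C\,d_M(p,p')^\alpha$ for all $p,p'$ and some $C$), and let $$\mathcal C^{2+\alpha}_{\rm ie}=\{u\in \mathcal C^{\alpha}_{\rm ie}\;:\;\Delta u\in \mathcal C^{\alpha}_{\rm ie},\ x^{-1}\mathcal V_e u\in \mathcal C^{\alpha}_{\rm ie}\}.$$ Here derivatives are taken in the sense of distributions on $M$, $\Delta u$ and the first derivatives are identified with their continuous extensions to $\widetilde M$, and $x^{-1}\mathcal V_e$ (with $\mathcal V_e$ the edge vector fields, tangent at $\partial M$ to the fibres of $\phi$) is identified locally with its generators: $\partial_x,\partial_{y_i},x^{-1}\partial_{z_j}$ in local coordinates $(x,y,z)$ near $\partial M$,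 where $y$ is lifted from coordinates on $B$ and $z$ restricts to coordinates on the fibres, and the coordinate vector fields in the interior. **Theorem.** Let $g$ be a feasible incomplete edge metric, $\alpha\in(0,1)$, $u\in \mathcal C^{2+\alpha}_{\rm ie}$ and $p\in\widetilde M$; the point $p$ may lie on $\partial M$. If $u$ attains its minimum over $\widetilde M$ at $p$, then $(\Delta u)(p)\ge 0$. If $u$ attains its maximum over $\widetilde M$ at $p$, then $(\Delta u)(p)\le 0$. -/

import Mathlib

open Set MeasureTheory Bundle
open scoped Manifold ContDiff ENNReal NNReal

noncomputable section

namespace EdgeGeometry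

section Local

/-! ### Local coordinates, weak derivatives, the Laplace-Beltrami operator -/

variable {E : Type*} [NormedAddCommGroup E] [NormedSpace ℝ E] {H : Type*} [TopologicalSpace H]

/-- The partial derivative `∂ᵢ η` of a function on the coordinate space `ι → ℝ`. -/
def partialDeriv {ι : Type} [Fintype ι] [DecidableEq ι] (i : ι) (η : (ι → ℝ) → ℝ)
    (v : ι → ℝ) : ℝ :=
  fderiv ℝ η v (Pi.single i 1)

/-- Smooth functions with compact support in the set `Ω`. -/
def IsTestFunction {ι : Type} [Fintype ι] (Ω : Set (ι → ℝ)) (η : (ι → ℝ) → ℝ) : Prop :=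
  ContDiff ℝ ∞ η ∧ HasCompactSupport η ∧ tsupport η ⊆ Ω

/-- `∂ᵢ u = w` on `Ω` in the sense of distributions. -/
def IsWeakPartialDeriv {ι : Type} [Fintype ι] [DecidableEq ι] (Ω : Set (ι → ℝ)) (i : ι)
    (u w : (ι → ℝ) → ℝ) : Prop :=
  ∀ η : (ι → ℝ) → ℝ, IsTestFunction Ω η →
    ∫ v, u v * partialDeriv i η v = - ∫ v, w v * η v

/-- A smooth local coordinate system (written as a parametrization) of the interior of a manifold
`N`, possibly with boundary; the coordinates are labelled by the finite type `ι`. -/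
structure LocalCoord (I : ModelWithCorners ℝ E H) (N : Type*) [TopologicalSpace N]
    [ChartedSpace H N] (ι : Type) [Fintype ι] extends OpenPartialHomeomorph (ι → ℝ) N where
  target_subset : target ⊆ I.interior N
  smooth : ContMDiffOn 𝓘(ℝ, ι → ℝ) I ∞ toFun source
  smooth_inv : ContMDiffOn I 𝓘(ℝ, ι → ℝ) ∞ invFun target

variable {I : ModelWithCorners ℝ E H} {N : Type*} [TopologicalSpace N] [ChartedSpace H N]

/-- The matrix `(T_{ij})` of a 2-tensor `T` in local coordinates. -/
def coordMatrix (T : ∀ p : N, TangentSpace I p → TangentSpace I p → ℝ) {ι : Type} [Fintype ι]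
    [DecidableEq ι] (ψ : LocalCoord I N ι) (v : ι → ℝ) : Matrix ι ι ℝ :=
  Matrix.of fun i j =>
    T (ψ.toFun v)
      (mfderiv 𝓘(ℝ, ι → ℝ) I ψ.toFun v (Pi.single i (1 : ℝ) : ι → ℝ))
      (mfderiv 𝓘(ℝ, ι → ℝ) I ψ.toFun v (Pi.single j (1 : ℝ) : ι → ℝ))

/-- The volume density `√(det T)` in local coordinates. -/
def coordDensity (T : ∀ p : N, TangentSpace I p → TangentSpace I p → ℝ) {ι : Type} [Fintype ι]
    [DecidableEq ι] (ψ : LocalCoord I N ι) (v : ι → ℝ) : ℝ :=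
  √((coordMatrix T ψ v).det)

/-- The expression `∑ᵢ ∂ᵢ (√(det T) ∑ⱼ Tⁱʲ ∂ⱼ η)`, that is `√(det T) Δη`. -/
def coordDivGrad (T : ∀ p : N, TangentSpace I p → TangentSpace I p → ℝ) {ι : Type} [Fintype ι]
    [DecidableEq ι] (ψ : LocalCoord I N ι) (η : (ι → ℝ) → ℝ) (v : ι → ℝ) : ℝ :=
  ∑ i, partialDeriv i
    (fun w => coordDensity T ψ w * ∑ j, (coordMatrix T ψ w)⁻¹ i j * partialDeriv j η w) v

/-- `Δu = f` in the sense of distributions on the interior of `N`, where `Δ` is the (negative)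
Laplace-Beltrami operator of the Riemannian metric `T`: in all local coordinates,
`∫ u Δη dvol = ∫ f η dvol` for all test functions `η`. -/
def IsWeakLaplacian (T : ∀ p : N, TangentSpace I p → TangentSpace I p → ℝ) (u f : N → ℝ) : Prop :=
  ∀ (ι : Type) [Fintype ι] [DecidableEq ι] (ψ : LocalCoord I N ι) (η : (ι → ℝ) → ℝ),
    IsTestFunction ψ.source η →
      ∫ v, u (ψ.toFun v) * coordDivGrad T ψ η v =
        ∫ v, f (ψ.toFun v) * η v * coordDensity T ψ v

/-- The space of smooth functions `e` with `-Δe = μ e` (the condition is linear in `e`, so that the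
span adds nothing). -/
def eigenspace (T : ∀ p : N, TangentSpace I p → TangentSpace I p → ℝ) (μ : ℝ) :
    Submodule ℝ (N → ℝ) :=
  Submodule.span ℝ
    {e | ContMDiff I 𝓘(ℝ, ℝ) ∞ e ∧ IsWeakLaplacian T e (fun z => -(μ * e z))}

/-- The length of a curve `γ : [0,1] → N` with respect to a (possibly degenerate) metric. -/
def curveLength (T : ∀ p : N, TangentSpace I p → TangentSpace I p → ℝ) (γ : ℝ → N) : ℝ≥0∞ :=
  ∫⁻ t in Icc (0 : ℝ) 1, ENNReal.ofReal
    √(T (γ t) (mfderivWithin 𝓘(ℝ, ℝ) I γ (Icc 0 1) t (1 : ℝ))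
      (mfderivWithin 𝓘(ℝ, ℝ) I γ (Icc 0 1) t (1 : ℝ)))

/-- The distance defined by `T`: the infimum of the lengths of `C¹` curves between two points
(infinite if there are none). -/
def metricDist (T : ∀ p : N, TangentSpace I p → TangentSpace I p → ℝ) (p q : N) : ℝ≥0∞ :=
  ⨅ (γ : ℝ → N) (_ : ContMDiffOn 𝓘(ℝ, ℝ) I 1 γ (Icc 0 1) ∧ γ 0 = p ∧ γ 1 = q), curveLength T γ

/-- `u` is continuous on `O` with finite `α`-Hölder seminorm on `O`, for the distance given by
`T`. -/
def HolderOn (T : ∀ p : N, TangentSpace I p → TangentSpace I p → ℝ) (α : ℝ) (u : N → ℝ)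
    (O : Set N) : Prop :=
  ContinuousOn u O ∧ ∃ C : ℝ≥0, ∀ p ∈ O, ∀ q ∈ O,
    ENNReal.ofReal |u p - u q| ≤ C * metricDist T p q ^ α

variable [IsManifold I ∞ N]

/-- Smoothness (up to the boundary) of a 2-tensor field. -/
def IsSmoothTensor (T : ∀ p : N, TangentSpace I p →L[ℝ] TangentSpace I p →L[ℝ] ℝ) : Prop :=
  ContMDiff I (I.prod 𝓘(ℝ, E →L[ℝ] E →L[ℝ] ℝ)) ∞
    (fun p => TotalSpace.mk' (E →L[ℝ] E →L[ℝ] ℝ) p (T p))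

end Local

section Fibration

variable {b n : ℕ}
  {Y : Type*} [TopologicalSpace Y] [ChartedSpace (EuclideanSpace ℝ (Fin (b + n))) Y]
  {B : Type*} [TopologicalSpace B] [ChartedSpace (EuclideanSpace ℝ (Fin b)) B]
  {F : Type*} [TopologicalSpace F] [ChartedSpace (EuclideanSpace ℝ (Fin n)) F]

/-- A smooth local trivialization `V × F ≅ φ⁻¹(V)` of `φ : Y → B`. -/
structure LocalTriv (b n : ℕ) {Y B : Type*} (F : Type*)
    [TopologicalSpace Y] [ChartedSpace (EuclideanSpace ℝ (Fin (b + n))) Y]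
    [TopologicalSpace B] [ChartedSpace (EuclideanSpace ℝ (Fin b)) B]
    [TopologicalSpace F] [ChartedSpace (EuclideanSpace ℝ (Fin n)) F]
    (φ : Y → B) extends OpenPartialHomeomorph (B × F) Y where
  base : Set B
  isOpen_base : IsOpen base
  source_eq : source = base ×ˢ univ
  target_eq : target = φ ⁻¹' base
  proj_apply : ∀ y ∈ base, ∀ z : F, φ (toFun (y, z)) = y
  smooth : ContMDiffOn ((𝓡 b).prod (𝓡 n)) (𝓡 (b + n)) ∞ toFun source
  smooth_inv : ContMDiffOn (𝓡 (b + n)) ((𝓡 b).prod (𝓡 n)) ∞ invFun target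

/-- The 2-tensor on `F` obtained by pulling back the 2-tensor `T` on `Y` to the fibre over `y`. -/
def fibreTensor {φ : Y → B}
    (T : ∀ q : Y, TangentSpace (𝓡 (b + n)) q →L[ℝ] TangentSpace (𝓡 (b + n)) q →L[ℝ] ℝ)
    (τ : LocalTriv b n F φ) (y : B) :
    ∀ z : F, TangentSpace (𝓡 n) z → TangentSpace (𝓡 n) z → ℝ :=
  fun z v w => T (τ.toFun (y, z))
    (mfderiv (𝓡 n) (𝓡 (b + n)) (fun z' : F => τ.toFun (y, z')) z v)
    (mfderiv (𝓡 n) (𝓡 (b + n)) (fun z' : F => τ.toFun (y, z')) z w)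

/-- Local coordinates `(y, z)` of `Y` that are adapted to `φ`: the `y` are lifted from local
coordinates of `B`, so that the `z` restrict to local coordinates of the fibres. -/
def IsFibredCoord (φ : Y → B) (κ : LocalCoord (𝓡 (b + n)) Y (Fin b ⊕ Fin n)) : Prop :=
  ∃ β : LocalCoord (𝓡 b) B (Fin b), ∀ v ∈ κ.source,
    (fun i => v (Sum.inl i)) ∈ β.source ∧ φ (κ.toFun v) = β.toFun (fun i => v (Sum.inl i))

end Fibration

section Edge

variable (b n : ℕ)
  (M : Type*) [TopologicalSpace M] [ChartedSpace (EuclideanHalfSpace (b + n + 1)) M]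
  (Y : Type*) [TopologicalSpace Y] [ChartedSpace (EuclideanSpace ℝ (Fin (b + n))) Y]
  (B : Type*) [TopologicalSpace B] [ChartedSpace (EuclideanSpace ℝ (Fin b)) B]
  (F : Type*) [TopologicalSpace F] [ChartedSpace (EuclideanSpace ℝ (Fin n)) F]

/-- The resolution of an edge space: a manifold with boundary `M` (the resolved space; the open
stratum is its interior), whose boundary is identified with `Y`, the total space of a smooth
fibration `φ = proj : Y → B` with fibre `F`, together with a collar `[0,1) × Y ≅ 𝒰 ⊆ M` of the
boundary. The radial function `x` on `𝒰` is the first component of `collarInv`. -/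
structure EdgeSpace where
  collar : ℝ × Y → M
  collarInv : M → ℝ × Y
  collar_smooth :
    ContMDiffOn (𝓘(ℝ, ℝ).prod (𝓡 (b + n))) (𝓡∂ (b + n + 1)) ∞ collar (Ico (0 : ℝ) 1 ×ˢ univ)
  collarInv_smooth :
    ContMDiffOn (𝓡∂ (b + n + 1)) (𝓘(ℝ, ℝ).prod (𝓡 (b + n))) ∞ collarInv
      (collar '' (Ico (0 : ℝ) 1 ×ˢ univ))
  left_inv : ∀ a ∈ Ico (0 : ℝ) 1 ×ˢ (univ : Set Y), collarInv (collar a) = a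
  isOpen_collar : IsOpen (collar '' (Ico (0 : ℝ) 1 ×ˢ univ))
  boundary_eq : (𝓡∂ (b + n + 1)).boundary M = range fun q : Y => collar (0, q)
  proj : Y → B
  proj_smooth : ContMDiff (𝓡 (b + n)) (𝓡 b) ∞ proj
  locallyTrivial : ∀ y : B, ∃ τ : LocalTriv b n F proj, y ∈ τ.base

variable {b n M Y B F}
variable [IsManifold (𝓡∂ (b + n + 1)) ∞ M] [IsManifold (𝓡 (b + n)) ∞ Y] [IsManifold (𝓡 b) ∞ B]

/-- The quadratic form of the rigid metric `g₀ = dx² + x² g^F + φ^* g^B` at the point `(x, q)` of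
the collar, evaluated at the tangent vector `(a, v)`. -/
def rigidForm (S : EdgeSpace b n M Y B F)
    (gF : ∀ q : Y, TangentSpace (𝓡 (b + n)) q →L[ℝ] TangentSpace (𝓡 (b + n)) q →L[ℝ] ℝ)
    (gB : ContMDiffRiemannianMetric (𝓡 b) ∞ (EuclideanSpace ℝ (Fin b))
      (fun y : B => TangentSpace (𝓡 b) y))
    (x : ℝ) (q : Y) (a : ℝ) (v : TangentSpace (𝓡 (b + n)) q) : ℝ :=
  a ^ 2 + x ^ 2 * gF q v v +
    gB.inner (S.proj q) (mfderiv (𝓡 (b + n)) (𝓡 b) S.proj q v)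
      (mfderiv (𝓡 (b + n)) (𝓡 b) S.proj q v)

/-- The quadratic form of the pull-back of a 2-tensor on `M` under the collar map at `(x, q)`,
`x > 0`, evaluated at the tangent vector `(a, v)`. -/
def collarForm (S : EdgeSpace b n M Y B F)
    (g : ∀ p : M, TangentSpace (𝓡∂ (b + n + 1)) p →L[ℝ] TangentSpace (𝓡∂ (b + n + 1)) p →L[ℝ] ℝ)
    (x : ℝ) (q : Y) (a : ℝ) (v : TangentSpace (𝓡 (b + n)) q) : ℝ :=
  g (S.collar (x, q))
    (mfderiv (𝓘(ℝ, ℝ).prod (𝓡 (b + n))) (𝓡∂ (b + n + 1)) S.collar (x, q)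
      ((a, v) : ℝ × EuclideanSpace ℝ (Fin (b + n))))
    (mfderiv (𝓘(ℝ, ℝ).prod (𝓡 (b + n))) (𝓡∂ (b + n + 1)) S.collar (x, q)
      ((a, v) : ℝ × EuclideanSpace ℝ (Fin (b + n))))

/-- An incomplete edge metric `g`. It is a Riemannian metric on the interior of `M` and of the form
`g₀ + h` on the collar, `g₀ = dx² + x² g^F + φ^* g^B` being rigid, and `h` being smooth up to the
boundary with `|h|_{g₀}` vanishing at `x = 0`. As `g₀` is smooth up to `x = 0` (where it is
degenerate), smoothness of `h` means that `g` is smooth on `M` up to the boundary. The norm of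
the symmetric tensor `h` is expressed by the equivalent norm `sup |h(ξ,ξ)| / g₀(ξ,ξ)`. -/
structure EdgeMetric (S : EdgeSpace b n M Y B F) where
  g : ∀ p : M, TangentSpace (𝓡∂ (b + n + 1)) p →L[ℝ] TangentSpace (𝓡∂ (b + n + 1)) p →L[ℝ] ℝ
  smooth : IsSmoothTensor g
  symm : ∀ p v w, g p v w = g p w v
  pos : ∀ p ∈ (𝓡∂ (b + n + 1)).interior M, ∀ v, v ≠ 0 → 0 < g p v v
  gB : ContMDiffRiemannianMetric (𝓡 b) ∞ (EuclideanSpace ℝ (Fin b))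
    (fun y : B => TangentSpace (𝓡 b) y)
  gF : ∀ q : Y, TangentSpace (𝓡 (b + n)) q →L[ℝ] TangentSpace (𝓡 (b + n)) q →L[ℝ] ℝ
  gF_smooth : IsSmoothTensor gF
  gF_symm : ∀ q v w, gF q v w = gF q w v
  gF_pos : ∀ q v, mfderiv (𝓡 (b + n)) (𝓡 b) S.proj q v = 0 → v ≠ 0 → 0 < gF q v v
  /-- The metrics induced on the fibres have the same Laplace eigenvalues with multiplicities. -/
  isospectral : ∀ τ τ' : LocalTriv b n F S.proj, ∀ y ∈ τ.base, ∀ y' ∈ τ'.base, ∀ μ : ℝ,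
    Module.rank ℝ (eigenspace (fibreTensor gF τ y) μ) =
      Module.rank ℝ (eigenspace (fibreTensor gF τ' y') μ)
  vanishing : ∀ ε > 0, ∃ δ > 0, δ ≤ 1 ∧ ∀ x ∈ Ioo 0 δ, ∀ q a v,
    |collarForm S g x q a v - rigidForm S gF gB x q a v| ≤ ε * rigidForm S gF gB x q a v

/-- Feasible edge metrics. -/
structure EdgeMetric.Feasible {S : EdgeSpace b n M Y B F} (G : EdgeMetric S) : Prop where
  /-- `|h|_{g₀} = O(x²)` as `x → 0`. -/
  quadratic : ∃ C : ℝ, ∃ δ > 0, δ ≤ 1 ∧ ∀ x ∈ Ioo 0 δ, ∀ q a v,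
    |collarForm S G.g x q a v - rigidForm S G.gF G.gB x q a v| ≤
      C * x ^ 2 * rigidForm S G.gF G.gB x q a v
  /-- `φ : (Y, g^F + φ^* g^B) → (B, g^B)` is a Riemannian submersion: `dφ` is isometric on vectors
  that are orthogonal to the fibres. -/
  submersion : ∀ q v,
    (∀ w, mfderiv (𝓡 (b + n)) (𝓡 b) S.proj q w = 0 →
      G.gF q v w + G.gB.inner (S.proj q) (mfderiv (𝓡 (b + n)) (𝓡 b) S.proj q v)
        (mfderiv (𝓡 (b + n)) (𝓡 b) S.proj q w) = 0) →
    G.gF q v v + G.gB.inner (S.proj q) (mfderiv (𝓡 (b + n)) (𝓡 b) S.proj q v)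
        (mfderiv (𝓡 (b + n)) (𝓡 b) S.proj q v) =
      G.gB.inner (S.proj q) (mfderiv (𝓡 (b + n)) (𝓡 b) S.proj q v)
        (mfderiv (𝓡 (b + n)) (𝓡 b) S.proj q v)
  /-- Non-zero eigenvalues of (minus) the Laplacian of the fibres are larger than `n`. -/
  eigenvalue_gt : ∀ τ : LocalTriv b n F S.proj, ∀ y ∈ τ.base, ∀ μ : ℝ, μ ≠ 0 →
    eigenspace (fibreTensor G.gF τ y) μ ≠ ⊥ → (n : ℝ) < μ

/-- Coordinates `(x, y, z)` near the boundary, labelled by `Unit ⊕ Fin b ⊕ Fin n`, defined by the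
collar and local coordinates `(y, z)` of `Y`. -/
def edgeCoord (S : EdgeSpace b n M Y B F) (κ : LocalCoord (𝓡 (b + n)) Y (Fin b ⊕ Fin n))
    (v : Unit ⊕ Fin b ⊕ Fin n → ℝ) : M :=
  S.collar (v (Sum.inl ()), κ.toFun fun i => v (Sum.inr i))

/-- The factor `1`, `1`, `x` by which the generators `∂_x`, `∂_y`, `x⁻¹ ∂_z` of `x⁻¹ 𝒱_e` have to be
multiplied to give the coordinate vector fields. -/
def edgeFactor (v : Unit ⊕ Fin b ⊕ Fin n → ℝ) : Unit ⊕ Fin b ⊕ Fin n → ℝ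
  | Sum.inl _ => 1
  | Sum.inr (Sum.inl _) => 1
  | Sum.inr (Sum.inr _) => v (Sum.inl ())

namespace EdgeMetric

variable {S : EdgeSpace b n M Y B F} (G : EdgeMetric S)

/-- The metric as a family of functions of two tangent vectors. -/
def tensor : ∀ p : M, TangentSpace (𝓡∂ (b + n + 1)) p → TangentSpace (𝓡∂ (b + n + 1)) p → ℝ :=
  fun p v w => G.g p v w

/-- The Hölder space `C^α_ie`: functions that are continuous on the resolved space `M`, with finite
`α`-Hölder norm for the distance defined by the metric. -/
def MemHolder (α : ℝ) (u : M → ℝ) : Prop :=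
  HolderOn G.tensor α u univ

/-- `x⁻¹ 𝒱_e u ∈ C^α_ie`, where `𝒱_e` (the smooth vector fields that are tangent to the fibres of
the boundary) is identified locally with its generators: around each interior point there are local
coordinates such that the coordinate derivatives of `u` are Hölder functions, and around each
boundary point there are adapted coordinates `(x, y, z)` such that `∂_x u`, `∂_y u`, `x⁻¹ ∂_z u`
extend to Hölder functions up to the boundary. Derivatives are in the sense of distributions. -/
def EdgeDerivHolder (α : ℝ) (u : M → ℝ) : Prop :=
  (∀ p ∈ (𝓡∂ (b + n + 1)).interior M,
    ∃ ψ : LocalCoord (𝓡∂ (b + n + 1)) M (Unit ⊕ Fin b ⊕ Fin n),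
    ∃ O : Set M, IsOpen O ∧ p ∈ O ∧ O ⊆ ψ.target ∧
      ∀ i, ∃ w : M → ℝ, HolderOn G.tensor α w O ∧
        IsWeakPartialDeriv {v | v ∈ ψ.source ∧ ψ.toFun v ∈ O} i
          (fun v => u (ψ.toFun v)) (fun v => w (ψ.toFun v))) ∧
  (∀ q : Y, ∃ κ : LocalCoord (𝓡 (b + n)) Y (Fin b ⊕ Fin n),
    IsFibredCoord S.proj κ ∧ q ∈ κ.target ∧
    ∃ O : Set M, IsOpen O ∧ S.collar (0, q) ∈ O ∧
      ∀ i, ∃ w : M → ℝ, HolderOn G.tensor α w O ∧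
        IsWeakPartialDeriv
          {v | v (Sum.inl ()) ∈ Ioo 0 1 ∧ (fun j => v (Sum.inr j)) ∈ κ.source ∧
            edgeCoord S κ v ∈ O} i
          (fun v => u (edgeCoord S κ v)) (fun v => edgeFactor v i * w (edgeCoord S κ v)))

/-- The hybrid Hölder space `C^{2+α}_ie` of functions `u ∈ C^α_ie` with `Δu ∈ C^α_ie` and
`x⁻¹ 𝒱_e u ∈ C^α_ie`. -/
def MemHybridHolder (α : ℝ) (u : M → ℝ) : Prop :=
  G.MemHolder α u ∧ (∃ f : M → ℝ, G.MemHolder α f ∧ IsWeakLaplacian G.tensor u f) ∧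
    G.EdgeDerivHolder α u

end EdgeMetric

end Edge

end EdgeGeometry

end

/-! Suppose that `u` attains its minimum `m₀` at `p` although `Δu (p) < 0`. Then `Δu ≤ -c < 0` on an
open set `R` containing `p`. The contradiction comes from an energy estimate that needs only `C¹`
regularity of `u` in the interior and some volume growth, so it works in the same way in the
interior and at the singular boundary.

Let `ρ ≥ 0` be a barrier on `R` with `|dρ|² ≤ Kρ` whose small sublevel sets lie in a compact subset
of `R`. Put `w = u - m₀ + ερ` and test the weak equation with `((δ - w)⁺)²`. On `{w < δ}` one has
`⟨∇u, ∇w⟩ = |∇u|² + ε⟨∇u, ∇ρ⟩ ≥ -ε²Kρ/4 ≥ -εKδ/4`, because `ερ ≤ w`. Hence `c ∫ ((δ - w)⁺)² ≤ (εK/2)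
δ ∫ (δ - w)⁺` (`IsVolume.energy_le`). By Chebyshev's inequality the volume `V(δ)` of `{w < δ}` then
satisfies `V(δ/2) ≤ (2εK/c) V(δ)` (`measure_sublevel_half_le`). For small `ε` this decay is faster
than any prescribed power of `δ`, whereas `V(δ) ≥ c' δ^d` since `u` and `ρ` are Lipschitz in
suitable coordinates (`false_of_measure_decay`). The argument is assembled in
`IsVolume.false_of_supersolution`.

At an interior point `ρ` is the squared coordinate distance. At a boundary point three more facts
are needed.

Green's formula has no boundary term. The derivatives of `u` along `∂_x`, `∂_y`, `x⁻¹∂_z` are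
bounded, so `|∇u|` is bounded near the boundary. The volume of `{x < t}` is `O(t²)` because the
fibres have dimension `n ≥ 1` and shrink. Cut-offs in `x` have gradient of order `1/t` there, and
their contribution is `O(t)` (`exists_volume_collar_le`, `exists_cutoffSequence`).

The barrier is `x² + ∑ hᵢ(y)²`, where the `hᵢ` are functions on the base whose only common zero is
the image of `p`. It has the required gradient bound because it does not depend on the fibre
variable; the price is that it vanishes on the whole boundary fibre through `p` (`exists_barrier`).

The sign of `Δu` must therefore be known along that fibre. The fibre at height `x` has size `O(x)`,
so a Hölder function is locally constant on boundary fibres (`MemHolder.eventually_eq`). The part of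
the fibre where `Δu` takes its value at `p` is thus both open and closed in it, and `R` is taken
around this part only (`MemHolder.exists_separation`).

The statement on maxima is the one on minima for `-u`. -/

open Set MeasureTheory Bundle
open scoped Manifold ContDiff ENNReal NNReal

noncomputable section

namespace EdgeGeometry

/-! ### Mollification and weak derivatives on Euclidean space -/

section Mollification

open Filter Topology ContinuousLinearMap
open scoped Convolution

variable {ι : Type} [Fintype ι]

/-- A bump function on `ι → ℝ` supported in the ball of radius `r`. -/
def radiusBump (ι : Type) [Fintype ι] (r : ℝ) (hr : 0 < r) : ContDiffBump (0 : ι → ℝ) where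
  rIn := r / 2
  rOut := r
  rIn_pos := by positivity
  rIn_lt_rOut := by linarith

/-- The mollification of `g` at scale `r`. -/
def mollify (r : ℝ) (hr : 0 < r) (g : (ι → ℝ) → ℝ) : (ι → ℝ) → ℝ :=
  (radiusBump ι r hr).normed volume ⋆[lsmul ℝ ℝ, volume] g

theorem exists_mollify_close {g : (ι → ℝ) → ℝ} (hg : Continuous g) (hc : HasCompactSupport g)
    {ε : ℝ} (hε : 0 < ε) :
    ∃ r₀ > 0, ∀ r (hr : 0 < r), r ≤ r₀ → ∀ v, |mollify r hr g v - g v| ≤ ε := by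
  obtain ⟨δ, hδ, h⟩ := Metric.uniformContinuous_iff.1 (hc.uniformContinuous_of_continuous hg) ε hε
  refine ⟨δ, hδ, fun r hr hrδ v => ?_⟩
  rw [← Real.dist_eq]
  refine ContDiffBump.dist_normed_convolution_le hg.aestronglyMeasurable fun x hx => ?_
  exact (h (lt_of_lt_of_le (Metric.mem_ball.1 hx) hrδ)).le

theorem tsupport_mollify_subset {g : (ι → ℝ) → ℝ} {r : ℝ} (hr : 0 < r) : tsupport (mollify r hr g) ⊆ Metric.cthickening r (tsupport g) := by
  refine closure_minimal (fun v hv => ?_) Metric.isClosed_cthickening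
  have := support_convolution_subset (L := lsmul ℝ ℝ) (μ := volume)
    (f := (radiusBump ι r hr).normed volume) (g := g) hv
  obtain ⟨a, ha, c, hc', rfl⟩ := Set.mem_add.1 this
  rw [ContDiffBump.support_normed_eq] at ha
  refine Metric.mem_cthickening_of_dist_le _ c _ _ (subset_tsupport _ hc') ?_
  have : dist a 0 < r := ha
  simpa [dist_eq_norm] using this.le

theorem contDiff_mollify {g : (ι → ℝ) → ℝ} (hg : Continuous g) {r : ℝ} (hr : 0 < r) :
    ContDiff ℝ ∞ (mollify r hr g) :=
  HasCompactSupport.contDiff_convolution_left _ (radiusBump ι r hr).hasCompactSupport_normed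
    (radiusBump ι r hr).contDiff_normed hg.locallyIntegrable

theorem partialDeriv_mollify [DecidableEq ι] {g : (ι → ℝ) → ℝ} (hg : ContDiff ℝ 1 g) (hc : HasCompactSupport g)
    {r : ℝ} (hr : 0 < r) (i : ι) (v : ι → ℝ) :
    partialDeriv i (mollify r hr g) v = mollify r hr (partialDeriv i g) v := by
  have hli : LocallyIntegrable ((radiusBump ι r hr).normed volume) (volume : Measure (ι → ℝ)) :=
    ((radiusBump ι r hr).contDiff_normed (n := 0)).continuous.locallyIntegrable
  have h := hc.hasFDerivAt_convolution_right (lsmul ℝ ℝ) hli hg v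
  rw [partialDeriv, mollify, h.fderiv, convolution_precompR_apply _ hli (hc.fderiv ℝ)
    (hg.continuous_fderiv one_ne_zero)]
  rfl

/-- The weak derivative of a mollification is the mollification of the weak derivative. -/
theorem hasFDerivAt_mollify_of_weak [DecidableEq ι] {U : (ι → ℝ) → ℝ} {W : ι → (ι → ℝ) → ℝ} (hU : Continuous U)
    (hW : ∀ i, IsWeakPartialDeriv univ i U (W i)) {r : ℝ} (hr : 0 < r) (v : ι → ℝ) :
    HasFDerivAt (mollify r hr U)
      (∑ i, mollify r hr (W i) v • (ContinuousLinearMap.proj i : (ι → ℝ) →L[ℝ] ℝ)) v := by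
  set φ := (radiusBump ι r hr).normed (volume : Measure (ι → ℝ)) with hφ
  have hφs : ContDiff ℝ ∞ φ := (radiusBump ι r hr).contDiff_normed
  have hφc : HasCompactSupport φ := (radiusBump ι r hr).hasCompactSupport_normed
  have h := hφc.hasFDerivAt_convolution_right (lsmul ℝ ℝ).flip
    (μ := volume) (hU.locallyIntegrable) (hφs.of_le (by simp)) v
  rw [convolution_flip] at h
  refine h.congr_fderiv ?_
  refine ContinuousLinearMap.coe_injective ((Pi.basisFun ℝ ι).ext fun i => ?_)
  have e1 : ((U ⋆[((lsmul ℝ ℝ).flip).precompR (ι → ℝ), volume] fderiv ℝ φ) v) (Pi.single i 1) =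
      (U ⋆[(lsmul ℝ ℝ).flip, volume] fun a => fderiv ℝ φ a (Pi.single i 1)) v :=
    convolution_precompR_apply _ hU.locallyIntegrable (hφc.fderiv ℝ)
      (hφs.continuous_fderiv (by simp)) _ _
  -- Differentiating the convolution puts the derivative on the bump. The weak derivative is then
  -- used with the reflected bump `t ↦ φ (v - t)`; its partial derivative is minus that of `φ` at `v
  -- - t`, and this sign cancels the one in the definition.
  have hη : IsTestFunction univ (fun t => φ (v - t)) := by
    refine ⟨hφs.comp (contDiff_const.sub contDiff_id), ?_, subset_univ _⟩
    exact hφc.comp_homeomorph (Homeomorph.subLeft v)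
  have hd : ∀ t, partialDeriv i (fun t => φ (v - t)) t = - fderiv ℝ φ (v - t) (Pi.single i 1) := by
    intro t
    have h1 : HasFDerivAt φ (fderiv ℝ φ (v - t)) (v - t) :=
      (hφs.differentiable (by simp) _).hasFDerivAt
    have h2 : HasFDerivAt (fun t => φ (v - t)) _ t :=
      h1.comp t ((hasFDerivAt_const v t).sub (hasFDerivAt_id t))
    rw [partialDeriv, h2.fderiv]
    simp
  have hw := hW i _ hη
  simp only [hd, mul_neg, integral_neg, neg_inj] at hw
  have e2 : mollify r hr (W i) v = ∫ t, W i t * φ (v - t) := by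
    rw [mollify, ← convolution_flip]
    simp [convolution, hφ, mul_comm]
  have e3 : (∑ j, mollify r hr (W j) v • (ContinuousLinearMap.proj j : (ι → ℝ) →L[ℝ] ℝ))
      (Pi.single i 1) = mollify r hr (W i) v := by
    simp [Pi.single_apply]
  simp only [Pi.basisFun_apply, ContinuousLinearMap.coe_coe]
  rw [e1, e3, e2, ← hw]
  simp [convolution, mul_comm]

/-- The mollifications of `U` converge to `U`, and their derivatives, being mollifications of the `W
i`, converge uniformly. A uniform limit of derivatives is the derivative of the limit. Compact
support supplies the uniform continuity behind both convergences. -/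
theorem hasFDerivAt_of_weak_univ [DecidableEq ι] {U : (ι → ℝ) → ℝ} {W : ι → (ι → ℝ) → ℝ} (hU : Continuous U)
    (hUc : HasCompactSupport U) (hWcont : ∀ i, Continuous (W i)) (hWc : ∀ i, HasCompactSupport (W i))
    (hW : ∀ i, IsWeakPartialDeriv univ i U (W i)) (v : ι → ℝ) :
    HasFDerivAt U (∑ i, W i v • (ContinuousLinearMap.proj i : (ι → ℝ) →L[ℝ] ℝ)) v := by
  have hpos : ∀ k : ℕ, (0 : ℝ) < 1 / (k + 1) := fun k => Nat.one_div_pos_of_nat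
  have close : ∀ g : (ι → ℝ) → ℝ, Continuous g → HasCompactSupport g → ∀ ε > 0,
      ∀ᶠ k : ℕ in atTop, ∀ v, |mollify _ (hpos k) g v - g v| ≤ ε := by
    intro g hg hgc ε hε
    obtain ⟨r₀, hr₀, h⟩ := exists_mollify_close hg hgc hε
    filter_upwards [(tendsto_one_div_add_atTop_nhds_zero_nat (𝕜 := ℝ)).eventually
      (Iic_mem_nhds hr₀)] with k hk
    exact h _ _ hk
  refine hasFDerivAt_of_tendstoUniformly (l := atTop)
    (f := fun k : ℕ => mollify _ (hpos k) U)
    (f' := fun k v => ∑ i, mollify _ (hpos k) (W i) v •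
      (ContinuousLinearMap.proj i : (ι → ℝ) →L[ℝ] ℝ))
    (g' := fun v => ∑ i, W i v • (ContinuousLinearMap.proj i : (ι → ℝ) →L[ℝ] ℝ))
    ?_ (fun k v => hasFDerivAt_mollify_of_weak hU hW (hpos k) v) ?_ v
  · rw [Metric.tendstoUniformly_iff]
    intro ε hε
    set C : ℝ := ∑ i : ι, ‖(ContinuousLinearMap.proj i : (ι → ℝ) →L[ℝ] ℝ)‖ + 1 with hC
    have hCpos : 0 < C := by positivity
    filter_upwards [eventually_all.2 fun i => close (W i) (hWcont i) (hWc i) (ε / C / 2)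
      (by positivity)] with k hk x
    rw [dist_comm, dist_eq_norm, ← Finset.sum_sub_distrib]
    calc _ ≤ ∑ i, ε / C / 2 * ‖(ContinuousLinearMap.proj i : (ι → ℝ) →L[ℝ] ℝ)‖ := by
          refine norm_sum_le_of_le _ fun i _ => ?_
          rw [← sub_smul, norm_smul]
          exact mul_le_mul_of_nonneg_right (hk i x) (norm_nonneg _)
      _ = ε / C / 2 * (C - 1) := by rw [← Finset.mul_sum, hC]; ring
      _ ≤ ε / C / 2 * C := by gcongr; linarith
      _ = ε / 2 := by field_simp
      _ < ε := by linarith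
  · intro x
    rw [Metric.tendsto_nhds]
    intro ε hε
    filter_upwards [close U hU hUc (ε / 2) (by positivity)] with k hk
    rw [Real.dist_eq]
    linarith [hk x]

end Mollification

/-! ### From weak to classical derivatives; `C¹` test functions -/

section Euclidean

open Filter Topology

variable {ι : Type}

theorem continuous_mul_of_tsupport_subset {Ω : Set (ι → ℝ)} (hΩ : IsOpen Ω)
    {a η : (ι → ℝ) → ℝ} (ha : ContinuousOn a Ω) (hη : Continuous η) (hs : tsupport η ⊆ Ω) :
    Continuous fun v => a v * η v :=
  (ha.mul hη.continuousOn).continuous_of_tsupport_subset hΩ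
    ((tsupport_mul_subset_right (f := a) (g := η)).trans hs)

variable [Fintype ι]

theorem integrable_mul_of_tsupport_subset {Ω : Set (ι → ℝ)} (hΩ : IsOpen Ω)
    {a η : (ι → ℝ) → ℝ} (ha : ContinuousOn a Ω) (hη : Continuous η) (hc : HasCompactSupport η)
    (hs : tsupport η ⊆ Ω) : Integrable fun v => a v * η v :=
  (continuous_mul_of_tsupport_subset hΩ ha hη hs).integrable_of_hasCompactSupport
    (HasCompactSupport.mul_left hc)

variable [DecidableEq ι]

theorem tsupport_partialDeriv_subset (i : ι) (η : (ι → ℝ) → ℝ) :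
    tsupport (partialDeriv i η) ⊆ tsupport η :=
  (closure_mono fun v hv => by
    contrapose! hv
    simp only [Function.mem_support, not_not] at hv ⊢
    simp [partialDeriv, hv]).trans (tsupport_fderiv_subset ℝ (f := η))

theorem hasCompactSupport_partialDeriv (i : ι) {η : (ι → ℝ) → ℝ} (hc : HasCompactSupport η) :
    HasCompactSupport (partialDeriv i η) :=
  hc.of_isClosed_subset (isClosed_tsupport _) (tsupport_partialDeriv_subset i η)

theorem continuous_partialDeriv (i : ι) {η : (ι → ℝ) → ℝ} (h : ContDiff ℝ 1 η) :
    Continuous (partialDeriv i η) :=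
  (h.continuous_fderiv one_ne_zero).clm_apply continuous_const

/-- A function with continuous weak partial derivatives is differentiable. -/
theorem hasFDerivAt_of_weak {Ω : Set (ι → ℝ)} (hΩ : IsOpen Ω) {u : (ι → ℝ) → ℝ}
    {w : ι → (ι → ℝ) → ℝ} (hu : ContinuousOn u Ω) (hw : ∀ i, ContinuousOn (w i) Ω)
    (hweak : ∀ i, IsWeakPartialDeriv Ω i u (w i)) {v₀ : ι → ℝ} (hv₀ : v₀ ∈ Ω) :
    HasFDerivAt u (∑ i, w i v₀ • (ContinuousLinearMap.proj i : (ι → ℝ) →L[ℝ] ℝ)) v₀ := by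
  obtain ⟨r, hr, hball⟩ := Metric.nhds_basis_closedBall.mem_iff.1 (hΩ.mem_nhds hv₀)
  -- Localization: `ζ` equals `1` near `v₀`, and `u ζ` has the global weak derivatives `w i ζ + u
  -- ∂ᵢζ`, as one sees by testing `u` with `ζ η`. At `v₀` the second term vanishes.
  let ζ : ContDiffBump v₀ := ⟨r / 2, r, by positivity, by linarith⟩
  have hζs : tsupport ζ ⊆ Ω := by rw [ζ.tsupport_eq]; exact hball
  have hζ : ContDiff ℝ ∞ ζ := ζ.contDiff
  have hζc : HasCompactSupport ζ := ζ.hasCompactSupport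
  have hζ1 : ContDiff ℝ 1 ζ := hζ.of_le (by simp)
  have hds : ∀ i, tsupport (partialDeriv i ζ) ⊆ Ω := fun i =>
    (tsupport_partialDeriv_subset i _).trans hζs
  have h := hasFDerivAt_of_weak_univ (U := fun v => u v * ζ v)
    (W := fun i v => w i v * ζ v + u v * partialDeriv i ζ v)
    (continuous_mul_of_tsupport_subset hΩ hu hζ.continuous hζs)
    (HasCompactSupport.mul_left hζc)
    (fun i => (continuous_mul_of_tsupport_subset hΩ (hw i) hζ.continuous hζs).add
      (continuous_mul_of_tsupport_subset hΩ hu (continuous_partialDeriv i hζ1) (hds i)))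
    (fun i => (HasCompactSupport.mul_left hζc).add
      (HasCompactSupport.mul_left (hasCompactSupport_partialDeriv i hζc))) ?_ v₀
  · have hev : ζ =ᶠ[𝓝 v₀] 1 := ζ.eventuallyEq_one
    have hd : ∀ i, partialDeriv i ζ v₀ = 0 := fun i => by
      rw [partialDeriv, hev.fderiv_eq]; simp
    have h1 : ζ v₀ = 1 := hev.self_of_nhds
    simp only [hd, h1, mul_one, mul_zero, add_zero] at h
    refine h.congr_of_eventuallyEq ?_
    filter_upwards [hev] with v hv
    simp [hv]
  · intro i η hη
    have hη1 : ContDiff ℝ 1 η := hη.1.of_le (by simp)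
    have hprod : IsTestFunction Ω (fun v => ζ v * η v) :=
      ⟨hζ.mul hη.1, HasCompactSupport.mul_right hζc, (tsupport_mul_subset_left).trans hζs⟩
    have hpd : ∀ v, partialDeriv i (fun v => ζ v * η v) v =
        ζ v * partialDeriv i η v + η v * partialDeriv i ζ v := by
      intro v
      have := ((hζ1.differentiable one_ne_zero v).hasFDerivAt.mul
        (hη1.differentiable one_ne_zero v).hasFDerivAt).fderiv
      rw [partialDeriv]
      erw [this]
      simp [partialDeriv]
    have hw' := hweak i _ hprod
    have i1 : Integrable fun v => u v * (ζ v * partialDeriv i η v) :=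
      integrable_mul_of_tsupport_subset hΩ hu (hζ.continuous.mul (continuous_partialDeriv i hη1))
        (HasCompactSupport.mul_right hζc) (tsupport_mul_subset_left.trans hζs)
    have i2 : Integrable fun v => u v * (partialDeriv i ζ v * η v) :=
      integrable_mul_of_tsupport_subset hΩ hu ((continuous_partialDeriv i hζ1).mul hη.1.continuous)
        (HasCompactSupport.mul_left hη.2.1) (tsupport_mul_subset_left.trans (hds i))
    have i3 : Integrable fun v => w i v * (ζ v * η v) :=
      integrable_mul_of_tsupport_subset hΩ (hw i) (hζ.continuous.mul hη.1.continuous)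
        (HasCompactSupport.mul_right hζc) (tsupport_mul_subset_left.trans hζs)
    have e1 : ∫ v, u v * partialDeriv i (fun v => ζ v * η v) v =
        (∫ v, u v * (ζ v * partialDeriv i η v)) + ∫ v, u v * (partialDeriv i ζ v * η v) := by
      rw [← integral_add i1 i2]
      refine integral_congr_ae (Eventually.of_forall fun v => ?_)
      simp only [hpd]; ring
    have e2 : ∫ v, (w i v * ζ v + u v * partialDeriv i ζ v) * η v =
        (∫ v, w i v * (ζ v * η v)) + ∫ v, u v * (partialDeriv i ζ v * η v) := by
      rw [← integral_add i3 i2]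
      exact integral_congr_ae (Eventually.of_forall fun v => by ring)
    have e3 : ∫ v, u v * ζ v * partialDeriv i η v = ∫ v, u v * (ζ v * partialDeriv i η v) :=
      integral_congr_ae (Eventually.of_forall fun v => by ring)
    rw [e3, e2]
    linarith

theorem contDiffOn_of_weak {Ω : Set (ι → ℝ)} (hΩ : IsOpen Ω) {u : (ι → ℝ) → ℝ}
    {w : ι → (ι → ℝ) → ℝ} (hu : ContinuousOn u Ω) (hw : ∀ i, ContinuousOn (w i) Ω)
    (hweak : ∀ i, IsWeakPartialDeriv Ω i u (w i)) : ContDiffOn ℝ 1 u Ω := by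
  rw [show (1 : WithTop ℕ∞) = 0 + 1 by rfl, contDiffOn_succ_iff_fderiv_of_isOpen hΩ]
  have hd : ∀ v ∈ Ω, HasFDerivAt u _ v := fun v hv => hasFDerivAt_of_weak hΩ hu hw hweak hv
  refine ⟨fun v hv => (hd v hv).differentiableAt.differentiableWithinAt, by simp, ?_⟩
  rw [contDiffOn_zero]
  refine ContinuousOn.congr (f := fun v => ∑ i, w i v •
    (ContinuousLinearMap.proj i : (ι → ℝ) →L[ℝ] ℝ)) ?_ fun v hv => (hd v hv).fderiv
  exact continuousOn_finsetSum _ fun i _ => (hw i).smul continuousOn_const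

theorem integral_mul_partialDeriv_eq {Ω : Set (ι → ℝ)} (hΩ : IsOpen Ω) (i : ι)
    {u F : (ι → ℝ) → ℝ} (hu : ContDiffOn ℝ 1 u Ω) (hF : ContDiff ℝ 1 F)
    (hc : HasCompactSupport F) (hs : tsupport F ⊆ Ω) :
    ∫ v, u v * partialDeriv i F v = - ∫ v, partialDeriv i u v * F v := by
  have hdu : ContinuousOn (partialDeriv i u) Ω :=
    (hu.continuousOn_fderiv_of_isOpen hΩ le_rfl).clm_apply continuousOn_const
  exact integral_mul_fderiv_eq_neg_fderiv_mul_of_integrable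
    (integrable_mul_of_tsupport_subset hΩ hdu hF.continuous hc hs)
    (integrable_mul_of_tsupport_subset hΩ hu.continuousOn (continuous_partialDeriv i hF)
      (hasCompactSupport_partialDeriv i hc) ((tsupport_partialDeriv_subset i F).trans hs))
    (integrable_mul_of_tsupport_subset hΩ hu.continuousOn hF.continuous hc hs)
    (fun v hv => (hu.contDiffAt (hΩ.mem_nhds (hs hv))).differentiableAt one_ne_zero)
    (fun v _ => hF.differentiable one_ne_zero v)

/-- An integral identity for smooth test functions extends to `C¹` test functions. -/
theorem integral_identity_of_smooth {Ω : Set (ι → ℝ)} (hΩ : IsOpen Ω) {a : ι → (ι → ℝ) → ℝ}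
    {h : (ι → ℝ) → ℝ} (ha : ∀ i, ContinuousOn (a i) Ω) (hh : ContinuousOn h Ω)
    (H : ∀ η, IsTestFunction Ω η → ∫ v, ((∑ i, a i v * partialDeriv i η v) + h v * η v) = 0)
    {η : (ι → ℝ) → ℝ} (hη : ContDiff ℝ 1 η) (hc : HasCompactSupport η) (hs : tsupport η ⊆ Ω) :
    ∫ v, ((∑ i, a i v * partialDeriv i η v) + h v * η v) = 0 := by
  obtain ⟨r₁, hr₁, hr₁Ω⟩ := IsCompact.exists_cthickening_subset_open hc hΩ hs
  set K := Metric.cthickening r₁ (tsupport η) with hK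
  have hKc : IsCompact K := IsCompact.cthickening hc
  have int : ∀ η : (ι → ℝ) → ℝ, ContDiff ℝ 1 η → HasCompactSupport η → tsupport η ⊆ Ω →
      Integrable fun v => (∑ i, a i v * partialDeriv i η v) + h v * η v := by
    intro η hη hc hs
    refine (integrable_finsetSum _ fun i _ => ?_).add
      (integrable_mul_of_tsupport_subset hΩ hh hη.continuous hc hs)
    exact integrable_mul_of_tsupport_subset hΩ (ha i) (continuous_partialDeriv i hη)
      (hasCompactSupport_partialDeriv i hc) ((tsupport_partialDeriv_subset i η).trans hs)
  obtain ⟨C, hC⟩ : ∃ C : ℝ, ∀ v ∈ K, (∑ i, |a i v|) + |h v| ≤ C := by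
    have : ContinuousOn (fun v => (∑ i, |a i v|) + |h v|) K :=
      (continuousOn_finsetSum _ fun i _ => ((ha i).mono hr₁Ω).abs).add (hh.mono hr₁Ω).abs
    obtain ⟨C, hC⟩ := hKc.bddAbove_image this
    exact ⟨C, fun v hv => hC (mem_image_of_mem _ hv)⟩
  by_contra hne
  set A := ∫ v, ((∑ i, a i v * partialDeriv i η v) + h v * η v) with hA
  set V := volume.real K
  have hV : 0 ≤ V := measureReal_nonneg
  -- If the integral `A` were not zero, a mollification of `η` that is `|A| / (2D)`-close to it in
  -- `C¹` would change the integral by at most `|A| / 2`. But the integral for the mollified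
  -- function is zero. The summand `1` only keeps `D` positive.
  set D := (max C 0) * V + 1 with hD
  have hDpos : 0 < D := by positivity
  have hApos : 0 < |A| := abs_pos.2 hne
  obtain ⟨ρ₀, hρ₀, hcl₀⟩ := exists_mollify_close hη.continuous hc (ε := |A| / (2 * D)) (by positivity)
  have hcl := fun i => exists_mollify_close (continuous_partialDeriv i hη)
    (hasCompactSupport_partialDeriv i hc) (ε := |A| / (2 * D)) (by positivity)
  choose ρ hρ hcl using hcl
  obtain ⟨r, hr, hr1, hr0, hri⟩ : ∃ r > 0, r ≤ r₁ ∧ r ≤ ρ₀ ∧ ∀ i, r ≤ ρ i := by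
    have : ∀ᶠ r in 𝓝[>] (0 : ℝ), r ≤ r₁ ∧ r ≤ ρ₀ ∧ ∀ i, r ≤ ρ i := by
      refine Filter.Eventually.filter_mono nhdsWithin_le_nhds ?_
      exact (eventually_le_nhds hr₁).and ((eventually_le_nhds hρ₀).and
        (eventually_all.2 fun i => eventually_le_nhds (hρ i)))
    obtain ⟨r, hr, hr'⟩ := (this.and self_mem_nhdsWithin).exists
    exact ⟨r, hr', hr⟩
  set η' := mollify r hr η
  have hη' : ContDiff ℝ ∞ η' := contDiff_mollify hη.continuous hr
  have hη1 : ContDiff ℝ 1 η' := hη'.of_le (by simp)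
  have hs' : tsupport η' ⊆ K := (tsupport_mollify_subset hr).trans (Metric.cthickening_mono hr1 _)
  have hsK : tsupport η ⊆ K := Metric.self_subset_cthickening _
  have hc' : HasCompactSupport η' := hKc.of_isClosed_subset (isClosed_tsupport _) hs'
  have h0 := H η' ⟨hη', hc', hs'.trans hr₁Ω⟩
  have key : ‖A - ∫ v, ((∑ i, a i v * partialDeriv i η' v) + h v * η' v)‖ ≤ |A| / (2 * D) * (max C 0) * V := by
    rw [hA, ← integral_sub (int η hη hc hs) (int η' hη1 hc' (hs'.trans hr₁Ω)),
      ← setIntegral_eq_integral_of_forall_compl_eq_zero (s := K)]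
    · refine norm_setIntegral_le_of_norm_le_const hKc.measure_lt_top fun v hv => ?_
      have e : ((∑ i, a i v * partialDeriv i η v) + h v * η v) -
          ((∑ i, a i v * partialDeriv i η' v) + h v * η' v) =
          (∑ i, a i v * (partialDeriv i η v - partialDeriv i η' v)) + h v * (η v - η' v) := by
        simp only [mul_sub, Finset.sum_sub_distrib]; ring
      rw [e]
      calc _ ≤ (∑ i, |a i v| * (|A| / (2 * D))) + |h v| * (|A| / (2 * D)) := by
            refine (norm_add_le _ _).trans (add_le_add (norm_sum_le_of_le _ fun i _ => ?_) ?_)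
            · rw [norm_mul, Real.norm_eq_abs, Real.norm_eq_abs, abs_sub_comm,
                partialDeriv_mollify hη hc]
              exact mul_le_mul_of_nonneg_left (hcl i r hr (hri i) v) (abs_nonneg _)
            · rw [norm_mul, Real.norm_eq_abs, Real.norm_eq_abs, abs_sub_comm]
              exact mul_le_mul_of_nonneg_left (hcl₀ r hr hr0 v) (abs_nonneg _)
        _ = ((∑ i, |a i v|) + |h v|) * (|A| / (2 * D)) := by rw [add_mul, Finset.sum_mul]
        _ ≤ max C 0 * (|A| / (2 * D)) := by
            gcongr; exact (hC v hv).trans (le_max_left _ _)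
        _ = _ := by ring
    · intro v hv
      have h1 : ∀ i, partialDeriv i η v = 0 := fun i => image_eq_zero_of_notMem_tsupport
        fun h => hv (hsK (tsupport_partialDeriv_subset i η h))
      have h2 : ∀ i, partialDeriv i η' v = 0 := fun i => image_eq_zero_of_notMem_tsupport
        fun h => hv (hs' (tsupport_partialDeriv_subset i η' h))
      have h3 : η v = 0 := image_eq_zero_of_notMem_tsupport fun h => hv (hsK h)
      have h4 : η' v = 0 := image_eq_zero_of_notMem_tsupport fun h => hv (hs' h)
      simp [h1, h2, h3, h4]
  rw [h0, sub_zero, Real.norm_eq_abs] at key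
  have : |A| / (2 * D) * (max C 0) * V ≤ |A| / 2 := by
    calc _ = |A| / (2 * D) * (max C 0 * V) := by ring
      _ ≤ |A| / (2 * D) * D := by gcongr; linarith
      _ = |A| / 2 := by field_simp
  linarith

end Euclidean

/-! ### Coordinate frames of a manifold -/

section Frame

open Filter Topology

theorem contMDiff_constSection {V : Type*} [NormedAddCommGroup V] [NormedSpace ℝ V] (ξ : V) :
    ContMDiff 𝓘(ℝ, V) (𝓘(ℝ, V).prod 𝓘(ℝ, V)) ∞
      (fun v : V => TotalSpace.mk' V (E := TangentSpace 𝓘(ℝ, V)) v ξ) :=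
  contMDiff_vectorSpace_iff_contDiff.2 contDiff_const

variable {E : Type*} [NormedAddCommGroup E] [NormedSpace ℝ E] {H : Type*} [TopologicalSpace H]
  {I : ModelWithCorners ℝ E H} {N : Type*} [TopologicalSpace N] [ChartedSpace H N]
  {ι : Type} [Fintype ι]

namespace LocalCoord

variable (ψ : LocalCoord I N ι) {v : ι → ℝ}

/-- The derivative of the parametrization `ψ` at `v`. -/
def frame (v : ι → ℝ) : (ι → ℝ) →L[ℝ] TangentSpace I (ψ.toFun v) :=
  mfderiv 𝓘(ℝ, ι → ℝ) I ψ.toFun v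

theorem mdifferentiableAt (hv : v ∈ ψ.source) :
    MDifferentiableAt 𝓘(ℝ, ι → ℝ) I ψ.toFun v :=
  ((ψ.smooth v hv).contMDiffAt (ψ.open_source.mem_nhds hv)).mdifferentiableAt (by simp)

theorem mem_target (hv : v ∈ ψ.source) : ψ.toFun v ∈ ψ.target := ψ.map_source' hv

theorem inv_toFun (hv : v ∈ ψ.source) : ψ.invFun (ψ.toFun v) = v := ψ.left_inv' hv

theorem toFun_inv {p : N} (hp : p ∈ ψ.target) : ψ.toFun (ψ.invFun p) = p := ψ.right_inv' hp

theorem inv_mem {p : N} (hp : p ∈ ψ.target) : ψ.invFun p ∈ ψ.source := ψ.map_target' hp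

theorem contMDiffAt_inv {p : N} (hp : p ∈ ψ.target) : ContMDiffAt I 𝓘(ℝ, ι → ℝ) ∞ ψ.invFun p :=
  (ψ.smooth_inv p hp).contMDiffAt (ψ.open_target.mem_nhds hp)

theorem mdifferentiableAt_inv (hv : v ∈ ψ.source) :
    MDifferentiableAt I 𝓘(ℝ, ι → ℝ) ψ.invFun (ψ.toFun v) :=
  (ψ.contMDiffAt_inv (ψ.mem_target hv)).mdifferentiableAt (by simp)

theorem frame_injective (hv : v ∈ ψ.source) : Function.Injective (ψ.frame v) := by
  have hev : ψ.invFun ∘ ψ.toFun =ᶠ[𝓝 v] id :=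
    Filter.eventuallyEq_of_mem (ψ.open_source.mem_nhds hv) fun w hw => ψ.inv_toFun hw
  have h := mfderiv_comp v (ψ.mdifferentiableAt_inv hv) (ψ.mdifferentiableAt hv)
  rw [hev.mfderiv_eq, mfderiv_id] at h
  intro a c hac
  have ha := DFunLike.congr_fun h a
  have hc := DFunLike.congr_fun h c
  have e : mfderiv I 𝓘(ℝ, ι → ℝ) ψ.invFun (ψ.toFun v) (ψ.frame v a) =
    mfderiv I 𝓘(ℝ, ι → ℝ) ψ.invFun (ψ.toFun v) (ψ.frame v c) := by rw [hac]
  exact ha.trans (e.trans hc.symm)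

theorem frame_surjective (hv : v ∈ ψ.source) : Function.Surjective (ψ.frame v) := by
  have hp := ψ.mem_target hv
  have hev : ψ.toFun ∘ ψ.invFun =ᶠ[𝓝 (ψ.toFun v)] id :=
    Filter.eventuallyEq_of_mem (ψ.open_target.mem_nhds hp) fun w hw => ψ.toFun_inv hw
  have hv' : ψ.invFun (ψ.toFun v) = v := ψ.inv_toFun hv
  have h := mfderiv_comp_of_eq (I' := 𝓘(ℝ, ι → ℝ)) (ψ.mdifferentiableAt hv)
    (ψ.mdifferentiableAt_inv hv) hv'
  rw [hev.mfderiv_eq, mfderiv_id] at h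
  intro ξ
  refine ⟨mfderiv I 𝓘(ℝ, ι → ℝ) ψ.invFun (ψ.toFun v) ξ, ?_⟩
  -- The derivatives of `ψ` at `ψ⁻¹(ψ(v))` and at `v` have values in formally different tangent
  -- spaces; they are compared in the model space `E`.
  have key : ∀ w, w = v → ∀ ζ : ι → ℝ,
      (mfderiv 𝓘(ℝ, ι → ℝ) I ψ.toFun w ζ : E) = mfderiv 𝓘(ℝ, ι → ℝ) I ψ.toFun v ζ := by
    rintro _ rfl ζ; rfl
  exact (key _ hv' _).symm.trans (DFunLike.congr_fun h ξ).symm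

theorem fderiv_comp {f : N → ℝ} (hv : v ∈ ψ.source)
    (hf : MDifferentiableAt I 𝓘(ℝ, ℝ) f (ψ.toFun v)) (ξ : ι → ℝ) :
    fderiv ℝ (fun w => f (ψ.toFun w)) v ξ = mfderiv I 𝓘(ℝ, ℝ) f (ψ.toFun v) (ψ.frame v ξ) := by
  have h := mfderiv_comp v hf (ψ.mdifferentiableAt hv)
  rw [mfderiv_eq_fderiv] at h
  exact DFunLike.congr_fun h ξ

theorem contDiffOn_comp {k : WithTop ℕ∞} (hk : k ≤ (∞ : WithTop ℕ∞)) {f : N → ℝ} {s : Set N}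
    (hf : ContMDiffOn I 𝓘(ℝ, ℝ) k f s) {Ω : Set (ι → ℝ)} (hΩ : Ω ⊆ ψ.source)
    (hs : ∀ v ∈ Ω, ψ.toFun v ∈ s) : ContDiffOn ℝ k (fun w => f (ψ.toFun w)) Ω :=
  contMDiffOn_iff_contDiffOn.1 (hf.comp ((ψ.smooth.of_le hk).mono hΩ) hs)

/-- The field is the tangent map of `ψ` composed with a constant section, and the tangent map of a
smooth map is smooth. -/
theorem contMDiffOn_frame [IsManifold I ∞ N] (ξ : ι → ℝ) :
    ContMDiffOn 𝓘(ℝ, ι → ℝ) (I.prod 𝓘(ℝ, E)) ∞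
      (fun v => TotalSpace.mk' E (E := TangentSpace I) (ψ.toFun v) (ψ.frame v ξ)) ψ.source := by
  have h := ψ.smooth.contMDiffOn_tangentMapWithin (m := (∞ : WithTop ℕ∞)) (by simp)
    (ψ.open_source.uniqueMDiffOn (I := 𝓘(ℝ, ι → ℝ)))
  have h2 := h.comp ((contMDiff_constSection ξ).contMDiffOn (s := ψ.source)) (fun v hv => hv)
  refine h2.congr fun v hv => ?_
  simp only [Function.comp, tangentMapWithin, TotalSpace.mk', frame]
  rw [mfderivWithin_of_isOpen ψ.open_source hv]
  rfl

theorem contDiffOn_bilin [IsManifold I ∞ N]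
    {g : ∀ p : N, TangentSpace I p →L[ℝ] TangentSpace I p →L[ℝ] ℝ} (hg : IsSmoothTensor g)
    (ξ ζ : ι → ℝ) :
    ContDiffOn ℝ ∞ (fun v => g (ψ.toFun v) (ψ.frame v ξ) (ψ.frame v ζ)) ψ.source := by
  have h := ContMDiffOn.clm_bundle_apply₂ (F₃ := ℝ) (E₃ := Trivial N ℝ) 
    (hg.comp_contMDiffOn ψ.smooth) (ψ.contMDiffOn_frame ξ) (ψ.contMDiffOn_frame ζ)
  rw [← contMDiffOn_iff_contDiffOn]
  intro v hv
  have := (contMDiffWithinAt_totalSpace.1 (h v hv)).2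
  exact this

end LocalCoord

end Frame

/-! ### Metric, gradient and the weak Laplace equation in one coordinate system -/

section Metric

open Filter Topology Matrix

variable {E : Type*} [NormedAddCommGroup E] [NormedSpace ℝ E] {H : Type*} [TopologicalSpace H]
  {I : ModelWithCorners ℝ E H} {N : Type*} [TopologicalSpace N] [ChartedSpace H N]
  {ι : Type} [Fintype ι] [DecidableEq ι]

theorem map_eq_sum_single {V : Type*} [AddCommGroup V] [Module ℝ V] [TopologicalSpace V]
    (L : (ι → ℝ) →L[ℝ] V) (ξ : ι → ℝ) : L ξ = ∑ i, ξ i • L (Pi.single i 1) := by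
  conv_lhs => rw [← (Pi.basisFun ℝ ι).sum_repr ξ]
  simp

/-- The quadratic form of a smooth tensor in coordinates. -/
theorem dotProduct_coordMatrix
    (g : ∀ p : N, TangentSpace I p →L[ℝ] TangentSpace I p →L[ℝ] ℝ) (ψ : LocalCoord I N ι)
    (v ξ ζ : ι → ℝ) :
    ξ ⬝ᵥ (coordMatrix (fun p a c => g p a c) ψ v *ᵥ ζ) =
      g (ψ.toFun v) (ψ.frame v ξ) (ψ.frame v ζ) := by
  rw [map_eq_sum_single (ψ.frame v) ξ, map_eq_sum_single (ψ.frame v) ζ]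
  simp only [dotProduct, mulVec, coordMatrix, Matrix.of_apply, map_sum, map_smul,
    _root_.sum_apply, _root_.smul_apply, smul_eq_mul, Finset.mul_sum]
  refine Finset.sum_comm.trans (Finset.sum_congr rfl fun i _ => Finset.sum_congr rfl fun j _ => ?_)
  have h : ∀ a x c : ℝ, a * (x * c) = c * (a * x) := fun a x c => by ring
  exact h _ _ _

variable [IsManifold I ∞ N]

theorem contDiffOn_coordMatrix
    {g : ∀ p : N, TangentSpace I p →L[ℝ] TangentSpace I p →L[ℝ] ℝ} (hg : IsSmoothTensor g)
    (ψ : LocalCoord I N ι) (i j : ι) :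
    ContDiffOn ℝ ∞ (fun v => coordMatrix (fun p a c => g p a c) ψ v i j) ψ.source :=
  ψ.contDiffOn_bilin hg (Pi.single i 1) (Pi.single j 1)

variable (I N) in
/-- A smooth symmetric 2-tensor that is positive definite on the interior of a manifold. -/
structure InteriorMetric where
  g : ∀ p : N, TangentSpace I p →L[ℝ] TangentSpace I p →L[ℝ] ℝ
  smooth : IsSmoothTensor g
  symm : ∀ p v w, g p v w = g p w v
  pos : ∀ p ∈ I.interior N, ∀ v, v ≠ 0 → 0 < g p v v

namespace InteriorMetric

variable (m : InteriorMetric I N) (ψ : LocalCoord I N ι) {v : ι → ℝ}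

/-- The metric as a family of functions of two tangent vectors. -/
def tensor : ∀ p : N, TangentSpace I p → TangentSpace I p → ℝ := fun p v w => m.g p v w

theorem isSymm_coordMatrix (v : ι → ℝ) : (coordMatrix m.tensor ψ v).IsSymm :=
  Matrix.IsSymm.ext fun _ _ => m.symm _ _ _

theorem posDef_coordMatrix (hv : v ∈ ψ.source) : (coordMatrix m.tensor ψ v).PosDef := by
  refine Matrix.PosDef.of_dotProduct_mulVec_pos (m.isSymm_coordMatrix ψ v) fun ξ hξ => ?_
  rw [star_trivial]
  refine lt_of_lt_of_eq ?_ (dotProduct_coordMatrix m.g ψ v ξ ξ).symm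
  refine m.pos _ (ψ.target_subset (ψ.mem_target hv)) _ fun h => hξ ?_
  exact ψ.frame_injective hv (h.trans (map_zero _).symm)

theorem det_coordMatrix_pos (hv : v ∈ ψ.source) : 0 < (coordMatrix m.tensor ψ v).det :=
  (m.posDef_coordMatrix ψ hv).det_pos

theorem coordDensity_pos (hv : v ∈ ψ.source) : 0 < coordDensity m.tensor ψ v :=
  Real.sqrt_pos.2 (m.det_coordMatrix_pos ψ hv)

theorem contDiffOn_det : ContDiffOn ℝ ∞ (fun v => (coordMatrix m.tensor ψ v).det) ψ.source := by
  simp only [Matrix.det_apply]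
  refine ContDiffOn.sum fun σ _ => ?_
  refine ContDiffOn.const_smul _ ?_
  exact contDiffOn_prod fun i _ => contDiffOn_coordMatrix m.smooth ψ _ _

theorem contDiffOn_density : ContDiffOn ℝ ∞ (coordDensity m.tensor ψ) ψ.source :=
  (m.contDiffOn_det ψ).sqrt fun _ hv => (m.det_coordMatrix_pos ψ hv).ne'

/-- Cramer's rule: an entry of the inverse is a quotient of two determinants, which are polynomials
in the smooth entries of the matrix. -/
theorem contDiffOn_inv (i j : ι) :
    ContDiffOn ℝ ∞ (fun v => (coordMatrix m.tensor ψ v)⁻¹ i j) ψ.source := by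
  have h : ∀ v ∈ ψ.source, (coordMatrix m.tensor ψ v)⁻¹ i j =
      ((coordMatrix m.tensor ψ v).det)⁻¹ *
        ((coordMatrix m.tensor ψ v).updateRow j (Pi.single i 1)).det := by
    intro v hv
    rw [Matrix.inv_def, Ring.inverse_eq_inv', Matrix.smul_apply, Matrix.adjugate_apply, smul_eq_mul]
  refine ContDiffOn.congr ?_ h
  refine ((m.contDiffOn_det ψ).inv fun _ hv => (m.det_coordMatrix_pos ψ hv).ne').mul ?_
  simp only [Matrix.det_apply]
  refine ContDiffOn.sum fun σ _ => ?_
  refine ContDiffOn.const_smul _ ?_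
  refine contDiffOn_prod fun k _ => ?_
  by_cases hk : σ k = j
  · simp only [hk, Matrix.updateRow_self]; exact contDiffOn_const
  · simp only [Matrix.updateRow_ne hk]; exact contDiffOn_coordMatrix m.smooth ψ _ _

/-- The gradient of `u` in local coordinates. -/
def coordGrad (u : N → ℝ) (v : ι → ℝ) : ι → ℝ :=
  (coordMatrix m.tensor ψ v)⁻¹ *ᵥ fun j => partialDeriv j (fun w => u (ψ.toFun w)) v

open Classical in
/-- The gradient of `u`. -/
def grad (u : N → ℝ) (p : N) : TangentSpace I p :=
  if h : ∃ X : TangentSpace I p, ∀ ξ, m.g p X ξ = mfderiv I 𝓘(ℝ, ℝ) u p ξ then h.choose else 0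

/-- The derivative of `Φ` in the direction of the gradient of `u`. -/
def pairing (u Φ : N → ℝ) (p : N) : ℝ := mfderiv I 𝓘(ℝ, ℝ) Φ p (m.grad u p)

theorem g_coordGrad {u : N → ℝ} (hv : v ∈ ψ.source)
    (hu : MDifferentiableAt I 𝓘(ℝ, ℝ) u (ψ.toFun v)) (ξ : TangentSpace I (ψ.toFun v)) :
    m.g (ψ.toFun v) (ψ.frame v (m.coordGrad ψ u v)) ξ = mfderiv I 𝓘(ℝ, ℝ) u (ψ.toFun v) ξ := by
  obtain ⟨ζ, rfl⟩ := ψ.frame_surjective hv ξ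
  rw [m.symm, ← dotProduct_coordMatrix, ← ψ.fderiv_comp hv hu, map_eq_sum_single (fderiv ℝ _ v) ζ]
  have hdet : IsUnit (coordMatrix m.tensor ψ v).det := (m.det_coordMatrix_pos ψ hv).ne'.isUnit
  have : coordMatrix m.tensor ψ v *ᵥ m.coordGrad ψ u v =
      fun j => partialDeriv j (fun w => u (ψ.toFun w)) v := by
    rw [coordGrad, Matrix.mulVec_mulVec, Matrix.mul_nonsing_inv _ hdet, Matrix.one_mulVec]
  exact congrArg (ζ ⬝ᵥ ·) this

/-- The coordinate gradient represents `du`, and a representing vector is unique because the metric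
is definite at interior points. So the invariantly chosen gradient is the coordinate one, in every
coordinate system. -/
theorem grad_eq {u : N → ℝ} (hv : v ∈ ψ.source)
    (hu : MDifferentiableAt I 𝓘(ℝ, ℝ) u (ψ.toFun v)) :
    m.grad u (ψ.toFun v) = ψ.frame v (m.coordGrad ψ u v) := by
  have hex : ∃ X : TangentSpace I (ψ.toFun v), ∀ ξ, m.g (ψ.toFun v) X ξ =
      mfderiv I 𝓘(ℝ, ℝ) u (ψ.toFun v) ξ := ⟨_, m.g_coordGrad ψ hv hu⟩
  rw [grad, dif_pos hex]
  by_contra hne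
  have hpos := m.pos _ (ψ.target_subset (ψ.mem_target hv)) _ (sub_ne_zero.2 hne)
  have h1 := hex.choose_spec
  have h2 := m.g_coordGrad ψ hv hu
  have e : ∀ ξ, m.g (ψ.toFun v) (hex.choose - ψ.frame v (m.coordGrad ψ u v)) ξ = 0 := fun ξ => by
    rw [map_sub]
    exact sub_eq_zero.2 ((h1 ξ).trans (h2 ξ).symm)
  rw [e] at hpos
  exact lt_irrefl _ hpos

theorem g_grad {u : N → ℝ} (hv : v ∈ ψ.source)
    (hu : MDifferentiableAt I 𝓘(ℝ, ℝ) u (ψ.toFun v)) (ξ : TangentSpace I (ψ.toFun v)) :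
    m.g (ψ.toFun v) (m.grad u (ψ.toFun v)) ξ = mfderiv I 𝓘(ℝ, ℝ) u (ψ.toFun v) ξ := by
  rw [m.grad_eq ψ hv hu, m.g_coordGrad ψ hv hu]

theorem pairing_eq {u Φ : N → ℝ} (hv : v ∈ ψ.source)
    (hu : MDifferentiableAt I 𝓘(ℝ, ℝ) u (ψ.toFun v))
    (hΦ : MDifferentiableAt I 𝓘(ℝ, ℝ) Φ (ψ.toFun v)) :
    m.pairing u Φ (ψ.toFun v) =
      ∑ i, m.coordGrad ψ u v i * partialDeriv i (fun w => Φ (ψ.toFun w)) v := by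
  rw [pairing, m.grad_eq ψ hv hu, ← ψ.fderiv_comp hv hΦ, map_eq_sum_single (fderiv ℝ _ v)]
  rfl

theorem continuousOn_coordGrad {u : N → ℝ} (hu : ContMDiffOn I 𝓘(ℝ, ℝ) 1 u (I.interior N)) (i : ι) :
    ContinuousOn (fun v => m.coordGrad ψ u v i) ψ.source := by
  have h1 := ψ.contDiffOn_comp (by simp) hu subset_rfl
    (fun v hv => ψ.target_subset (ψ.mem_target hv))
  simp only [coordGrad, mulVec, dotProduct]
  refine continuousOn_finsetSum _ fun j _ => (m.contDiffOn_inv ψ i j).continuousOn.mul ?_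
  exact (h1.continuousOn_fderiv_of_isOpen ψ.open_source le_rfl).clm_apply continuousOn_const

/-- The weak Laplace equation tested with `C¹` functions, in one coordinate system. -/
theorem green_chart {u f : N → ℝ} (hu : ContMDiffOn I 𝓘(ℝ, ℝ) 1 u (I.interior N))
    (hf : ContinuousOn f (I.interior N)) (hΔ : IsWeakLaplacian m.tensor u f)
    {η : (ι → ℝ) → ℝ} (hη : ContDiff ℝ 1 η) (hc : HasCompactSupport η) (hs : tsupport η ⊆ ψ.source) :
    ∫ v, ((∑ i, coordDensity m.tensor ψ v * m.coordGrad ψ u v i * partialDeriv i η v) +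
      f (ψ.toFun v) * coordDensity m.tensor ψ v * η v) = 0 := by
  have hint : ∀ v ∈ ψ.source, ψ.toFun v ∈ I.interior N :=
    fun v hv => ψ.target_subset (ψ.mem_target hv)
  have hu1 := ψ.contDiffOn_comp (by simp) hu subset_rfl hint
  have hd := (m.contDiffOn_density ψ).continuousOn
  have hfψ : ContinuousOn (fun v => f (ψ.toFun v)) ψ.source :=
    hf.comp ψ.smooth.continuousOn hint
  refine integral_identity_of_smooth ψ.open_source
    (fun i => hd.mul (m.continuousOn_coordGrad ψ hu i)) (hfψ.mul hd) ?_ hη hc hs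
  intro η hη
  -- `F` is `√(det g) ∇η`, so that `√(det g) Δη` is its divergence. It is `C¹` with support in that
  -- of `η`, and one integration by parts moves the derivative to `u`.
  set F : ι → (ι → ℝ) → ℝ := fun i w => coordDensity m.tensor ψ w *
    ∑ j, (coordMatrix m.tensor ψ w)⁻¹ i j * partialDeriv j η w with hF
  have hFsupp : ∀ i, tsupport (F i) ⊆ tsupport η := fun i =>
    closure_minimal (fun w hw => by
      by_contra hne
      refine hw ?_
      have : ∀ j, partialDeriv j η w = 0 := fun j => image_eq_zero_of_notMem_tsupport
        fun h => hne (tsupport_partialDeriv_subset j η h)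
      simp [hF, this]) (isClosed_tsupport _)
  have hpd : ∀ j, ContDiff ℝ ∞ (partialDeriv j η) := fun j =>
    (hη.1.fderiv_right (m := (∞ : WithTop ℕ∞)) (by simp)).clm_apply contDiff_const
  have hFs : ∀ i, ContDiff ℝ 1 (F i) := by
    intro i
    rw [← contMDiff_iff_contDiff]
    refine contMDiff_of_tsupport fun w hw => ?_
    have hw' : ψ.source ∈ 𝓝 w := ψ.open_source.mem_nhds (hη.2.2 (hFsupp i hw))
    rw [contMDiffAt_iff_contDiffAt]
    refine ContDiffAt.of_le (n := (∞ : WithTop ℕ∞)) ?_ (by simp)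
    refine ((m.contDiffOn_density ψ).contDiffAt hw').mul (ContDiffAt.sum fun j _ => ?_)
    exact ((m.contDiffOn_inv ψ i j).contDiffAt hw').mul (hpd j).contDiffAt
  have hFc : ∀ i, HasCompactSupport (F i) := fun i =>
    hη.2.1.of_isClosed_subset (isClosed_tsupport _) (hFsupp i)
  have hFd : ∀ i, tsupport (F i) ⊆ ψ.source := fun i => (hFsupp i).trans hη.2.2
  have h1 : ∫ v, u (ψ.toFun v) * coordDivGrad m.tensor ψ η v =
      ∑ i, ∫ v, u (ψ.toFun v) * partialDeriv i (F i) v := by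
    rw [← integral_finsetSum]
    · simp only [coordDivGrad, Finset.mul_sum, hF]
    · intro i _
      exact integrable_mul_of_tsupport_subset ψ.open_source hu1.continuousOn
        (continuous_partialDeriv i (hFs i)) (hasCompactSupport_partialDeriv i (hFc i))
        ((tsupport_partialDeriv_subset i _).trans (hFd i))
  have h2 : ∀ i, ∫ v, u (ψ.toFun v) * partialDeriv i (F i) v =
      - ∫ v, partialDeriv i (fun w => u (ψ.toFun w)) v * F i v := fun i =>
    integral_mul_partialDeriv_eq ψ.open_source i hu1 (hFs i) (hFc i) (hFd i)
  have hdu : ∀ i, ContinuousOn (partialDeriv i fun w => u (ψ.toFun w)) ψ.source := fun i =>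
    (hu1.continuousOn_fderiv_of_isOpen ψ.open_source le_rfl).clm_apply continuousOn_const
  have i1 : ∀ i, Integrable fun v => partialDeriv i (fun w => u (ψ.toFun w)) v * F i v := fun i =>
    integrable_mul_of_tsupport_subset ψ.open_source (hdu i) (hFs i).continuous (hFc i) (hFd i)
  have i2 : Integrable fun v => f (ψ.toFun v) * coordDensity m.tensor ψ v * η v :=
    integrable_mul_of_tsupport_subset ψ.open_source (hfψ.mul hd) hη.1.continuous hη.2.1 hη.2.2
  have h3 := hΔ ι ψ η hη
  rw [h1, Finset.sum_congr rfl fun i _ => h2 i, Finset.sum_neg_distrib,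
    ← integral_finsetSum _ fun i _ => i1 i] at h3
  -- Symmetry of the inverse matrix: `⟨∇u, dη⟩ = ⟨du, ∇η⟩`.
  have e : ∀ v, ∑ i, coordDensity m.tensor ψ v * m.coordGrad ψ u v i * partialDeriv i η v =
      ∑ i, partialDeriv i (fun w => u (ψ.toFun w)) v * F i v := by
    intro v
    have hsymm : ∀ i j, (coordMatrix m.tensor ψ v)⁻¹ i j = (coordMatrix m.tensor ψ v)⁻¹ j i := by
      intro i j
      have : ((coordMatrix m.tensor ψ v)⁻¹).IsSymm := by
        rw [Matrix.IsSymm, Matrix.transpose_nonsing_inv, (m.isSymm_coordMatrix ψ v).eq]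
      exact this.apply j i
    simp only [coordGrad, mulVec, dotProduct, hF, Finset.mul_sum, Finset.sum_mul]
    rw [Finset.sum_comm]
    refine Finset.sum_congr rfl fun i _ => Finset.sum_congr rfl fun j _ => ?_
    rw [hsymm j i]; ring
  show ∫ v, ((∑ i, coordDensity m.tensor ψ v * m.coordGrad ψ u v i * partialDeriv i η v) +
      f (ψ.toFun v) * coordDensity m.tensor ψ v * η v) = 0
  simp only [e]
  rw [integral_add (integrable_finsetSum _ fun i _ => i1 i) i2]
  have h4 : ∫ v, f (ψ.toFun v) * η v * coordDensity m.tensor ψ v =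
      ∫ v, f (ψ.toFun v) * coordDensity m.tensor ψ v * η v :=
    integral_congr_ae (Eventually.of_forall fun v => by ring)
  rw [h4] at h3
  linarith

end InteriorMetric

end Metric

/-! ### The Riemannian volume measure -/

section Volume

open Filter Topology Matrix

variable {E : Type*} [NormedAddCommGroup E] [NormedSpace ℝ E] {H : Type*} [TopologicalSpace H]
  {I : ModelWithCorners ℝ E H} {N : Type*} [TopologicalSpace N] [ChartedSpace H N]
  {ι : Type} [Fintype ι]

/-- The pull-back of a tensor by a parametrization depends only on the germ of the latter. -/
theorem pullback_congr (g : ∀ p : N, TangentSpace I p →L[ℝ] TangentSpace I p →L[ℝ] ℝ)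
    {h h' : (ι → ℝ) → N} {v : ι → ℝ} (hh : h =ᶠ[𝓝 v] h') (ξ ζ : ι → ℝ) :
    g (h v) (mfderiv 𝓘(ℝ, ι → ℝ) I h v ξ) (mfderiv 𝓘(ℝ, ι → ℝ) I h v ζ) =
      g (h' v) (mfderiv 𝓘(ℝ, ι → ℝ) I h' v ξ) (mfderiv 𝓘(ℝ, ι → ℝ) I h' v ζ) := by
  have key : ∀ (q q' : N) (_ : q = q') (a c a' c' : E), a = a' → c = c' →
      (g q : E →L[ℝ] E →L[ℝ] ℝ) a c = (g q' : E →L[ℝ] E →L[ℝ] ℝ) a' c' := by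
    rintro q _ rfl a c _ _ rfl rfl; rfl
  refine key _ _ hh.self_of_nhds _ _ _ _ ?_ ?_
  · exact DFunLike.congr_fun hh.mfderiv_eq ξ
  · exact DFunLike.congr_fun hh.mfderiv_eq ζ

namespace LocalCoord

/-- The change of coordinates between two local coordinate systems. -/
def transition (ψ ψ' : LocalCoord I N ι) (v : ι → ℝ) : ι → ℝ := ψ'.invFun (ψ.toFun v)

theorem differentiableAt_transition (ψ ψ' : LocalCoord I N ι) {v : ι → ℝ} (hv : v ∈ ψ.source)
    (hv' : ψ.toFun v ∈ ψ'.target) : DifferentiableAt ℝ (transition ψ ψ') v := by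
  rw [← mdifferentiableAt_iff_differentiableAt]
  exact ((ψ'.contMDiffAt_inv hv').mdifferentiableAt (by simp)).comp v (ψ.mdifferentiableAt hv)

theorem preimage_mem_nhds (ψ : LocalCoord I N ι) {v : ι → ℝ} (hv : v ∈ ψ.source) {s : Set N}
    (hs : s ∈ 𝓝 (ψ.toFun v)) : ψ.toFun ⁻¹' s ∈ 𝓝 v :=
  (ψ.mdifferentiableAt hv).continuousAt.preimage_mem_nhds hs

variable [MeasurableSpace N] [BorelSpace N]

theorem aemeasurable_toFun (ψ : LocalCoord I N ι) :
    AEMeasurable ψ.toFun (volume.restrict ψ.source) :=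
  ψ.smooth.continuousOn.aemeasurable ψ.open_source.measurableSet

theorem measurableSet_preimage_inter (ψ : LocalCoord I N ι) {A : Set N} (hA : MeasurableSet A) :
    MeasurableSet (ψ.toFun ⁻¹' A ∩ ψ.source) := by
  have h : Measurable (ψ.source.domRestrict ψ.toFun) :=
    (continuousOn_iff_continuous_domRestrict.1 ψ.smooth.continuousOn).measurable
  have h2 := ψ.open_source.measurableSet.subtype_image (h hA)
  convert h2 using 1
  ext v
  constructor
  · rintro ⟨h1, h3⟩
    exact ⟨⟨v, h3⟩, h1, rfl⟩
  · rintro ⟨⟨w, hw⟩, h1, rfl⟩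
    exact ⟨h1, hw⟩

end LocalCoord

variable [DecidableEq ι] [IsManifold I ∞ N]

namespace InteriorMetric

variable (m : InteriorMetric I N)

/-- The matrix of the metric changes by `Aᵀ · A`, where `A` is the Jacobian matrix of the transition
map, so its determinant is multiplied by `(det A)²`. -/
theorem coordDensity_transition (ψ ψ' : LocalCoord I N ι) {v : ι → ℝ} (hv : v ∈ ψ.source)
    (hv' : ψ.toFun v ∈ ψ'.target) :
    coordDensity m.tensor ψ v = |(fderiv ℝ (LocalCoord.transition ψ ψ') v).det| *
      coordDensity m.tensor ψ' (LocalCoord.transition ψ ψ' v) := by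
  set θ := LocalCoord.transition ψ ψ' with hθ
  have hθv : θ v ∈ ψ'.source := ψ'.inv_mem hv'
  have hd : DifferentiableAt ℝ θ v := LocalCoord.differentiableAt_transition ψ ψ' hv hv'
  have hev : ψ.toFun =ᶠ[𝓝 v] ψ'.toFun ∘ θ := by
    filter_upwards [ψ.preimage_mem_nhds hv (ψ'.open_target.mem_nhds hv')] with w hw
    exact (ψ'.toFun_inv hw).symm
  have hfr : ∀ ξ : ι → ℝ, mfderiv 𝓘(ℝ, ι → ℝ) I (ψ'.toFun ∘ θ) v ξ =
      ψ'.frame (θ v) (fderiv ℝ θ v ξ) := fun ξ => by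
    rw [mfderiv_comp v (ψ'.mdifferentiableAt hθv) hd.mdifferentiableAt, mfderiv_eq_fderiv]
    rfl
  set A := LinearMap.toMatrix' (fderiv ℝ θ v : (ι → ℝ) →ₗ[ℝ] (ι → ℝ)) with hA
  have hcol : ∀ i, fderiv ℝ θ v (Pi.single i 1) = A.col i := fun i => by
    ext k; simp [hA, LinearMap.toMatrix'_apply]
  have hM : coordMatrix m.tensor ψ v = Aᵀ * coordMatrix m.tensor ψ' (θ v) * A := by
    ext i j
    have h1 : coordMatrix m.tensor ψ v i j = _ :=
      pullback_congr m.g hev (Pi.single i 1) (Pi.single j 1)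
    rw [h1, hfr, hfr]
    refine (dotProduct_coordMatrix m.g ψ' (θ v) _ _).symm.trans ?_
    rw [hcol, hcol, Matrix.mul_assoc]
    simp only [Matrix.mul_apply, dotProduct, mulVec, Matrix.transpose_apply, Matrix.col_apply]
    rfl
  have hdet : (fderiv ℝ θ v).det = A.det := by
    rw [hA, LinearMap.det_toMatrix']
  rw [coordDensity, hM, Matrix.det_mul, Matrix.det_mul, Matrix.det_transpose, hdet, coordDensity,
    ← Real.sqrt_sq_eq_abs, ← Real.sqrt_mul (sq_nonneg _)]
  congr 1; ring

variable [MeasurableSpace N] [BorelSpace N]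

/-- The Riemannian volume on the range of a local coordinate system. -/
def chartMeasure (ψ : LocalCoord I N ι) : Measure N :=
  Measure.map ψ.toFun ((volume.restrict ψ.source).withDensity
    fun v => ENNReal.ofReal (coordDensity m.tensor ψ v))

theorem chartMeasure_apply (ψ : LocalCoord I N ι) {A : Set N} (hA : MeasurableSet A) :
    m.chartMeasure ψ A =
      ∫⁻ v in ψ.toFun ⁻¹' A ∩ ψ.source, ENNReal.ofReal (coordDensity m.tensor ψ v) := by
  rw [chartMeasure, Measure.map_apply_of_aemeasurable
    (ψ.aemeasurable_toFun.mono_ac (withDensity_absolutelyContinuous _ _)) hA,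
    withDensity_apply', Measure.restrict_restrict' ψ.open_source.measurableSet]

/-- Change of variables along the transition map; the Jacobian factor is exactly the ratio of the
two densities. -/
theorem chartMeasure_eq (ψ ψ' : LocalCoord I N ι) {A : Set N} (hA : MeasurableSet A)
    (h : A ⊆ ψ.target) (h' : A ⊆ ψ'.target) : m.chartMeasure ψ A = m.chartMeasure ψ' A := by
  rw [chartMeasure_apply m ψ hA, chartMeasure_apply m ψ' hA]
  set θ := LocalCoord.transition ψ ψ' with hθ
  have himg : ψ'.toFun ⁻¹' A ∩ ψ'.source = θ '' (ψ.toFun ⁻¹' A ∩ ψ.source) := by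
    ext w
    constructor
    · rintro ⟨hw, hws⟩
      refine ⟨ψ.invFun (ψ'.toFun w), ⟨?_, ψ.inv_mem (h hw)⟩, ?_⟩
      · rw [mem_preimage, ψ.toFun_inv (h hw)]; exact hw
      · rw [hθ, LocalCoord.transition, ψ.toFun_inv (h hw), ψ'.inv_toFun hws]
    · rintro ⟨v, ⟨hv, hvs⟩, rfl⟩
      have : ψ'.toFun (θ v) = ψ.toFun v := ψ'.toFun_inv (h' hv)
      exact ⟨by rw [mem_preimage, this]; exact hv, ψ'.inv_mem (h' hv)⟩
  have hinj : InjOn θ (ψ.toFun ⁻¹' A ∩ ψ.source) := by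
    rintro v ⟨hv, hvs⟩ w ⟨hw, hws⟩ hvw
    have e := congrArg ψ'.toFun hvw
    rw [hθ, LocalCoord.transition, LocalCoord.transition, ψ'.toFun_inv (h' hv),
      ψ'.toFun_inv (h' hw)] at e
    rw [← ψ.inv_toFun hvs, e, ψ.inv_toFun hws]
  rw [himg, lintegral_image_eq_lintegral_abs_det_fderiv_mul volume
    (ψ.measurableSet_preimage_inter hA) (fun v hv => ((LocalCoord.differentiableAt_transition ψ ψ'
      hv.2 (h' hv.1)).hasFDerivAt).hasFDerivWithinAt) hinj]
  refine setLIntegral_congr_fun (ψ.measurableSet_preimage_inter hA) fun v hv => ?_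
  rw [← ENNReal.ofReal_mul (abs_nonneg _), m.coordDensity_transition ψ ψ' hv.2 (h' hv.1)]

/-- `μ` is the Riemannian volume measure, computed with coordinates labelled by `ι`. -/
def IsVolume (ι : Type) [Fintype ι] [DecidableEq ι] (μ : Measure N) : Prop :=
  (∀ ψ : LocalCoord I N ι, μ.restrict ψ.target = m.chartMeasure ψ) ∧ μ (I.interior N)ᶜ = 0

/-- Countably many coordinate systems suffice to cover the interior. Their ranges are made disjoint
and the chart measures of the pieces are added; the result restricts correctly to every coordinate
range because chart measures agree on overlaps. -/
theorem exists_isVolume [SecondCountableTopology N] [hne : Nonempty (LocalCoord I N ι)]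
    (hcov : ∀ p ∈ I.interior N, ∃ ψ : LocalCoord I N ι, p ∈ ψ.target) :
    ∃ μ : Measure N, m.IsVolume ι μ := by
  obtain ⟨T, hT, hTU⟩ := TopologicalSpace.isOpen_iUnion_countable
    (fun ψ : LocalCoord I N ι => ψ.target) fun ψ => ψ.open_target
  obtain ⟨ψ₀⟩ := hne
  -- Adding `ψ₀` makes the family nonempty, so that it can be enumerated by the natural numbers.
  obtain ⟨f, hf⟩ := (hT.insert ψ₀).exists_eq_range (insert_nonempty _ _)
  have hU : ∀ ψ : LocalCoord I N ι, ψ.target ⊆ ⋃ k, (f k).target := by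
    intro ψ p hp
    have : p ∈ ⋃ ψ : LocalCoord I N ι, ψ.target := mem_iUnion.2 ⟨ψ, hp⟩
    rw [← hTU] at this
    simp only [mem_iUnion] at this
    obtain ⟨ψ', hψ', hp'⟩ := this
    have : ψ' ∈ range f := hf ▸ mem_insert_of_mem _ hψ'
    obtain ⟨k, rfl⟩ := this
    exact mem_iUnion.2 ⟨k, hp'⟩
  set D := disjointed fun k => (f k).target with hD
  have hDm : ∀ k, MeasurableSet (D k) :=
    MeasurableSet.disjointed fun k => (f k).open_target.measurableSet
  have hDs : ∀ k, D k ⊆ (f k).target := fun k => disjointed_subset _ _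
  have hDU : ⋃ k, D k = ⋃ k, (f k).target := iUnion_disjointed
  have hDd : Pairwise (Function.onFun Disjoint D) := disjoint_disjointed _
  refine ⟨Measure.sum fun k => (m.chartMeasure (f k)).restrict (D k), fun ψ => ?_, ?_⟩
  · ext A hA
    have e1 : m.chartMeasure ψ A = m.chartMeasure ψ (A ∩ ψ.target) := by
      rw [chartMeasure_apply m ψ hA, chartMeasure_apply m ψ (hA.inter ψ.open_target.measurableSet)]
      congr 2
      ext v
      simp only [mem_inter_iff, mem_preimage]
      exact ⟨fun h => ⟨⟨h.1, ψ.mem_target h.2⟩, h.2⟩, fun h => ⟨h.1.1, h.2⟩⟩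
    have hAt := hA.inter ψ.open_target.measurableSet
    rw [Measure.restrict_apply hA, e1, Measure.sum_apply _ hAt]
    have e2 : A ∩ ψ.target = ⋃ k, (A ∩ ψ.target) ∩ D k := by
      rw [← inter_iUnion, hDU]
      exact (inter_eq_left.2 (inter_subset_right.trans (hU ψ))).symm
    conv_rhs => rw [e2]
    rw [measure_iUnion (fun i j hij => (hDd hij).mono inter_subset_right inter_subset_right)
      fun k => hAt.inter (hDm k)]
    refine tsum_congr fun k => ?_
    rw [Measure.restrict_apply hAt]
    exact m.chartMeasure_eq _ _ (hAt.inter (hDm k)) (inter_subset_right.trans (hDs k))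
      (inter_subset_left.trans inter_subset_right)
  · have hsub : (I.interior N)ᶜ ⊆ (⋃ k, (f k).target)ᶜ := by
      refine compl_subset_compl.2 (iUnion_subset fun k => (f k).target_subset)
    have hcov' : (⋃ k, (f k).target)ᶜ ⊆ (I.interior N)ᶜ := by
      refine compl_subset_compl.2 fun p hp => ?_
      obtain ⟨ψ, hψ⟩ := hcov p hp
      exact hU ψ hψ
    rw [subset_antisymm hsub hcov', Measure.sum_apply _
      (MeasurableSet.iUnion fun k => (f k).open_target.measurableSet).compl]
    refine ENNReal.tsum_eq_zero.2 fun k => ?_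
    rw [Measure.restrict_apply (MeasurableSet.iUnion fun k => (f k).open_target.measurableSet).compl]
    refine measure_mono_null (t := ∅) ?_ (by simp)
    rintro p ⟨hp, hpk⟩
    exact hp (mem_iUnion.2 ⟨k, hDs k hpk⟩)

variable {m}

theorem IsVolume.apply {μ : Measure N} (hμ : m.IsVolume ι μ) (ψ : LocalCoord I N ι) {A : Set N}
    (hA : MeasurableSet A) (h : A ⊆ ψ.target) :
    μ A = ∫⁻ v in ψ.toFun ⁻¹' A ∩ ψ.source, ENNReal.ofReal (coordDensity m.tensor ψ v) := by
  rw [← m.chartMeasure_apply ψ hA, ← hμ.1 ψ, Measure.restrict_apply hA, inter_eq_left.2 h]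

theorem IsVolume.integral_eq {μ : Measure N} (hμ : m.IsVolume ι μ) (ψ : LocalCoord I N ι)
    {h : N → ℝ} (hm : AEStronglyMeasurable h (μ.restrict ψ.target))
    (hs : ∀ p, p ∉ ψ.target → h p = 0) :
    ∫ p, h p ∂μ = ∫ v in ψ.source, coordDensity m.tensor ψ v * h (ψ.toFun v) := by
  rw [← setIntegral_eq_integral_of_forall_compl_eq_zero hs]
  rw [hμ.1 ψ] at hm ⊢
  have hd : AEMeasurable (fun v => ENNReal.ofReal (coordDensity m.tensor ψ v))
      (volume.restrict ψ.source) :=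
    ((m.contDiffOn_density ψ).continuousOn.aemeasurable ψ.open_source.measurableSet).ennreal_ofReal
  rw [chartMeasure, integral_map (ψ.aemeasurable_toFun.mono_ac
    (withDensity_absolutelyContinuous _ _)) hm,
    integral_withDensity_eq_integral_toReal_smul₀ hd (Eventually.of_forall fun _ => by simp)]
  refine setIntegral_congr_fun ψ.open_source.measurableSet fun v hv => ?_
  simp only [smul_eq_mul]
  rw [ENNReal.toReal_ofReal (m.coordDensity_pos ψ hv).le]

end InteriorMetric

end Volume

/-! ### Pairing of gradients and Green's formula -/

section Green

open Filter Topology Matrix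

variable {E : Type*} [NormedAddCommGroup E] [NormedSpace ℝ E] {H : Type*} [TopologicalSpace H]
  {I : ModelWithCorners ℝ E H} {N : Type*} [TopologicalSpace N] [ChartedSpace H N]

theorem LocalCoord.continuousOn_of_comp {ι : Type} [Fintype ι] (ψ : LocalCoord I N ι) {h : N → ℝ}
    (hh : ContinuousOn (fun v => h (ψ.toFun v)) ψ.source) : ContinuousOn h ψ.target := by
  have := hh.comp ψ.smooth_inv.continuousOn fun p hp => ψ.inv_mem hp
  refine this.congr fun p hp => ?_
  simp only [Function.comp]
  rw [ψ.toFun_inv hp]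

variable [IsManifold I ∞ N]

namespace InteriorMetric

variable (m : InteriorMetric I N)

theorem pairing_congr (u : N → ℝ) {Φ Φ' : N → ℝ} {p : N} (h : Φ =ᶠ[𝓝 p] Φ') :
    m.pairing u Φ p = m.pairing u Φ' p := by
  rw [pairing, pairing]
  exact DFunLike.congr_fun h.mfderiv_eq _

theorem pairing_of_hasMFDerivAt (u : N → ℝ) {Φ : N → ℝ} {p : N} {D : TangentSpace I p →L[ℝ] ℝ}
    (h : HasMFDerivAt I 𝓘(ℝ, ℝ) Φ p D) : m.pairing u Φ p = D (m.grad u p) := by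
  rw [pairing, h.mfderiv]
  rfl

theorem pairing_eq_zero (u : N → ℝ) {Φ : N → ℝ} {p : N} (h : Φ =ᶠ[𝓝 p] fun _ => 0) :
    m.pairing u Φ p = 0 := by
  rw [m.pairing_congr u h]
  exact m.pairing_of_hasMFDerivAt u (D := 0) (hasMFDerivAt_const _ _)

theorem pairing_comp (u : N → ℝ) {Φ : N → ℝ} {p : N} {F : ℝ → ℝ} {F' : ℝ}
    (hF : HasDerivAt F F' (Φ p)) (hΦ : MDifferentiableAt I 𝓘(ℝ, ℝ) Φ p) :
    m.pairing u (fun q => F (Φ q)) p = F' * m.pairing u Φ p := by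
  have h := (hF.hasFDerivAt.hasMFDerivAt).comp p hΦ.hasMFDerivAt
  have h2 := m.pairing_of_hasMFDerivAt u h
  refine Eq.trans h2 ?_
  simp only [pairing]
  exact mul_comm (G := ℝ) _ _

theorem pairing_mul (u : N → ℝ) {Φ Φ' : N → ℝ} {p : N} (hΦ : MDifferentiableAt I 𝓘(ℝ, ℝ) Φ p)
    (hΦ' : MDifferentiableAt I 𝓘(ℝ, ℝ) Φ' p) :
    m.pairing u (fun q => Φ q * Φ' q) p = Φ p * m.pairing u Φ' p + Φ' p * m.pairing u Φ p :=
  m.pairing_of_hasMFDerivAt u (hΦ.hasMFDerivAt.mul hΦ'.hasMFDerivAt)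

theorem pairing_add (u : N → ℝ) {Φ Φ' : N → ℝ} {p : N} (hΦ : MDifferentiableAt I 𝓘(ℝ, ℝ) Φ p)
    (hΦ' : MDifferentiableAt I 𝓘(ℝ, ℝ) Φ' p) :
    m.pairing u (fun q => Φ q + Φ' q) p = m.pairing u Φ p + m.pairing u Φ' p :=
  m.pairing_of_hasMFDerivAt u (hΦ.hasMFDerivAt.add hΦ'.hasMFDerivAt)

theorem pairing_sum (u : N → ℝ) {J : Type*} (t : Finset J) {Φ : J → N → ℝ} {p : N}
    (hΦ : ∀ j ∈ t, MDifferentiableAt I 𝓘(ℝ, ℝ) (Φ j) p) :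
    m.pairing u (fun q => ∑ j ∈ t, Φ j q) p = ∑ j ∈ t, m.pairing u (Φ j) p := by
  classical
  suffices h : MDifferentiableAt I 𝓘(ℝ, ℝ) (fun q => ∑ j ∈ t, Φ j q) p ∧
      m.pairing u (fun q => ∑ j ∈ t, Φ j q) p = ∑ j ∈ t, m.pairing u (Φ j) p from h.2
  induction t using Finset.induction_on with
  | empty => simpa using ⟨mdifferentiableAt_const, m.pairing_eq_zero u (Eventually.of_forall fun _ => rfl)⟩
  | insert a t ha ih =>
    have h1 := ih fun j hj => hΦ j (Finset.mem_insert_of_mem hj)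
    have h2 := hΦ a (Finset.mem_insert_self _ _)
    simp only [Finset.sum_insert ha]
    exact ⟨h2.add h1.1, by rw [m.pairing_add u h2 h1.1, h1.2]⟩

variable {ι : Type} [Fintype ι] [DecidableEq ι] {m}

theorem continuousOn_pairing (ψ : LocalCoord I N ι) {u Φ : N → ℝ}
    (hu : ContMDiffOn I 𝓘(ℝ, ℝ) 1 u (I.interior N))
    (hΦ : ContMDiffOn I 𝓘(ℝ, ℝ) 1 Φ ψ.target) : ContinuousOn (m.pairing u Φ) ψ.target := by
  have hint : IsOpen (I.interior N) := I.isOpen_interior (n := ∞) (by simp)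
  refine ψ.continuousOn_of_comp ?_
  have h1 : ∀ v ∈ ψ.source, m.pairing u Φ (ψ.toFun v) =
      ∑ i, m.coordGrad ψ u v i * partialDeriv i (fun w => Φ (ψ.toFun w)) v := fun v hv =>
    m.pairing_eq ψ hv ((hu.contMDiffAt (hint.mem_nhds
      (ψ.target_subset (ψ.mem_target hv)))).mdifferentiableAt one_ne_zero)
      ((hΦ.contMDiffAt (ψ.open_target.mem_nhds (ψ.mem_target hv))).mdifferentiableAt one_ne_zero)
  refine ContinuousOn.congr ?_ h1
  refine continuousOn_finsetSum _ fun i _ => (m.continuousOn_coordGrad ψ hu i).mul ?_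
  have hd := ψ.contDiffOn_comp (by simp) hΦ subset_rfl fun v hv => ψ.mem_target hv
  exact (hd.continuousOn_fderiv_of_isOpen ψ.open_source le_rfl).clm_apply continuousOn_const

variable [MeasurableSpace N] [BorelSpace N]

/-- The density is bounded on the compact coordinate image of `K`, so `K` has finite volume, and `h`
is bounded on `K`. -/
theorem IsVolume.integrable_of_chart [T2Space N] {μ : Measure N} (hμ : m.IsVolume ι μ)
    (ψ : LocalCoord I N ι) {h : N → ℝ} (hh : ContinuousOn h ψ.target) {K : Set N}
    (hK : IsCompact K) (hKt : K ⊆ ψ.target) (hz : ∀ p, p ∉ K → h p = 0) : Integrable h μ := by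
  have hKm := hK.isClosed.measurableSet
  rw [← integrableOn_iff_integrable_of_support_subset (s := K) (fun p hp => by
    by_contra hne; exact hp (hz p hne))]
  have hpre : IsCompact (ψ.toFun ⁻¹' K ∩ ψ.source) := by
    have : ψ.toFun ⁻¹' K ∩ ψ.source = ψ.invFun '' K := by
      ext v
      constructor
      · rintro ⟨h1, h2⟩; exact ⟨_, h1, ψ.inv_toFun h2⟩
      · rintro ⟨p, hp, rfl⟩
        exact ⟨by rw [mem_preimage, ψ.toFun_inv (hKt hp)]; exact hp, ψ.inv_mem (hKt hp)⟩
    rw [this]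
    exact hK.image_of_continuousOn (ψ.smooth_inv.continuousOn.mono hKt)
  have hfin : μ K < ⊤ := by
    rw [hμ.apply ψ hKm hKt]
    exact ((((m.contDiffOn_density ψ).continuousOn.mono inter_subset_right).integrableOn_compact
      hpre).lintegral_lt_top)
  obtain ⟨C, hC⟩ := hK.exists_bound_of_continuousOn (hh.mono hKt)
  refine ⟨(hh.mono hKt).aestronglyMeasurable_of_isCompact hK hKm, ?_⟩
  have : IsFiniteMeasure (μ.restrict K) := ⟨by simpa using hfin⟩
  exact HasFiniteIntegral.of_bounded ((ae_restrict_iff' hKm).2 (Eventually.of_forall hC))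

/-- Green's formula for a test function supported in one coordinate system. -/
theorem IsVolume.green_of_chart [T2Space N] {μ : Measure N} (hμ : m.IsVolume ι μ)
    (ψ : LocalCoord I N ι) {u f Φ : N → ℝ}
    (hu : ContMDiffOn I 𝓘(ℝ, ℝ) 1 u (I.interior N)) (hf : ContinuousOn f (I.interior N))
    (hΔ : IsWeakLaplacian m.tensor u f) (hΦ : ContMDiffOn I 𝓘(ℝ, ℝ) 1 Φ (I.interior N))
    {K : Set N} (hK : IsCompact K) (hKt : K ⊆ ψ.target) (hz : ∀ p, p ∉ K → Φ p = 0) :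
    Integrable (m.pairing u Φ) μ ∧ Integrable (fun p => f p * Φ p) μ ∧
      (∫ p, m.pairing u Φ p ∂μ) + ∫ p, f p * Φ p ∂μ = 0 := by
  have hint : IsOpen (I.interior N) := I.isOpen_interior (n := ∞) (by simp)
  have hΦt := hΦ.mono ψ.target_subset
  have hpair_cont := continuousOn_pairing (m := m) ψ hu hΦt
  have hfΦ_cont : ContinuousOn (fun p => f p * Φ p) ψ.target :=
    (hf.mono ψ.target_subset).mul hΦt.continuousOn
  have hpz : ∀ p, p ∉ K → m.pairing u Φ p = 0 := fun p hp => m.pairing_eq_zero u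
    (eventually_of_mem (hK.isClosed.isOpen_compl.mem_nhds hp) fun q hq => hz q hq)
  have i1 := hμ.integrable_of_chart ψ hpair_cont hK hKt hpz
  have i2 := hμ.integrable_of_chart ψ hfΦ_cont hK hKt fun p hp => by simp [hz p hp]
  refine ⟨i1, i2, ?_⟩
  rw [← integral_add i1 i2, hμ.integral_eq ψ (h := fun p => m.pairing u Φ p + f p * Φ p)
    (i1.add i2).aestronglyMeasurable.restrict fun p hp => by
      simp [hpz p fun h => hp (hKt h), hz p fun h => hp (hKt h)]]
  -- `Φ` in coordinates, extended by zero. The extension is `C¹` because its support is contained in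
  -- a compact subset of the open domain.
  set η : (ι → ℝ) → ℝ := ψ.source.indicator fun v => Φ (ψ.toFun v) with hη
  have hpre : ψ.toFun ⁻¹' K ∩ ψ.source = ψ.invFun '' K := by
    ext v
    constructor
    · rintro ⟨h1, h2⟩; exact ⟨_, h1, ψ.inv_toFun h2⟩
    · rintro ⟨p, hp, rfl⟩
      exact ⟨by rw [mem_preimage, ψ.toFun_inv (hKt hp)]; exact hp, ψ.inv_mem (hKt hp)⟩
  have hKc : IsCompact (ψ.toFun ⁻¹' K ∩ ψ.source) := by
    rw [hpre]
    exact hK.image_of_continuousOn (ψ.smooth_inv.continuousOn.mono hKt)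
  have hηs : tsupport η ⊆ ψ.toFun ⁻¹' K ∩ ψ.source := by
    refine closure_minimal (fun v hv => ?_) hKc.isClosed
    have hvs : v ∈ ψ.source := by
      by_contra h; exact hv (indicator_of_notMem h _)
    refine ⟨?_, hvs⟩
    by_contra h
    exact hv (by rw [hη, indicator_of_mem hvs]; exact hz _ h)
  have hηc : HasCompactSupport η := hKc.of_isClosed_subset (isClosed_tsupport _) hηs
  have hev : ∀ v ∈ ψ.source, η =ᶠ[𝓝 v] fun w => Φ (ψ.toFun w) := fun v hv =>
    eventually_of_mem (ψ.open_source.mem_nhds hv) fun w hw => indicator_of_mem hw _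
  have hd := ψ.contDiffOn_comp (by simp) hΦt subset_rfl fun v hv => ψ.mem_target hv
  have hη1 : ContDiff ℝ 1 η := by
    rw [← contMDiff_iff_contDiff]
    refine contMDiff_of_tsupport fun v hv => ?_
    have hvs := (hηs hv).2
    rw [contMDiffAt_iff_contDiffAt]
    exact (hd.contDiffAt (ψ.open_source.mem_nhds hvs)).congr_of_eventuallyEq (hev v hvs)
  have key := m.green_chart ψ hu hf hΔ hη1 hηc (hηs.trans inter_subset_right)
  rw [← setIntegral_eq_integral_of_forall_compl_eq_zero (s := ψ.source)] at key
  · rw [← key]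
    refine setIntegral_congr_fun ψ.open_source.measurableSet fun v hv => ?_
    have e := m.pairing_eq (u := u) (Φ := Φ) ψ hv ((hu.contMDiffAt (hint.mem_nhds
      (ψ.target_subset (ψ.mem_target hv)))).mdifferentiableAt one_ne_zero)
      ((hΦt.contMDiffAt (ψ.open_target.mem_nhds (ψ.mem_target hv))).mdifferentiableAt one_ne_zero)
    have e2 : ∀ i, partialDeriv i η v = partialDeriv i (fun w => Φ (ψ.toFun w)) v := fun i => by
      rw [partialDeriv, (hev v hv).fderiv_eq]; rfl
    have e3 : η v = Φ (ψ.toFun v) := indicator_of_mem hv _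
    simp only [e, e2, e3, mul_add, Finset.mul_sum]
    congr 1
    · exact Finset.sum_congr rfl fun i _ => by ring
    · ring
  · intro v hv
    have h0 : v ∉ tsupport η := fun h => hv (hηs h).2
    have h1 : ∀ i, partialDeriv i η v = 0 := fun i => image_eq_zero_of_notMem_tsupport
      fun h => h0 (tsupport_partialDeriv_subset i η h)
    simp [h1, image_eq_zero_of_notMem_tsupport h0]

/-- Green's formula `∫ ⟨∇u, ∇Φ⟩ = - ∫ Δu Φ` for `C¹` functions `Φ` with compact support in the
interior. -/
theorem IsVolume.green [T2Space N] [SigmaCompactSpace N] [FiniteDimensional ℝ E] {μ : Measure N}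
    (hμ : m.IsVolume ι μ) (hcov : ∀ p ∈ I.interior N, ∃ ψ : LocalCoord I N ι, p ∈ ψ.target)
    {u f Φ : N → ℝ} (hu : ContMDiffOn I 𝓘(ℝ, ℝ) 1 u (I.interior N))
    (hf : ContinuousOn f (I.interior N)) (hΔ : IsWeakLaplacian m.tensor u f)
    (hΦ : ContMDiffOn I 𝓘(ℝ, ℝ) 1 Φ (I.interior N)) {K : Set N} (hK : IsCompact K)
    (hKi : K ⊆ I.interior N) (hz : ∀ p, p ∉ K → Φ p = 0) :
    Integrable (m.pairing u Φ) μ ∧ Integrable (fun p => f p * Φ p) μ ∧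
      (∫ p, m.pairing u Φ p ∂μ) + ∫ p, f p * Φ p ∂μ = 0 := by
  have hint : IsOpen (I.interior N) := I.isOpen_interior (n := ∞) (by simp)
  obtain ⟨t, ht⟩ := hK.elim_finite_subcover (fun ψ : LocalCoord I N ι => ψ.target)
    (fun ψ => ψ.open_target) fun p hp => by
      obtain ⟨ψ, hψ⟩ := hcov p (hKi hp)
      exact mem_iUnion.2 ⟨ψ, hψ⟩
  -- A partition of unity on `K` subordinate to finitely many coordinate ranges. As `Φ` vanishes off
  -- `K`, the identity `Φ = ∑ χⱼ Φ` holds everywhere.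
  obtain ⟨χ, hχ⟩ := SmoothPartitionOfUnity.exists_isSubordinate I hK.isClosed
    (fun ψ : t => ψ.1.target) (fun ψ => ψ.1.open_target) fun p hp => by
      obtain ⟨ψ, hψ, hp'⟩ := mem_iUnion₂.1 (ht hp)
      exact mem_iUnion.2 ⟨⟨ψ, hψ⟩, hp'⟩
  have hsum : ∀ p, Φ p = ∑ j, χ j p * Φ p := by
    intro p
    by_cases hp : p ∈ K
    · have := χ.sum_eq_one hp
      rw [finsum_eq_sum_of_fintype] at this
      rw [← Finset.sum_mul, this, one_mul]
    · simp [hz p hp]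
  have hχΦ : ∀ j, ContMDiffOn I 𝓘(ℝ, ℝ) 1 (fun p => χ j p * Φ p) (I.interior N) := fun j =>
    (((χ j).contMDiff.of_le (by simp)).contMDiffOn).mul hΦ
  have hj := fun j : t => hμ.green_of_chart j.1 hu hf hΔ (hχΦ j)
    (K := K ∩ tsupport (χ j)) (hK.inter_right (isClosed_tsupport _))
    (inter_subset_right.trans (hχ j)) fun p hp => by
      by_cases hpK : p ∈ K
      · rw [image_eq_zero_of_notMem_tsupport fun h => hp ⟨hpK, h⟩, zero_mul]
      · rw [hz p hpK, mul_zero]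
  -- Additivity needs differentiability, known only at interior points; these have full measure.
  have hae : ∀ᵐ p ∂μ, m.pairing u Φ p = ∑ j, m.pairing u (fun q => χ j q * Φ q) p := by
    filter_upwards [compl_mem_ae_iff.2 hμ.2] with p hp
    have hp' : p ∈ I.interior N := by simpa using hp
    rw [← m.pairing_sum u Finset.univ fun j _ =>
      ((hχΦ j).contMDiffAt (hint.mem_nhds hp')).mdifferentiableAt one_ne_zero]
    exact m.pairing_congr u (Eventually.of_forall hsum)
  have hfsum : (fun p => f p * Φ p) = fun p => ∑ j, f p * (χ j p * Φ p) := by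
    ext p
    rw [← Finset.mul_sum, ← hsum]
  refine ⟨(integrable_finsetSum _ fun j _ => (hj j).1).congr (hae.mono fun p hp => hp.symm), ?_, ?_⟩
  · rw [hfsum]
    exact integrable_finsetSum _ fun j _ => (hj j).2.1
  · rw [integral_congr_ae hae, hfsum, integral_finsetSum _ fun j _ => (hj j).1,
      integral_finsetSum _ fun j _ => (hj j).2.1, ← Finset.sum_add_distrib]
    exact Finset.sum_eq_zero fun j _ => (hj j).2.2

end InteriorMetric

end Green

/-! ### Truncation and decay of sublevel sets -/

section VolumeDecay

open Filter Topology

theorem hasDerivAt_max_sq (s : ℝ) : HasDerivAt (fun t : ℝ => max t 0 ^ 2) (2 * max s 0) s := by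
  rcases lt_trichotomy s 0 with h | rfl | h
  · rw [max_eq_right h.le, mul_zero]
    refine (hasDerivAt_const s (0 : ℝ)).congr_of_eventuallyEq ?_
    filter_upwards [Iio_mem_nhds h] with t ht
    have ht' : t ≤ 0 := le_of_lt ht
    simp [ht']
  · rw [max_self, mul_zero, hasDerivAt_iff_isLittleO]
    simp only [max_self, smul_zero, sub_zero, ne_eq, OfNat.ofNat_ne_zero, not_false_eq_true,
      zero_pow]
    refine Asymptotics.IsBigO.trans_isLittleO (g := fun t : ℝ => t ^ 2) ?_ ?_
    · refine Asymptotics.IsBigO.of_bound 1 (Eventually.of_forall fun t => ?_)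
      rw [one_mul, norm_pow, norm_pow]
      gcongr
      rw [Real.norm_eq_abs, Real.norm_eq_abs, abs_of_nonneg (le_max_right _ _)]
      exact max_le (le_abs_self t) (abs_nonneg t)
    · exact Asymptotics.isLittleO_pow_id one_lt_two
  · rw [max_eq_left h.le]
    have h2 : HasDerivAt (fun t : ℝ => t ^ 2) (2 * s) s := by simpa using hasDerivAt_pow 2 s
    refine h2.congr_of_eventuallyEq ?_
    filter_upwards [Ioi_mem_nhds h] with t ht
    rw [max_eq_left (le_of_lt ht)]

/-- The `C¹` truncation `t ↦ ((δ - t)⁺)²`. -/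
def truncSq (δ t : ℝ) : ℝ := max (δ - t) 0 ^ 2

theorem hasDerivAt_truncSq (δ t : ℝ) : HasDerivAt (truncSq δ) (-2 * max (δ - t) 0) t := by
  have h := (hasDerivAt_max_sq (δ - t)).comp t ((hasDerivAt_const t δ).sub (hasDerivAt_id t))
  simp only [zero_sub, mul_neg, mul_one] at h
  rw [neg_mul]
  exact h

theorem contDiff_truncSq (δ : ℝ) : ContDiff ℝ 1 (truncSq δ) := by
  rw [contDiff_one_iff_deriv]
  refine ⟨fun t => (hasDerivAt_truncSq δ t).differentiableAt, ?_⟩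
  rw [show deriv (truncSq δ) = fun t => -2 * max (δ - t) 0 from
    funext fun t => (hasDerivAt_truncSq δ t).deriv]
  fun_prop

theorem truncSq_of_le {δ t : ℝ} (h : δ ≤ t) : truncSq δ t = 0 := by
  rw [truncSq, max_eq_right (by linarith)]; simp

theorem truncSq_nonneg (δ t : ℝ) : 0 ≤ truncSq δ t := sq_nonneg _

theorem truncSq_le {δ t : ℝ} (hδ : 0 ≤ δ) (ht : 0 ≤ t) : truncSq δ t ≤ δ ^ 2 := by
  unfold truncSq
  gcongr
  exact max_le (by linarith) hδ

variable {X : Type*} [MeasurableSpace X] {ν : Measure X} {w : X → ℝ}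

/-- Chebyshev's inequality: the integrand on the left is at least `δ²/4` on `{w < δ/2}`, and the one
on the right is at most `δ` and supported in `{w < δ}`. -/
theorem measure_sublevel_half_le [IsFiniteMeasure ν] (hw : Measurable w) (hw0 : ∀ x, 0 ≤ w x) {c κ δ : ℝ} (hc : 0 < c)
    (hκ : 0 ≤ κ) (hδ : 0 < δ)
    (h : c * ∫ x, truncSq δ (w x) ∂ν ≤ κ * δ * ∫ x, max (δ - w x) 0 ∂ν) :
    ν.real {x | w x < δ / 2} ≤ 4 * κ / c * ν.real {x | w x < δ} := by
  have hm : ∀ t, MeasurableSet {x | w x < t} := fun t => measurableSet_lt hw measurable_const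
  have b1 : ∀ x, ‖truncSq δ (w x)‖ ≤ δ ^ 2 := fun x => by
    rw [Real.norm_eq_abs, abs_of_nonneg (truncSq_nonneg _ _)]
    exact truncSq_le hδ.le (hw0 x)
  have b2 : ∀ x, ‖max (δ - w x) 0‖ ≤ δ := fun x => by
    rw [Real.norm_eq_abs, abs_of_nonneg (le_max_right _ _)]
    exact max_le (by linarith [hw0 x]) hδ.le
  have i1 : Integrable (fun x => truncSq δ (w x)) ν :=
    Integrable.of_bound (((contDiff_truncSq δ).continuous.measurable.comp hw).aestronglyMeasurable)
      _ (Eventually.of_forall b1)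
  have i2 : Integrable (fun x => max (δ - w x) 0) ν :=
    Integrable.of_bound (((measurable_const.sub hw).max measurable_const).aestronglyMeasurable)
      _ (Eventually.of_forall b2)
  have e1 : (δ / 2) ^ 2 * ν.real {x | w x < δ / 2} ≤ ∫ x, truncSq δ (w x) ∂ν := by
    have : ∫ x, {x | w x < δ / 2}.indicator (fun _ => (δ / 2) ^ 2) x ∂ν =
        (δ / 2) ^ 2 * ν.real {x | w x < δ / 2} := by
      rw [integral_indicator_const _ (hm _), smul_eq_mul, mul_comm]
    rw [← this]
    refine integral_mono ((integrable_const _).indicator (hm _)) i1 fun x => ?_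
    by_cases hx : w x < δ / 2
    · rw [indicator_of_mem (by exact hx), truncSq]
      gcongr
      exact le_max_of_le_left (by linarith)
    · rw [indicator_of_notMem (by exact hx)]
      exact truncSq_nonneg _ _
  have e2 : ∫ x, max (δ - w x) 0 ∂ν ≤ δ * ν.real {x | w x < δ} := by
    have : ∫ x, {x | w x < δ}.indicator (fun _ => δ) x ∂ν = δ * ν.real {x | w x < δ} := by
      rw [integral_indicator_const _ (hm _), smul_eq_mul, mul_comm]
    rw [← this]
    refine integral_mono i2 ((integrable_const _).indicator (hm _)) fun x => ?_
    by_cases hx : w x < δ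
    · rw [indicator_of_mem (by exact hx)]
      exact (le_abs_self _).trans (b2 x)
    · rw [indicator_of_notMem (by exact hx)]
      exact max_le (by linarith [not_lt.1 hx]) le_rfl
  have e3 : c * ((δ / 2) ^ 2 * ν.real {x | w x < δ / 2}) ≤ κ * δ * (δ * ν.real {x | w x < δ}) :=
    (mul_le_mul_of_nonneg_left e1 hc.le).trans (h.trans (mul_le_mul_of_nonneg_left e2 (by positivity)))
  rw [div_mul_eq_mul_div, le_div_iff₀ hc]
  have hδ2 : 0 < δ ^ 2 := by positivity
  refine le_of_mul_le_mul_left ?_ hδ2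
  nlinarith

/-- A measure whose sublevel sets `{w < δ}` have at least polynomial size cannot decay by a small
factor under each halving of `δ`. -/
theorem false_of_measure_decay {c' δ₀ θ : ℝ} {d : ℕ} (hc' : 0 < c') (hδ₀ : 0 < δ₀) (hθ : 0 ≤ θ)
    (hθd : θ * 2 ^ d ≤ 1 / 2)
    (hlow : ∀ δ, 0 < δ → δ ≤ δ₀ → c' * δ ^ d ≤ ν.real {x | w x < δ})
    (hdec : ∀ δ, 0 < δ → δ ≤ δ₀ → ν.real {x | w x < δ / 2} ≤ θ * ν.real {x | w x < δ}) : False := by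
  set V := ν.real {x | w x < δ₀}
  have hstep : ∀ k : ℕ, ν.real {x | w x < δ₀ / 2 ^ k} ≤ θ ^ k * V := by
    intro k
    induction k with
    | zero => simp [V]
    | succ k ih =>
      have h1 := hdec (δ₀ / 2 ^ k) (by positivity) (div_le_self hδ₀.le (one_le_pow₀ one_le_two))
      rw [pow_succ, ← div_div, pow_succ, mul_comm (θ ^ k), mul_assoc]
      exact h1.trans (mul_le_mul_of_nonneg_left ih hθ)
  -- The lower bound at `δ₀ / 2^k` and `k` decay steps give `c' (δ₀ / 2^k)^d ≤ θ^k V`;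
  -- multiplication by `2^(kd)` leaves the ratio `θ 2^d ≤ 1/2`. The right-hand side tends to zero,
  -- the left-hand side is a positive constant.
  have hk : ∀ k : ℕ, c' * δ₀ ^ d ≤ (1 / 2) ^ k * V := by
    intro k
    have h1 := hlow (δ₀ / 2 ^ k) (by positivity) (div_le_self hδ₀.le (one_le_pow₀ one_le_two))
    have h2 := h1.trans (hstep k)
    rw [div_pow, ← mul_div_assoc, div_le_iff₀ (by positivity)] at h2
    refine h2.trans ?_
    have h3 : θ ^ k * V * (2 ^ k) ^ d = (θ * 2 ^ d) ^ k * V := by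
      rw [mul_pow, ← pow_mul, ← pow_mul, mul_comm k d]; ring
    rw [h3]
    gcongr
  have hlim : Tendsto (fun k : ℕ => (1 / 2 : ℝ) ^ k * V) atTop (𝓝 (0 * V)) :=
    (tendsto_pow_atTop_nhds_zero_of_lt_one (by norm_num) (by norm_num)).mul_const _
  rw [zero_mul] at hlim
  have := ge_of_tendsto' hlim hk
  have h5 : 0 < c' * δ₀ ^ d := by positivity
  linarith

end VolumeDecay

/-! ### The energy estimate -/

section Energy

open Filter Topology

variable {E : Type*} [NormedAddCommGroup E] [NormedSpace ℝ E] {H : Type*} [TopologicalSpace H]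
  {I : ModelWithCorners ℝ E H} {N : Type*} [TopologicalSpace N] [ChartedSpace H N]
  [IsManifold I ∞ N] {ι : Type} [Fintype ι] [DecidableEq ι] [MeasurableSpace N] [BorelSpace N]

namespace InteriorMetric

/-- Cut-off functions that approximate `1` on the part of `s` in the interior, vanish near the
boundary, and whose gradients are negligible against that of `u`. -/
structure CutoffSequence (m : InteriorMetric I N) (μ : Measure N) (u : N → ℝ) (R s : Set N) where
  θ : ℕ → N → ℝ
  contMDiffOn : ∀ k, ContMDiffOn I 𝓘(ℝ, ℝ) 1 (θ k) (R ∩ I.interior N)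
  nonneg : ∀ k p, 0 ≤ θ k p
  le_one : ∀ k p, θ k p ≤ 1
  tendsto_one : ∀ p ∈ s ∩ I.interior N, Tendsto (fun k => θ k p) atTop (𝓝 1)
  K : ℕ → Set N
  isClosed_K : ∀ k, IsClosed (K k)
  K_subset : ∀ k, s ∩ K k ⊆ I.interior N
  eq_zero : ∀ k, ∀ p ∈ s, p ∉ K k → θ k p = 0
  A : ℕ → Set N
  measurableSet_A : ∀ k, MeasurableSet (A k)
  A_lt_top : ∀ k, μ (A k) < ⊤
  b : ℕ → ℝ
  b_nonneg : ∀ k, 0 ≤ b k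
  pairing_le : ∀ k, ∀ p ∈ R ∩ I.interior N, |m.pairing u (θ k) p| ≤ (A k).indicator (fun _ => b k) p
  tendsto_zero : Tendsto (fun k => b k * μ.real (A k)) atTop (𝓝 0)

variable {m : InteriorMetric I N} {μ : Measure N}

/-- Green's formula with `θₖ φ`, where `φ = ((δ - w)⁺)²`. The term with `f` is at most `-c ∫ θₖ φ`.
In the gradient term, `∇φ = -2 (δ - w)⁺ ∇w` contributes at most `2κδ ∫ (δ - w)⁺`, and `φ ⟨∇u, ∇θₖ⟩`
at most `δ² bₖ μ(Aₖ)`, which tends to zero. The cut-offs are what replaces a boundary condition: `θₖ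
φ` has compact support in the interior. -/
theorem IsVolume.energy_le [T2Space N] [SigmaCompactSpace N] [FiniteDimensional ℝ E]
    (hμ : m.IsVolume ι μ) (hcov : ∀ p ∈ I.interior N, ∃ ψ : LocalCoord I N ι, p ∈ ψ.target)
    {u f : N → ℝ} (hu : ContMDiffOn I 𝓘(ℝ, ℝ) 1 u (I.interior N))
    (hf : ContinuousOn f (I.interior N)) (hΔ : IsWeakLaplacian m.tensor u f) {R s : Set N}
    (hR : IsOpen R) (hRfin : μ R < ⊤) (hs : IsCompact s) (hsR : s ⊆ R)
    (C : CutoffSequence m μ u R s) {c : ℝ} (hfc : ∀ p ∈ R, f p ≤ -c) {w : N → ℝ}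
    (hw : Measurable w) (hw0 : ∀ p, 0 ≤ w p) (hw1 : ContMDiffOn I 𝓘(ℝ, ℝ) 1 w (R ∩ I.interior N))
    {δ κ : ℝ} (hδ : 0 < δ) (hκ : 0 ≤ κ) (hws : ∀ p, w p < δ → p ∈ s)
    (hpair : ∀ p ∈ R ∩ I.interior N, w p < δ → -m.pairing u w p ≤ κ * δ) :
    c * ∫ p, truncSq δ (w p) ∂(μ.restrict R) ≤
      2 * κ * δ * ∫ p, max (δ - w p) 0 ∂(μ.restrict R) := by
  have hint : IsOpen (I.interior N) := I.isOpen_interior (n := ∞) (by simp)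
  have hfin : IsFiniteMeasure (μ.restrict R) := ⟨by simpa using hRfin⟩
  have hRm := hR.measurableSet
  set φ : N → ℝ := fun p => truncSq δ (w p) with hφ
  have hφ0 : ∀ p, p ∉ s → φ p = 0 := fun p hp => truncSq_of_le (not_lt.1 fun h => hp (hws p h))
  have hφn : ∀ p, 0 ≤ φ p := fun p => truncSq_nonneg _ _
  have hφδ : ∀ p, φ p ≤ δ ^ 2 := fun p => truncSq_le hδ.le (hw0 p)
  have hφm : Measurable φ := (contDiff_truncSq δ).continuous.measurable.comp hw
  have hφ1 : ContMDiffOn I 𝓘(ℝ, ℝ) 1 φ (R ∩ I.interior N) :=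
    (contDiff_truncSq δ).contMDiff.comp_contMDiffOn hw1
  have b2 : ∀ x, ‖max (δ - w x) 0‖ ≤ δ := fun x => by
    rw [Real.norm_eq_abs, abs_of_nonneg (le_max_right _ _)]
    exact max_le (by linarith [hw0 x]) hδ.le
  have iφ : Integrable φ (μ.restrict R) := Integrable.of_bound hφm.aestronglyMeasurable (δ ^ 2)
    (Eventually.of_forall fun p => by
      rw [Real.norm_eq_abs, abs_of_nonneg (hφn p)]; exact hφδ p)
  have iw : Integrable (fun p => max (δ - w p) 0) (μ.restrict R) :=
    Integrable.of_bound (((measurable_const.sub hw).max measurable_const).aestronglyMeasurable)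
      _ (Eventually.of_forall b2)
  have hmd : ∀ {a : N → ℝ}, ContMDiffOn I 𝓘(ℝ, ℝ) 1 a (R ∩ I.interior N) →
      ∀ p ∈ R ∩ I.interior N, MDifferentiableAt I 𝓘(ℝ, ℝ) a p := fun ha p hp =>
    (ha.contMDiffAt ((hR.inter hint).mem_nhds hp)).mdifferentiableAt one_ne_zero
  set B := ∫ p, max (δ - w p) 0 ∂(μ.restrict R) with hB
  have hae : ∀ᵐ p ∂μ, p ∈ I.interior N := by
    filter_upwards [compl_mem_ae_iff.2 hμ.2] with p hp
    simpa using hp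
  have step : ∀ k, c * ∫ p, C.θ k p * φ p ∂(μ.restrict R) ≤
      2 * κ * δ * B + δ ^ 2 * (C.b k * μ.real (C.A k)) := by
    intro k
    have hz : ∀ p, p ∉ s ∩ C.K k → C.θ k p * φ p = 0 := by
      intro p hp
      by_cases hps : p ∈ s
      · rw [C.eq_zero k p hps fun h => hp ⟨hps, h⟩, zero_mul]
      · rw [hφ0 p hps, mul_zero]
    -- On `R` both factors are `C¹`. A point outside `R` has a neighbourhood disjoint from the
    -- closed set `s`, on which `φ` vanishes.
    have hΦ : ContMDiffOn I 𝓘(ℝ, ℝ) 1 (fun p => C.θ k p * φ p) (I.interior N) := by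
      intro p hp
      by_cases hpR : p ∈ R
      · exact (((C.contMDiffOn k).mul hφ1).contMDiffAt
          ((hR.inter hint).mem_nhds ⟨hpR, hp⟩)).contMDiffWithinAt
      · have : (fun p => C.θ k p * φ p) =ᶠ[𝓝 p] fun _ => 0 :=
          eventually_of_mem (hs.isClosed.isOpen_compl.mem_nhds fun h => hpR (hsR h))
            fun q hq => by simp only [hφ0 q hq, mul_zero]
        exact (contMDiffAt_const.congr_of_eventuallyEq this).contMDiffWithinAt
    obtain ⟨j1, j2, j3⟩ := hμ.green hcov hu hf hΔ hΦ (hs.inter_right (C.isClosed_K k))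
      (C.K_subset k) hz
    have k1 : Integrable (fun p => C.θ k p * φ p) (μ.restrict R) := by
      refine iφ.mono ?_ (Eventually.of_forall fun p => ?_)
      · have hRi : μ.restrict R = μ.restrict (R ∩ I.interior N) :=
          Measure.restrict_congr_set (by
            filter_upwards [hae] with p hp
            exact propext ⟨fun h => ⟨h, hp⟩, fun h => h.1⟩)
        rw [hRi]
        exact ((C.contMDiffOn k).continuousOn.mul hφ1.continuousOn).aestronglyMeasurable
          (hR.inter hint).measurableSet
      · rw [norm_mul, Real.norm_eq_abs, abs_of_nonneg (C.nonneg k p)]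
        exact mul_le_of_le_one_left (norm_nonneg _) (C.le_one k p)
    have hoff1 : ∀ p, p ∉ R → m.pairing u (fun p => C.θ k p * φ p) p = 0 := fun p hp =>
      m.pairing_eq_zero u (eventually_of_mem
        (hs.isClosed.isOpen_compl.mem_nhds fun h => hp (hsR h))
        fun q hq => by simp only [hφ0 q hq, mul_zero])
    have hoff2 : ∀ p, p ∉ R → f p * (C.θ k p * φ p) = 0 := fun p hp => by
      rw [hφ0 p fun h => hp (hsR h)]; ring
    rw [← setIntegral_eq_integral_of_forall_compl_eq_zero hoff1,
      ← setIntegral_eq_integral_of_forall_compl_eq_zero hoff2] at j3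
    have l1 : ∫ p in R, f p * (C.θ k p * φ p) ∂μ ≤ - (c * ∫ p in R, C.θ k p * φ p ∂μ) := by
      rw [← integral_const_mul, ← integral_neg]
      refine setIntegral_mono_on j2.integrableOn (k1.const_mul c).neg hRm fun p hp => ?_
      have : 0 ≤ C.θ k p * φ p := mul_nonneg (C.nonneg k p) (hφn p)
      nlinarith [hfc p hp]
    have iA : Integrable ((C.A k).indicator fun _ => C.b k) μ :=
      (integrable_indicator_iff (C.measurableSet_A k)).2
        (integrableOn_const (C.A_lt_top k).ne)
    have l2 : ∫ p in R, m.pairing u (fun p => C.θ k p * φ p) p ∂μ ≤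
        2 * κ * δ * B + δ ^ 2 * (C.b k * μ.real (C.A k)) := by
      have i3 : Integrable (fun p => 2 * κ * δ * max (δ - w p) 0 +
          δ ^ 2 * (C.A k).indicator (fun _ => C.b k) p) (μ.restrict R) :=
        (iw.const_mul _).add (iA.integrableOn.const_mul _)
      have l3 : ∫ p in R, m.pairing u (fun p => C.θ k p * φ p) p ∂μ ≤
          ∫ p in R, (2 * κ * δ * max (δ - w p) 0 +
            δ ^ 2 * (C.A k).indicator (fun _ => C.b k) p) ∂μ := by
        refine integral_mono_ae j1.integrableOn i3 ?_
        filter_upwards [ae_restrict_of_ae hae, ae_restrict_mem hRm] with p hpi hpR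
        have hp : p ∈ R ∩ I.interior N := ⟨hpR, hpi⟩
        have e1 := m.pairing_mul u (hmd (C.contMDiffOn k) p hp) (hmd hφ1 p hp)
        have e2 : m.pairing u φ p = -2 * max (δ - w p) 0 * m.pairing u w p :=
          m.pairing_comp u (hasDerivAt_truncSq δ (w p)) (hmd hw1 p hp)
        rw [e1, e2]
        have hmax : 0 ≤ max (δ - w p) 0 := le_max_right _ _
        have e3 : -2 * max (δ - w p) 0 * m.pairing u w p ≤ 2 * κ * δ * max (δ - w p) 0 := by
          by_cases h : w p < δ
          · nlinarith [hpair p hp h]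
          · rw [max_eq_right (by linarith [not_lt.1 h])]; simp
        have e4 : C.θ k p * (-2 * max (δ - w p) 0 * m.pairing u w p) ≤
            2 * κ * δ * max (δ - w p) 0 :=
          (mul_le_mul_of_nonneg_left e3 (C.nonneg k p)).trans
            (mul_le_of_le_one_left (by positivity) (C.le_one k p))
        have e5 : φ p * m.pairing u (C.θ k) p ≤
            δ ^ 2 * (C.A k).indicator (fun _ => C.b k) p :=
          (mul_le_mul_of_nonneg_left ((le_abs_self _).trans (C.pairing_le k p hp)) (hφn p)).trans
            (mul_le_mul_of_nonneg_right (hφδ p) ((abs_nonneg _).trans (C.pairing_le k p hp)))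
        exact add_le_add e4 e5
      refine l3.trans ?_
      rw [integral_add (iw.const_mul _) (iA.integrableOn.const_mul _), integral_const_mul,
        integral_const_mul]
      have l4 : ∫ p in R, (C.A k).indicator (fun _ => C.b k) p ∂μ ≤ C.b k * μ.real (C.A k) := by
        refine (setIntegral_le_integral iA (Eventually.of_forall fun p =>
          indicator_nonneg (fun _ _ => C.b_nonneg k) p)).trans ?_
        rw [integral_indicator_const _ (C.measurableSet_A k), smul_eq_mul, mul_comm]
      gcongr
    linarith
  -- Dominated convergence with majorant `φ`.
  have lim1 : Tendsto (fun k => ∫ p, C.θ k p * φ p ∂(μ.restrict R)) atTop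
      (𝓝 (∫ p, φ p ∂(μ.restrict R))) := by
    have hRi : μ.restrict R = μ.restrict (R ∩ I.interior N) :=
      Measure.restrict_congr_set (by
        filter_upwards [hae] with p hp
        exact propext ⟨fun h => ⟨h, hp⟩, fun h => h.1⟩)
    refine tendsto_integral_of_dominated_convergence φ (fun k => ?_) iφ
      (fun k => Eventually.of_forall fun p => ?_) ?_
    · rw [hRi]
      exact ((C.contMDiffOn k).continuousOn.mul hφ1.continuousOn).aestronglyMeasurable
        (hR.inter hint).measurableSet
    · rw [Real.norm_eq_abs, abs_of_nonneg (mul_nonneg (C.nonneg k p) (hφn p))]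
      exact mul_le_of_le_one_left (hφn p) (C.le_one k p)
    · filter_upwards [ae_restrict_of_ae hae] with p hp
      by_cases hps : p ∈ s
      · simpa using (C.tendsto_one p ⟨hps, hp⟩).mul_const (φ p)
      · simp [hφ0 p hps]
  have lim2 : Tendsto (fun k => 2 * κ * δ * B + δ ^ 2 * (C.b k * μ.real (C.A k))) atTop
      (𝓝 (2 * κ * δ * B + δ ^ 2 * 0)) := (C.tendsto_zero.const_mul _).const_add _
  have := le_of_tendsto_of_tendsto' (lim1.const_mul c) lim2 step
  simpa using this

end InteriorMetric

end Energy

/-! ### Supersolutions cannot have a confined minimum -/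

section Supersolution

open Filter Topology

variable {E : Type*} [NormedAddCommGroup E] [NormedSpace ℝ E] {H : Type*} [TopologicalSpace H]
  {I : ModelWithCorners ℝ E H} {N : Type*} [TopologicalSpace N] [ChartedSpace H N]

/-- The differential of a real function as a covector. -/
def differential (Φ : N → ℝ) (p : N) : TangentSpace I p →L[ℝ] ℝ := mfderiv I 𝓘(ℝ, ℝ) Φ p

variable [IsManifold I ∞ N] {ι : Type} [Fintype ι] [DecidableEq ι]

namespace InteriorMetric

variable {m : InteriorMetric I N}

theorem pairing_self (hcov : ∀ p ∈ I.interior N, ∃ ψ : LocalCoord I N ι, p ∈ ψ.target)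
    {u : N → ℝ} {p : N} (hp : p ∈ I.interior N) (hu : MDifferentiableAt I 𝓘(ℝ, ℝ) u p) :
    m.pairing u u p = m.g p (m.grad u p) (m.grad u p) := by
  obtain ⟨ψ, hψ⟩ := hcov p hp
  have hv := ψ.inv_mem hψ
  have e := ψ.toFun_inv hψ
  generalize ψ.invFun p = v at hv e
  subst e
  exact (m.g_grad ψ hv hu _).symm

variable [MeasurableSpace N] [BorelSpace N] {μ : Measure N}

/-- A function with `Δu ≤ -c < 0` on `R` has no interior minimum in the sense that a barrier `ρ`
cannot confine its sublevel sets. -/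
theorem IsVolume.false_of_supersolution [T2Space N] [SigmaCompactSpace N] [FiniteDimensional ℝ E]
    (hμ : m.IsVolume ι μ) (hcov : ∀ p ∈ I.interior N, ∃ ψ : LocalCoord I N ι, p ∈ ψ.target)
    {u f : N → ℝ} (hu : ContMDiffOn I 𝓘(ℝ, ℝ) 1 u (I.interior N)) (huc : Continuous u)
    (hf : ContinuousOn f (I.interior N)) (hΔ : IsWeakLaplacian m.tensor u f) {R s : Set N}
    (hR : IsOpen R) (hRfin : μ R < ⊤) (hs : IsCompact s) (hsR : s ⊆ R)
    (C : CutoffSequence m μ u R s) {c : ℝ} (hc : 0 < c) (hfc : ∀ p ∈ R, f p ≤ -c)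
    {m₀ : ℝ} (hmin : ∀ p, m₀ ≤ u p) {ρ : N → ℝ} (hρ0 : ∀ p ∈ R, 0 ≤ ρ p)
    (hρc : ContinuousOn ρ R) (hρ1 : ContMDiffOn I 𝓘(ℝ, ℝ) 1 ρ (R ∩ I.interior N))
    {r₁ : ℝ} (hr₁ : 0 < r₁) (hρs : ∀ p ∈ R, p ∉ s → r₁ ≤ ρ p) {K : ℝ} (hK : 0 ≤ K)
    (hρK : ∀ p ∈ R ∩ I.interior N, ∀ ξ : TangentSpace I p,
      differential ρ p ξ ^ 2 ≤ K * ρ p * m.g p ξ ξ)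
    {c' t₀ : ℝ} {d : ℕ} (hc' : 0 < c') (ht₀ : 0 < t₀)
    (hlow : ∀ t, 0 < t → t ≤ t₀ → c' * t ^ d ≤ μ.real {p | p ∈ R ∧ u p - m₀ < t ∧ ρ p < t}) :
    False := by
  have hint : IsOpen (I.interior N) := I.isOpen_interior (n := ∞) (by simp)
  have hfin : IsFiniteMeasure (μ.restrict R) := ⟨by simpa using hRfin⟩
  -- The decay factor will be `2εK/c`, and it must not exceed `2^(-d)/2`. Writing `K + 1` for `K`
  -- avoids division by zero. With `ε ≤ 1`, both `u - m₀ < δ/2` and `ρ < δ/2` together imply `w <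
  -- δ`.
  obtain ⟨ε, hε, hε1, hεc⟩ : ∃ ε : ℝ, 0 < ε ∧ ε ≤ 1 ∧ 4 * (K + 1) * 2 ^ d * ε ≤ c := by
    refine ⟨min 1 (c / (4 * (K + 1) * 2 ^ d)), by positivity, min_le_left _ _, ?_⟩
    calc _ ≤ 4 * (K + 1) * 2 ^ d * (c / (4 * (K + 1) * 2 ^ d)) := by
          gcongr; exact min_le_right _ _
      _ = c := by field_simp
  classical
  set w₀ : N → ℝ := fun p => u p - m₀ + ε * ρ p with hw₀
  -- Nothing is known about `ρ` off `R`. The value `1` there keeps the sublevel sets `{w < δ}`, `δ ≤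
  -- 1`, inside `R`.
  set w : N → ℝ := R.piecewise w₀ fun _ => 1 with hw
  have hwR : ∀ p ∈ R, w p = w₀ p := fun p hp => piecewise_eq_of_mem _ _ _ hp
  have hwR' : ∀ p, p ∉ R → w p = 1 := fun p hp => piecewise_eq_of_notMem _ _ _ hp
  have hwm : Measurable w := by
    refine ContinuousOn.measurable_piecewise ?_ continuousOn_const hR.measurableSet
    exact (huc.continuousOn.sub continuousOn_const).add (continuousOn_const.mul hρc)
  have hw0 : ∀ p, 0 ≤ w p := fun p => by
    by_cases hp : p ∈ R
    · rw [hwR p hp]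
      exact add_nonneg (sub_nonneg.2 (hmin p)) (mul_nonneg hε.le (hρ0 p hp))
    · rw [hwR' p hp]; exact zero_le_one
  have hwev : ∀ p ∈ R, w =ᶠ[𝓝 p] w₀ := fun p hp => eventually_of_mem (hR.mem_nhds hp) hwR
  have hw₀1 : ContMDiffOn I 𝓘(ℝ, ℝ) 1 w₀ (R ∩ I.interior N) :=
    ((hu.mono inter_subset_right).sub contMDiffOn_const).add (contMDiffOn_const.mul hρ1)
  have hw1 : ContMDiffOn I 𝓘(ℝ, ℝ) 1 w (R ∩ I.interior N) :=
    hw₀1.congr fun p hp => hwR p hp.1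
  have hmdρ : ∀ p ∈ R ∩ I.interior N, MDifferentiableAt I 𝓘(ℝ, ℝ) ρ p := fun p hp =>
    (hρ1.contMDiffAt ((hR.inter hint).mem_nhds hp)).mdifferentiableAt one_ne_zero
  have hmdu : ∀ p ∈ R ∩ I.interior N, MDifferentiableAt I 𝓘(ℝ, ℝ) u p := fun p hp =>
    (hu.contMDiffAt (hint.mem_nhds hp.2)).mdifferentiableAt one_ne_zero
  have hpw : ∀ p ∈ R ∩ I.interior N, m.pairing u w p =
      m.g p (m.grad u p) (m.grad u p) + ε * m.pairing u ρ p := by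
    intro p hp
    have h1 : HasDerivAt (fun t : ℝ => t - m₀) 1 (u p) := (hasDerivAt_id _).sub_const _
    have h2 : HasDerivAt (fun t : ℝ => ε * t) ε (ρ p) := by
      simpa using (hasDerivAt_id (ρ p)).const_mul ε
    have d1 : MDifferentiableAt I 𝓘(ℝ, ℝ) (fun q => u q - m₀) p :=
      (h1.differentiableAt.mdifferentiableAt).comp p (hmdu p hp)
    have d2 : MDifferentiableAt I 𝓘(ℝ, ℝ) (fun q => ε * ρ q) p :=
      (h2.differentiableAt.mdifferentiableAt).comp p (hmdρ p hp)
    rw [m.pairing_congr u (hwev p hp.1), m.pairing_add u d1 d2,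
      m.pairing_comp u h1 (hmdu p hp), m.pairing_comp u h2 (hmdρ p hp), one_mul,
      pairing_self hcov hp.2 (hmdu p hp)]
  -- The second bound forces `ρ < r₁` on `{w < δ}`, since `ε ρ ≤ w`, and so confines this set to
  -- `s`.
  obtain ⟨δ₀, hδ₀, hδ1, hδr, hδt⟩ : ∃ δ₀ : ℝ, 0 < δ₀ ∧ δ₀ ≤ 1 ∧ δ₀ ≤ ε * r₁ ∧ δ₀ ≤ t₀ :=
    ⟨min 1 (min (ε * r₁) t₀), by positivity, min_le_left _ _,
      (min_le_right _ _).trans (min_le_left _ _), (min_le_right _ _).trans (min_le_right _ _)⟩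
  refine false_of_measure_decay (ν := μ.restrict R) (w := w) (c' := c' / 2 ^ d) (δ₀ := δ₀)
    (θ := 4 * (2 * (ε * K / 4)) / c) (d := d) (by positivity) hδ₀ (by positivity) ?_ ?_ ?_
  · rw [div_mul_eq_mul_div, div_le_iff₀ hc]
    have : 0 ≤ 4 * 2 ^ d * ε := by positivity
    nlinarith
  · intro δ hδ hδδ
    have h1 := hlow (δ / 2) (by positivity) (by linarith)
    rw [div_pow, ← mul_div_assoc, mul_div_right_comm] at h1
    refine h1.trans ?_
    rw [measureReal_restrict_apply (measurableSet_lt hwm measurable_const)]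
    refine measureReal_mono ?_ (ne_top_of_le_ne_top hRfin.ne (measure_mono inter_subset_right))
    rintro p ⟨hpR, hpu, hpρ⟩
    refine ⟨?_, hpR⟩
    have : ε * ρ p ≤ 1 * ρ p := mul_le_mul_of_nonneg_right hε1 (hρ0 p hpR)
    rw [mem_ofPred_eq, hwR p hpR]
    show u p - m₀ + ε * ρ p < δ
    linarith
  · intro δ hδ hδδ
    have hsub : ∀ p, w p < δ → p ∈ R := fun p hp => by
      by_contra h
      rw [hwR' p h] at hp
      linarith
    have hle : ∀ p ∈ R, ε * ρ p ≤ w p := fun p hp => by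
      rw [hwR p hp]
      show ε * ρ p ≤ u p - m₀ + ε * ρ p
      linarith [hmin p]
    refine measure_sublevel_half_le hwm hw0 hc (by positivity) hδ
      (hμ.energy_le hcov hu hf hΔ hR hRfin hs hsR C hfc hwm hw0 hw1 hδ (by positivity)
        (fun p hp => ?_) fun p hp hpw' => ?_)
    · by_contra hps
      have h1 := hle p (hsub p hp)
      have h2 := mul_le_mul_of_nonneg_left (hρs p (hsub p hp) hps) hε.le
      linarith
    · rw [hpw p hp]
      have h1 : (m.pairing u ρ p) ^ 2 ≤ K * ρ p * m.g p (m.grad u p) (m.grad u p) :=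
        hρK p hp _
      have h2 : 0 ≤ m.g p (m.grad u p) (m.grad u p) := by
        by_cases h : m.grad u p = 0
        · rw [h]; simp
        · exact (m.pos p hp.2 _ h).le
      have h3 := hle p hp.1
      have h4 := hρ0 p hp.1
      set G := m.g p (m.grad u p) (m.grad u p)
      set x := m.pairing u ρ p
      set r := ρ p
      have h5 : ε * K / 4 * (ε * r) ≤ ε * K / 4 * δ :=
        mul_le_mul_of_nonneg_left (h3.trans hpw'.le) (by positivity)
      refine le_trans ?_ h5
      -- With `G = |∇u|²`, `x = ⟨∇u, ∇ρ⟩` and `y = ε²Kr`, one has `(εx)² ≤ yG`. If `-(G + εx) >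
      -- y/4`, then `(G + y/4)² < yG`, that is `(G - y/4)² < 0`.
      by_contra hlt
      push Not at hlt
      have hy : 0 ≤ ε ^ 2 * (K * r) := by positivity
      have h6 : (ε * x) ^ 2 ≤ ε ^ 2 * (K * r) * G := by
        rw [mul_pow, mul_assoc (ε ^ 2)]
        exact mul_le_mul_of_nonneg_left h1 (sq_nonneg _)
      have h7 : G + ε ^ 2 * (K * r) / 4 < -(ε * x) := by nlinarith
      have h8 : (G + ε ^ 2 * (K * r) / 4) ^ 2 < (-(ε * x)) ^ 2 :=
        pow_lt_pow_left₀ h7 (by positivity) two_ne_zero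
      nlinarith [sq_nonneg (G - ε ^ 2 * (K * r) / 4)]

end InteriorMetric

end Supersolution

/-! ### Quadratic forms with convergent coefficients -/

section Quadratic

open Filter Topology Matrix

variable {ι : Type} [Fintype ι]

theorem norm_sq_le_sum_sq (ξ : ι → ℝ) : ‖ξ‖ ^ 2 ≤ ∑ i, ξ i ^ 2 := by
  have h : ‖ξ‖ ≤ √(∑ i, ξ i ^ 2) := by
    refine (pi_norm_le_iff_of_nonneg (Real.sqrt_nonneg _)).2 fun i => ?_
    rw [Real.norm_eq_abs]
    refine Real.abs_le_sqrt ?_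
    exact Finset.single_le_sum (f := fun i => ξ i ^ 2) (fun i _ => sq_nonneg _) (Finset.mem_univ i)
  calc ‖ξ‖ ^ 2 ≤ √(∑ i, ξ i ^ 2) ^ 2 := by gcongr
    _ = _ := Real.sq_sqrt (Finset.sum_nonneg fun i _ => sq_nonneg _)

theorem sum_sq_le_norm_sq (ξ : ι → ℝ) : ∑ i, ξ i ^ 2 ≤ Fintype.card ι * ‖ξ‖ ^ 2 := by
  calc ∑ i, ξ i ^ 2 ≤ ∑ _i : ι, ‖ξ‖ ^ 2 := by
        refine Finset.sum_le_sum fun i _ => ?_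
        rw [← sq_abs]
        gcongr
        exact norm_le_pi_norm ξ i
    _ = _ := by simp

theorem abs_dotProduct_mulVec_le {A : Matrix ι ι ℝ} {η : ℝ} (hA : ∀ i j, |A i j| ≤ η)
    (ξ : ι → ℝ) : |ξ ⬝ᵥ (A *ᵥ ξ)| ≤ (Fintype.card ι : ℝ) ^ 2 * η * ‖ξ‖ ^ 2 := by
  simp only [dotProduct, mulVec, Finset.mul_sum]
  calc _ ≤ ∑ _i : ι, ∑ _j : ι, η * ‖ξ‖ ^ 2 := by
        refine (Finset.abs_sum_le_sum_abs _ _).trans (Finset.sum_le_sum fun i _ => ?_)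
        refine (Finset.abs_sum_le_sum_abs _ _).trans (Finset.sum_le_sum fun j _ => ?_)
        rw [abs_mul, abs_mul]
        have h1 : |ξ i| ≤ ‖ξ‖ := norm_le_pi_norm ξ i
        have h2 : |ξ j| ≤ ‖ξ‖ := norm_le_pi_norm ξ j
        calc |ξ i| * (|A i j| * |ξ j|) = |A i j| * (|ξ i| * |ξ j|) := by ring
          _ ≤ η * (‖ξ‖ * ‖ξ‖) := by
            gcongr
            · exact (abs_nonneg _).trans (hA i j)
            · exact hA i j
          _ = _ := by ring
    _ = _ := by simp; ring

/-- A quadratic form that is positive definite at one point is uniformly so nearby. -/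
theorem eventually_quadratic_ge {X : Type*} {l : Filter X} {A : X → Matrix ι ι ℝ}
    {A₀ : Matrix ι ι ℝ} (hA : ∀ i j, Tendsto (fun x => A x i j) l (𝓝 (A₀ i j)))
    (hpos : ∀ ξ : ι → ℝ, ξ ≠ 0 → 0 < ξ ⬝ᵥ (A₀ *ᵥ ξ)) :
    ∃ c > 0, ∀ᶠ x in l, ∀ ξ, c * ∑ i, ξ i ^ 2 ≤ ξ ⬝ᵥ (A x *ᵥ ξ) := by
  have hcont : Continuous fun ξ : ι → ℝ => ξ ⬝ᵥ (A₀ *ᵥ ξ) := by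
    simp only [dotProduct, mulVec]; fun_prop
  obtain ⟨c₁, hc₁, h₁⟩ : ∃ c₁ > 0, ∀ ξ : ι → ℝ, c₁ * ‖ξ‖ ^ 2 ≤ ξ ⬝ᵥ (A₀ *ᵥ ξ) := by
    obtain ⟨c₁, hc₁, h⟩ : ∃ c₁ > 0, ∀ ξ ∈ Metric.sphere (0 : ι → ℝ) 1, c₁ ≤ ξ ⬝ᵥ (A₀ *ᵥ ξ) := by
      -- A positive lower bound on the unit sphere comes from compactness; the sphere is empty only
      -- if there are no coordinates.
      rcases (Metric.sphere (0 : ι → ℝ) 1).eq_empty_or_nonempty with he | hne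
      · exact ⟨1, one_pos, by simp [he]⟩
      · obtain ⟨ξ₀, hξ₀, hmin⟩ := (isCompact_sphere (0 : ι → ℝ) 1).exists_isMinOn hne
          hcont.continuousOn
        refine ⟨_, hpos ξ₀ ?_, fun ξ hξ => hmin hξ⟩
        rintro rfl
        simp at hξ₀
    refine ⟨c₁, hc₁, fun ξ => ?_⟩
    by_cases hξ : ξ = 0
    · simp [hξ]
    · have hn : 0 < ‖ξ‖ := norm_pos_iff.2 hξ
      have h2 := h (‖ξ‖⁻¹ • ξ) (by simp [norm_smul, hn.ne'])
      rw [Matrix.mulVec_smul, dotProduct_smul, smul_dotProduct, smul_eq_mul, smul_eq_mul] at h2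
      have : c₁ * ‖ξ‖ ^ 2 ≤ (‖ξ‖⁻¹ * (‖ξ‖⁻¹ * ξ ⬝ᵥ (A₀ *ᵥ ξ))) * ‖ξ‖ ^ 2 := by gcongr
      refine this.trans (le_of_eq ?_)
      field_simp
  set d : ℝ := (Fintype.card ι : ℝ) with hd
  have hd0 : 0 ≤ d := Nat.cast_nonneg _
  -- Changing each entry by at most `η` changes the form by at most `d² η ‖ξ‖² ≤ (c₁/2) ‖ξ‖²`, half
  -- of the lower bound. The norm is the maximum norm, whence the further factor `d + 1` in the
  -- constant for `∑ ξᵢ²`.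
  set η := c₁ / (2 * (d ^ 2 + 1)) with hη
  have hηpos : 0 < η := by positivity
  refine ⟨c₁ / (2 * (d + 1)), by positivity, ?_⟩
  have hclose : ∀ᶠ x in l, ∀ i j, |A x i j - A₀ i j| ≤ η := by
    refine eventually_all.2 fun i => eventually_all.2 fun j => ?_
    filter_upwards [(Metric.tendsto_nhds.1 (hA i j)) η hηpos] with x hx
    rw [Real.dist_eq] at hx
    exact hx.le
  filter_upwards [hclose] with x hx ξ
  have h3 := abs_dotProduct_mulVec_le (A := A x - A₀) (η := η) (fun i j => hx i j) ξ
  rw [Matrix.sub_mulVec, dotProduct_sub] at h3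
  have h4 := (abs_le.1 h3).1
  have h5 : d ^ 2 * η ≤ c₁ / 2 := by
    rw [hη, ← mul_div_assoc, div_le_div_iff₀ (by positivity) (by positivity)]
    nlinarith
  have h6 : d ^ 2 * η * ‖ξ‖ ^ 2 ≤ c₁ / 2 * ‖ξ‖ ^ 2 := by gcongr
  have h7 : c₁ / (2 * (d + 1)) * ∑ i, ξ i ^ 2 ≤ c₁ / 2 * ‖ξ‖ ^ 2 := by
    calc _ ≤ c₁ / (2 * (d + 1)) * (d * ‖ξ‖ ^ 2) := by gcongr; exact sum_sq_le_norm_sq ξ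
      _ = c₁ / 2 * ‖ξ‖ ^ 2 * (d / (d + 1)) := by field_simp
      _ ≤ c₁ / 2 * ‖ξ‖ ^ 2 * 1 := by
        gcongr
        rw [div_le_one (by positivity)]; linarith
      _ = _ := mul_one _
  linarith [h₁ ξ]

end Quadratic

/-! ### Minima at interior points -/

section InteriorPoint

open Filter Topology

variable {E : Type*} [NormedAddCommGroup E] [NormedSpace ℝ E] {H : Type*} [TopologicalSpace H]
  {I : ModelWithCorners ℝ E H} {N : Type*} [TopologicalSpace N] [ChartedSpace H N]
  [IsManifold I ∞ N] {ι : Type} [Fintype ι] [DecidableEq ι]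

namespace InteriorMetric

variable {m : InteriorMetric I N} [MeasurableSpace N] [BorelSpace N] {μ : Measure N}

theorem IsVolume.apply_image (hμ : m.IsVolume ι μ) (ψ : LocalCoord I N ι) {s : Set (ι → ℝ)}
    (hs : IsOpen s) (hsub : s ⊆ ψ.source) :
    μ (ψ.toFun '' s) = ∫⁻ v in s, ENNReal.ofReal (coordDensity m.tensor ψ v) := by
  have ho : IsOpen (ψ.toFun '' s) :=
    ψ.toOpenPartialHomeomorph.isOpen_image_of_subset_source hs hsub
  rw [hμ.apply ψ ho.measurableSet (by rintro _ ⟨v, hv, rfl⟩; exact ψ.mem_target (hsub hv))]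
  congr 2
  ext v
  constructor
  · rintro ⟨⟨w, hw, hwv⟩, hv⟩
    rwa [← ψ.inv_toFun hv, ← hwv, ψ.inv_toFun (hsub hw)]
  · exact fun hv => ⟨⟨v, hv, rfl⟩, hsub hv⟩

/-- Balls in coordinate space are cubes of side `2r`. This turns a lower bound of the density into a
lower bound of the volume. -/
theorem IsVolume.le_measureReal_of_ball (hμ : m.IsVolume ι μ) (ψ : LocalCoord I N ι) {A : Set N}
    (hA : μ A < ⊤) {v : ι → ℝ} {r : ℝ} (hr : 0 < r) (hb : Metric.ball v r ⊆ ψ.source)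
    (hbA : ∀ w ∈ Metric.ball v r, ψ.toFun w ∈ A) {a : ℝ} (ha : 0 ≤ a)
    (hden : ∀ w ∈ Metric.ball v r, a ≤ coordDensity m.tensor ψ w) :
    a * (2 * r) ^ Fintype.card ι ≤ μ.real A := by
  rw [measureReal_def, ← ENNReal.ofReal_le_iff_le_toReal hA.ne, ENNReal.ofReal_mul ha,
    ← Real.volume_pi_ball v hr, ← setLIntegral_const]
  calc _ ≤ ∫⁻ w in Metric.ball v r, ENNReal.ofReal (coordDensity m.tensor ψ w) :=
        setLIntegral_mono' measurableSet_ball fun w hw => ENNReal.ofReal_le_ofReal (hden w hw)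
    _ = μ (ψ.toFun '' Metric.ball v r) := (hμ.apply_image ψ Metric.isOpen_ball hb).symm
    _ ≤ μ A := measure_mono (by rintro _ ⟨w, hw, rfl⟩; exact hbA w hw)

/-- The Laplacian is nonnegative at an interior minimum. -/
theorem IsVolume.nonneg_of_interior_min [T2Space N] [SigmaCompactSpace N] [FiniteDimensional ℝ E]
    (hμ : m.IsVolume ι μ) (hcov : ∀ p ∈ I.interior N, ∃ ψ : LocalCoord I N ι, p ∈ ψ.target)
    {u f : N → ℝ} (hu : ContMDiffOn I 𝓘(ℝ, ℝ) 1 u (I.interior N)) (huc : Continuous u)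
    (hf : ContinuousOn f (I.interior N)) (hΔ : IsWeakLaplacian m.tensor u f) {p : N}
    (hp : p ∈ I.interior N) (hmin : ∀ q, u p ≤ u q) : 0 ≤ f p := by
  by_contra hneg
  push Not at hneg
  obtain ⟨ψ, hψ⟩ := hcov p hp
  obtain ⟨v₀, hv₀, rfl⟩ : ∃ v₀ ∈ ψ.source, ψ.toFun v₀ = p := ⟨_, ψ.inv_mem hψ, ψ.toFun_inv hψ⟩
  have hsrc : ψ.source ∈ 𝓝 v₀ := ψ.open_source.mem_nhds hv₀
  have hints : ∀ v ∈ ψ.source, ψ.toFun v ∈ I.interior N :=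
    fun v hv => ψ.target_subset (ψ.mem_target hv)
  obtain ⟨c₀, hc₀, hlowev⟩ := eventually_quadratic_ge (l := 𝓝 v₀)
    (A := fun v => coordMatrix m.tensor ψ v) (A₀ := coordMatrix m.tensor ψ v₀)
    (fun i j => ((contDiffOn_coordMatrix m.smooth ψ i j).continuousOn.continuousAt hsrc))
    (fun ξ hξ => by simpa using (m.posDef_coordMatrix ψ hv₀).dotProduct_mulVec_pos hξ)
  have hfev : ∀ᶠ v in 𝓝 v₀, f (ψ.toFun v) ≤ -(-f (ψ.toFun v₀) / 2) := by
    have hcont : ContinuousAt (fun v => f (ψ.toFun v)) v₀ :=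
      (hf.comp ψ.smooth.continuousOn hints).continuousAt hsrc
    exact (hcont.eventually (Iio_mem_nhds (show f (ψ.toFun v₀) < -(-f (ψ.toFun v₀) / 2) by
      linarith))).mono fun v hv => le_of_lt hv
  have hdev : ∀ᶠ v in 𝓝 v₀, coordDensity m.tensor ψ v₀ / 2 ≤ coordDensity m.tensor ψ v :=
    (((m.contDiffOn_density ψ).continuousOn.continuousAt hsrc).eventually
      (Ioi_mem_nhds (half_lt_self (m.coordDensity_pos ψ hv₀)))).mono fun v hv => le_of_lt hv
  have hu1 := ψ.contDiffOn_comp (by simp) hu subset_rfl hints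
  obtain ⟨L, U, hU, hL⟩ := (hu1.contDiffAt hsrc).exists_lipschitzOnWith
  obtain ⟨r', hr', hball⟩ := Metric.nhds_basis_closedBall.eventually_iff.1
    ((((show ∀ᶠ v in 𝓝 v₀, v ∈ ψ.source from hsrc).and hlowev).and (hfev.and hdev)).and hU)
  obtain ⟨r, hr, hr2, hr1⟩ : ∃ r > 0, 2 * r ≤ r' ∧ 2 * r ≤ 1 :=
    ⟨min r' 1 / 2, by positivity, by linarith [min_le_left r' 1], by linarith [min_le_right r' 1]⟩
  have hcb : Metric.closedBall v₀ (2 * r) ⊆ Metric.closedBall v₀ r' :=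
    Metric.closedBall_subset_closedBall hr2
  have hcbs : Metric.closedBall v₀ (2 * r) ⊆ ψ.source := fun v hv => (hball (hcb hv)).1.1.1
  have hbs : Metric.ball v₀ (2 * r) ⊆ ψ.source := Metric.ball_subset_closedBall.trans hcbs
  set R : Set N := ψ.toFun '' Metric.ball v₀ (2 * r) with hRdef
  set s : Set N := ψ.toFun '' Metric.closedBall v₀ r with hsdef
  have hRopen : IsOpen R :=
    ψ.toOpenPartialHomeomorph.isOpen_image_of_subset_source Metric.isOpen_ball hbs
  have hsR : s ⊆ R := image_mono (Metric.closedBall_subset_ball (by linarith))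
  have hRt : R ⊆ ψ.target := by rintro _ ⟨v, hv, rfl⟩; exact ψ.mem_target (hbs hv)
  have hs : IsCompact s := (isCompact_closedBall v₀ r).image_of_continuousOn
    (ψ.smooth.continuousOn.mono ((Metric.closedBall_subset_closedBall (by linarith)).trans hcbs))
  have hRfin : μ R < ⊤ := by
    rw [hRdef, hμ.apply_image ψ Metric.isOpen_ball hbs]
    refine lt_of_le_of_lt (lintegral_mono_set Metric.ball_subset_closedBall) ?_
    exact (((m.contDiffOn_density ψ).continuousOn.mono hcbs).integrableOn_compact
      (isCompact_closedBall _ _)).lintegral_lt_top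
  -- The barrier is the squared Euclidean distance in coordinates. As `g ≥ c₀ |·|²` near `v₀`, the
  -- Cauchy–Schwarz inequality gives `|dρ|² ≤ (4/c₀) ρ`.
  set ρ : N → ℝ := fun q => ∑ i, (ψ.invFun q i - v₀ i) ^ 2 with hρ
  have hρψ : ∀ v ∈ ψ.source, ρ (ψ.toFun v) = ∑ i, (v i - v₀ i) ^ 2 := fun v hv => by
    simp only [hρ, ψ.inv_toFun hv]
  have hρ1 : ContMDiffOn I 𝓘(ℝ, ℝ) 1 ρ ψ.target := by
    have hsm : ContDiff ℝ 1 fun v : ι → ℝ => ∑ i, (v i - v₀ i) ^ 2 := by fun_prop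
    exact hsm.contMDiff.comp_contMDiffOn (ψ.smooth_inv.of_le (by simp))
  -- `R` lies in the interior, so the constant cut-off `1` will do.
  have C : CutoffSequence m μ u R s :=
    { θ := fun _ _ => 1
      contMDiffOn := fun _ => contMDiffOn_const
      nonneg := fun _ _ => zero_le_one
      le_one := fun _ _ => le_rfl
      tendsto_one := fun _ _ => tendsto_const_nhds
      K := fun _ => univ
      isClosed_K := fun _ => isClosed_univ
      K_subset := fun _ => inter_subset_left.trans (hsR.trans (hRt.trans ψ.target_subset))
      eq_zero := fun _ _ _ h => absurd (mem_univ _) h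
      A := fun _ => ∅
      measurableSet_A := fun _ => MeasurableSet.empty
      A_lt_top := fun _ => by simp
      b := fun _ => 0
      b_nonneg := fun _ => le_rfl
      pairing_le := fun _ q _ => by
        rw [m.pairing_of_hasMFDerivAt u (D := 0) (hasMFDerivAt_const (1 : ℝ) q)]
        simp
      tendsto_zero := by simp }
  refine hμ.false_of_supersolution hcov hu huc hf hΔ hRopen hRfin hs hsR C
    (c := -f (ψ.toFun v₀) / 2) (by linarith) ?_ hmin (ρ := ρ) (r₁ := r ^ 2) (K := 4 / c₀)
    (fun q _ => Finset.sum_nonneg fun i _ => sq_nonneg _) (hρ1.continuousOn.mono hRt)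
    (hρ1.mono (inter_subset_left.trans hRt)) (by positivity) ?_ (by positivity) ?_
    (c' := coordDensity m.tensor ψ v₀ / 2 * (2 * (2 * r / (L + Fintype.card ι + 1))) ^ Fintype.card ι)
    (t₀ := 1) (d := Fintype.card ι) ?_ one_pos ?_
  · rintro _ ⟨v, hv, rfl⟩
    exact (hball (hcb (Metric.ball_subset_closedBall hv))).1.2.1
  · rintro _ ⟨v, hv, rfl⟩ hvs
    rw [hρψ v (hbs hv)]
    have : r < ‖v - v₀‖ := by
      by_contra h
      exact hvs ⟨v, by rw [mem_closedBall_iff_norm]; exact not_lt.1 h, rfl⟩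
    calc r ^ 2 ≤ ‖v - v₀‖ ^ 2 := by gcongr
      _ ≤ _ := norm_sq_le_sum_sq (v - v₀)
  · rintro _ ⟨⟨v, hv, rfl⟩, -⟩ ξ
    have hvs := hbs hv
    obtain ⟨ζ, rfl⟩ := ψ.frame_surjective hvs ξ
    have hd : differential ρ (ψ.toFun v) (ψ.frame v ζ) = ∑ i, 2 * (v i - v₀ i) * ζ i := by
      have h1 := ψ.fderiv_comp hvs ((hρ1.contMDiffAt (ψ.open_target.mem_nhds
        (ψ.mem_target hvs))).mdifferentiableAt one_ne_zero) ζ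
      refine Eq.trans h1.symm ?_
      have hev : (fun w => ρ (ψ.toFun w)) =ᶠ[𝓝 v] fun w => ∑ i, (w i - v₀ i) ^ 2 :=
        eventually_of_mem (ψ.open_source.mem_nhds hvs) hρψ
      rw [hev.fderiv_eq]
      have h2 : HasFDerivAt (fun w : ι → ℝ => ∑ i, (w i - v₀ i) ^ 2)
          (∑ i, (2 * (v i - v₀ i)) • (ContinuousLinearMap.proj i : (ι → ℝ) →L[ℝ] ℝ)) v := by
        refine HasFDerivAt.fun_sum fun i _ => ?_
        have h3 := ((ContinuousLinearMap.proj i : (ι → ℝ) →L[ℝ] ℝ).hasFDerivAt (x := v)).sub_const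
          (v₀ i)
        simpa using h3.pow 2
      rw [h2.fderiv]
      simp
    rw [hd, hρψ v hvs, ← dotProduct_coordMatrix]
    have hq := (hball (hcb (Metric.ball_subset_closedBall hv))).1.1.2 ζ
    have hcs := Finset.sum_mul_sq_le_sq_mul_sq Finset.univ (fun i => v i - v₀ i) ζ
    have e : ∑ i, 2 * (v i - v₀ i) * ζ i = 2 * ∑ i, (v i - v₀ i) * ζ i := by
      rw [Finset.mul_sum]; exact Finset.sum_congr rfl fun i _ => by ring
    rw [e, mul_pow]
    have h0 : 0 ≤ ∑ i, (v i - v₀ i) ^ 2 := Finset.sum_nonneg fun i _ => sq_nonneg _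
    calc 2 ^ 2 * (∑ i, (v i - v₀ i) * ζ i) ^ 2
        ≤ 4 / c₀ * (∑ i, (v i - v₀ i) ^ 2) * (c₀ * ∑ i, ζ i ^ 2) := by
          rw [show 4 / c₀ * (∑ i, (v i - v₀ i) ^ 2) * (c₀ * ∑ i, ζ i ^ 2) =
            4 * ((∑ i, (v i - v₀ i) ^ 2) * ∑ i, ζ i ^ 2) by field_simp]
          linarith
      _ ≤ _ := by gcongr; exact hq
  · have := m.coordDensity_pos ψ hv₀
    positivity
  · intro t ht ht1
    -- At distance at most `1` from `v₀`, both `u - m₀` and `ρ ≤ card ι · ‖w - v₀‖²` are at most `D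
    -- ‖w - v₀‖`, so the ball of radius `t/D` lies in the sublevel set. The factor `2r ≤ 1` in the
    -- radius keeps the ball inside `R`.
    set D : ℝ := L + Fintype.card ι + 1 with hD
    have hDpos : 0 < D := by positivity
    have hD1 : 1 ≤ D := by
      have : (0 : ℝ) ≤ L + Fintype.card ι := by positivity
      linarith
    have hb1 : Metric.ball v₀ (2 * r / D * t) ⊆ Metric.ball v₀ (2 * r) := by
      refine Metric.ball_subset_ball ?_
      calc 2 * r / D * t ≤ 2 * r / D * 1 := by gcongr
        _ ≤ 2 * r := by rw [mul_one]; exact div_le_self (by positivity) hD1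
    refine le_trans (le_of_eq ?_) (hμ.le_measureReal_of_ball ψ (lt_of_le_of_lt
      (measure_mono fun q hq => hq.1) hRfin) (v := v₀) (r := 2 * r / D * t)
      (a := coordDensity m.tensor ψ v₀ / 2) (by positivity)
      (hb1.trans hbs) ?_ (half_pos (m.coordDensity_pos ψ hv₀)).le
      fun w hw => (hball (hcb (Metric.ball_subset_closedBall (hb1 hw)))).1.2.2)
    · rw [← mul_assoc, mul_pow _ t]; ring
    · intro w hw
      have hw' := hball (hcb (Metric.ball_subset_closedBall (hb1 hw)))
      have hn : ‖w - v₀‖ < t / D := by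
        have : ‖w - v₀‖ < 2 * r / D * t := mem_ball_iff_norm.1 hw
        refine this.trans_le ?_
        rw [div_mul_eq_mul_div]
        gcongr
        nlinarith
      have hn1 : ‖w - v₀‖ ≤ 1 := by
        have : t / D ≤ 1 := (div_le_one hDpos).2 (ht1.trans hD1)
        linarith
      have hDt : D * ‖w - v₀‖ < t := by rwa [lt_div_iff₀' hDpos] at hn
      refine ⟨mem_image_of_mem _ (hb1 hw), ?_, ?_⟩
      · have h1 := hL.dist_le_mul w hw'.2 v₀ (mem_of_mem_nhds hU)
        rw [Real.dist_eq, dist_eq_norm] at h1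
        have h2 : (L : ℝ) * ‖w - v₀‖ ≤ D * ‖w - v₀‖ := by
          gcongr
          rw [hD]
          have : (0 : ℝ) ≤ Fintype.card ι := Nat.cast_nonneg _
          linarith
        linarith [le_abs_self (u (ψ.toFun w) - u (ψ.toFun v₀))]
      · rw [hρψ w (hbs (hb1 hw))]
        have h1 := sum_sq_le_norm_sq (w - v₀)
        have h2 : (Fintype.card ι : ℝ) * ‖w - v₀‖ ^ 2 ≤ D * ‖w - v₀‖ := by
          have : ‖w - v₀‖ ^ 2 ≤ ‖w - v₀‖ := by nlinarith [norm_nonneg (w - v₀)]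
          gcongr
          rw [hD]
          have : (0 : ℝ) ≤ L := L.2
          linarith
        exact lt_of_le_of_lt (h1.trans h2) hDt

end InteriorMetric

end InteriorPoint

/-! ### Collar coordinates of the interior -/

section EdgeChart

open Filter Topology

variable {b n : ℕ}
  {M : Type*} [TopologicalSpace M] [ChartedSpace (EuclideanHalfSpace (b + n + 1)) M]
  {Y : Type*} [TopologicalSpace Y] [ChartedSpace (EuclideanSpace ℝ (Fin (b + n))) Y]
  {B : Type*} [TopologicalSpace B] [ChartedSpace (EuclideanSpace ℝ (Fin b)) B]
  {F : Type*} [TopologicalSpace F] [ChartedSpace (EuclideanSpace ℝ (Fin n)) F]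

namespace EdgeSpace

variable (S : EdgeSpace b n M Y B F)

theorem collarInv_collar {x : ℝ} (hx : x ∈ Ico (0 : ℝ) 1) (q : Y) :
    S.collarInv (S.collar (x, q)) = (x, q) := S.left_inv _ ⟨hx, mem_univ _⟩

theorem collar_mem_image {x : ℝ} (hx : x ∈ Ico (0 : ℝ) 1) (q : Y) :
    S.collar (x, q) ∈ S.collar '' (Ico (0 : ℝ) 1 ×ˢ univ) := mem_image_of_mem _ ⟨hx, mem_univ _⟩

theorem collar_collarInv {p : M} (hp : p ∈ S.collar '' (Ico (0 : ℝ) 1 ×ˢ univ)) :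
    S.collar (S.collarInv p) = p := by
  obtain ⟨a, ha, rfl⟩ := hp
  rw [S.left_inv a ha]

theorem collarInv_mem {p : M} (hp : p ∈ S.collar '' (Ico (0 : ℝ) 1 ×ˢ univ)) :
    (S.collarInv p).1 ∈ Ico (0 : ℝ) 1 := by
  obtain ⟨a, ha, rfl⟩ := hp
  rw [S.left_inv a ha]
  exact ha.1

theorem collar_mem_interior {x : ℝ} (hx : x ∈ Ioo (0 : ℝ) 1) (q : Y) :
    S.collar (x, q) ∈ (𝓡∂ (b + n + 1)).interior M := by
  rw [← ModelWithCorners.compl_boundary, S.boundary_eq]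
  rintro ⟨q', hq'⟩
  have h := congrArg (fun p => (S.collarInv p).1) hq'
  simp only [S.collarInv_collar ⟨le_rfl, one_pos⟩, S.collarInv_collar (Ioo_subset_Ico_self hx)] at h
  exact hx.1.ne h

theorem collarInv_pos_of_interior {p : M} (hp : p ∈ S.collar '' (Ico (0 : ℝ) 1 ×ˢ univ))
    (hpi : p ∈ (𝓡∂ (b + n + 1)).interior M) : 0 < (S.collarInv p).1 := by
  refine lt_of_le_of_ne (S.collarInv_mem hp).1 fun h => ?_
  rw [← ModelWithCorners.compl_boundary, S.boundary_eq] at hpi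
  refine hpi ⟨(S.collarInv p).2, ?_⟩
  have e : ((0 : ℝ), (S.collarInv p).2) = S.collarInv p := Prod.ext h rfl
  exact (congrArg S.collar e).trans (S.collar_collarInv hp)

theorem contMDiffAt_collar {x : ℝ} (hx : x ∈ Ioo (0 : ℝ) 1) (q : Y) :
    ContMDiffAt (𝓘(ℝ, ℝ).prod (𝓡 (b + n))) (𝓡∂ (b + n + 1)) ∞ S.collar (x, q) :=
  (S.collar_smooth _ ⟨Ioo_subset_Ico_self hx, mem_univ _⟩).contMDiffAt
    (prod_mem_nhds (mem_of_superset (isOpen_Ioo.mem_nhds hx) Ioo_subset_Ico_self) univ_mem)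

variable (κ : LocalCoord (𝓡 (b + n)) Y (Fin b ⊕ Fin n))

/-- The domain of the coordinates `edgeCoord S κ` of the interior. -/
def edgeSource : Set (Unit ⊕ Fin b ⊕ Fin n → ℝ) :=
  {v | v (Sum.inl ()) ∈ Ioo (0 : ℝ) 1 ∧ (fun j => v (Sum.inr j)) ∈ κ.source}

theorem isOpen_edgeSource : IsOpen (edgeSource κ) := by
  refine IsOpen.inter (isOpen_Ioo.preimage (continuous_apply _)) (κ.open_source.preimage ?_)
  fun_prop

/-- The inverse of `edgeCoord S κ`. -/
def edgeCoordInv (p : M) : Unit ⊕ Fin b ⊕ Fin n → ℝ :=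
  Sum.elim (fun _ => (S.collarInv p).1) (κ.invFun (S.collarInv p).2)

/-- The range of the coordinates `edgeCoord S κ` of the interior. -/
def edgeTarget : Set M :=
  S.collar '' (Ico (0 : ℝ) 1 ×ˢ univ) ∩ S.collarInv ⁻¹' (Ioo (0 : ℝ) 1 ×ˢ κ.target)

theorem edgeCoordInv_edgeCoord {v : Unit ⊕ Fin b ⊕ Fin n → ℝ} (hv : v ∈ edgeSource κ) :
    S.edgeCoordInv κ (edgeCoord S κ v) = v := by
  funext i
  rw [edgeCoordInv, edgeCoord, S.collarInv_collar (Ioo_subset_Ico_self hv.1)]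
  rcases i with i | i
  · rfl
  · exact congrFun (κ.inv_toFun hv.2) i

theorem edgeCoord_edgeCoordInv {p : M} (hp : p ∈ S.edgeTarget κ) :
    edgeCoord S κ (S.edgeCoordInv κ p) = p := by
  rw [edgeCoord, edgeCoordInv]
  simp only [Sum.elim_inl, Sum.elim_inr]
  have h : κ.toFun (fun i => κ.invFun (S.collarInv p).2 i) = (S.collarInv p).2 :=
    κ.toFun_inv hp.2.2
  rw [h]
  exact S.collar_collarInv hp.1

/-- The map `(x, y, z) ↦ (x, κ(y, z))`. -/
def collarCoord (v : Unit ⊕ Fin b ⊕ Fin n → ℝ) : ℝ × Y :=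
  (v (Sum.inl ()), κ.toFun fun i => v (Sum.inr i))

theorem contMDiff_restrict_inr {b n : ℕ} : ContMDiff 𝓘(ℝ, Unit ⊕ Fin b ⊕ Fin n → ℝ)
    𝓘(ℝ, Fin b ⊕ Fin n → ℝ) ∞ (fun v : Unit ⊕ Fin b ⊕ Fin n → ℝ => fun i => v (Sum.inr i)) := by
  refine ContDiff.contMDiff ?_
  fun_prop

theorem contMDiffOn_collarCoord : ContMDiffOn 𝓘(ℝ, Unit ⊕ Fin b ⊕ Fin n → ℝ)
    (𝓘(ℝ, ℝ).prod (𝓡 (b + n))) ∞ (collarCoord κ) (edgeSource κ) := by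
  refine ContMDiffOn.prodMk ?_ ?_
  · refine (ContDiff.contMDiff ?_).contMDiffOn
    fun_prop
  · exact κ.smooth.comp contMDiff_restrict_inr.contMDiffOn fun v hv => hv.2

/-- The coordinates `(x, y, z)` given by the collar, as coordinates of the interior. -/
def edgeLocalCoord : LocalCoord (𝓡∂ (b + n + 1)) M (Unit ⊕ Fin b ⊕ Fin n) where
  toFun := edgeCoord S κ
  invFun := S.edgeCoordInv κ
  source := edgeSource κ
  target := S.edgeTarget κ
  map_source' v hv := by
    refine ⟨S.collar_mem_image (Ioo_subset_Ico_self hv.1) _, ?_⟩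
    rw [edgeCoord, mem_preimage, S.collarInv_collar (Ioo_subset_Ico_self hv.1)]
    exact ⟨hv.1, κ.mem_target hv.2⟩
  map_target' p hp := ⟨hp.2.1, κ.inv_mem hp.2.2⟩
  left_inv' v hv := S.edgeCoordInv_edgeCoord κ hv
  right_inv' p hp := S.edgeCoord_edgeCoordInv κ hp
  open_source := isOpen_edgeSource κ
  open_target := S.collarInv_smooth.continuousOn.isOpen_inter_preimage S.isOpen_collar
    (isOpen_Ioo.prod κ.open_target)
  continuousOn_toFun := (S.collar_smooth.comp (contMDiffOn_collarCoord κ)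
    fun _ hv => ⟨Ioo_subset_Ico_self hv.1, mem_univ _⟩).continuousOn
  continuousOn_invFun := by
    have h := S.collarInv_smooth.continuousOn.mono
      (inter_subset_left : S.edgeTarget κ ⊆ _)
    refine continuousOn_pi.2 fun i => ?_
    rcases i with i | i
    · exact continuous_fst.comp_continuousOn h
    · exact (continuous_apply i).comp_continuousOn (κ.smooth_inv.continuousOn.comp
        (continuous_snd.comp_continuousOn h) fun p hp => hp.2.2)
  target_subset p hp := by
    have h := S.collar_mem_interior hp.2.1 (S.collarInv p).2
    rwa [Prod.mk.eta, S.collar_collarInv hp.1] at h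
  smooth := S.collar_smooth.comp (contMDiffOn_collarCoord κ)
    fun _ hv => ⟨Ioo_subset_Ico_self hv.1, mem_univ _⟩
  smooth_inv := by
    have h := S.collarInv_smooth.mono (inter_subset_left : S.edgeTarget κ ⊆ _)
    refine contMDiffOn_pi_space.2 fun i => ?_
    rcases i with i | i
    · exact contMDiff_fst.comp_contMDiffOn h
    · exact (contMDiffOn_pi_space.1 (κ.smooth_inv.comp (contMDiff_snd.comp_contMDiffOn h)
        fun p hp => hp.2.2)) i

theorem frame_edgeLocalCoord {v : Unit ⊕ Fin b ⊕ Fin n → ℝ} (hv : v ∈ edgeSource κ)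
    (ξ : Unit ⊕ Fin b ⊕ Fin n → ℝ) :
    (S.edgeLocalCoord κ).frame v ξ =
      mfderiv (𝓘(ℝ, ℝ).prod (𝓡 (b + n))) (𝓡∂ (b + n + 1)) S.collar
        (v (Sum.inl ()), κ.toFun fun i => v (Sum.inr i))
        ((ξ (Sum.inl ()), κ.frame (fun i => v (Sum.inr i)) fun i => ξ (Sum.inr i)) :
          ℝ × EuclideanSpace ℝ (Fin (b + n))) := by
  have hc : MDifferentiableAt (𝓘(ℝ, ℝ).prod (𝓡 (b + n))) (𝓡∂ (b + n + 1)) S.collar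
      (collarCoord κ v) := (S.contMDiffAt_collar hv.1 _).mdifferentiableAt (by simp)
  have h1 : HasMFDerivAt 𝓘(ℝ, Unit ⊕ Fin b ⊕ Fin n → ℝ) 𝓘(ℝ, ℝ)
      (fun v : Unit ⊕ Fin b ⊕ Fin n → ℝ => v (Sum.inl ())) v
      (ContinuousLinearMap.proj (Sum.inl ())) :=
    (ContinuousLinearMap.proj (R := ℝ) (φ := fun _ : Unit ⊕ Fin b ⊕ Fin n => ℝ)
      (Sum.inl ())).hasFDerivAt.hasMFDerivAt
  have h2 : HasMFDerivAt 𝓘(ℝ, Unit ⊕ Fin b ⊕ Fin n → ℝ) 𝓘(ℝ, Fin b ⊕ Fin n → ℝ)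
      (fun v : Unit ⊕ Fin b ⊕ Fin n → ℝ => fun i => v (Sum.inr i)) v
      (ContinuousLinearMap.pi fun i => ContinuousLinearMap.proj (Sum.inr i)) :=
    (ContinuousLinearMap.pi fun i => ContinuousLinearMap.proj (R := ℝ)
      (φ := fun _ : Unit ⊕ Fin b ⊕ Fin n => ℝ) (Sum.inr i)).hasFDerivAt.hasMFDerivAt
  have h3 := (κ.mdifferentiableAt hv.2).hasMFDerivAt.comp v h2
  have h := hc.hasMFDerivAt.comp v (h1.prodMk h3)
  exact DFunLike.congr_fun h.mfderiv ξ

end EdgeSpace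

end EdgeChart

/-! ### Estimates of determinants -/

section Determinant

open Matrix

variable {ι : Type} [Fintype ι] [DecidableEq ι]

/-- In every term of the Leibniz formula each `f i` occurs exactly twice, once from a row and once
from a column. -/
theorem abs_det_le_of_abs_entries_le {A : Matrix ι ι ℝ} {C : ℝ} {f : ι → ℝ}
    (hA : ∀ i j, |A i j| ≤ C * (f i * f j)) :
    |A.det| ≤ (Fintype.card ι).factorial * (C ^ Fintype.card ι * (∏ i, f i) ^ 2) := by
  rw [Matrix.det_apply]
  calc |∑ σ : Equiv.Perm ι, Equiv.Perm.sign σ • ∏ i, A (σ i) i|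
      ≤ ∑ σ : Equiv.Perm ι, |Equiv.Perm.sign σ • ∏ i, A (σ i) i| := Finset.abs_sum_le_sum_abs _ _
    _ ≤ ∑ _σ : Equiv.Perm ι, C ^ Fintype.card ι * (∏ i, f i) ^ 2 := by
        refine Finset.sum_le_sum fun σ _ => ?_
        have h1 : |Equiv.Perm.sign σ • ∏ i, A (σ i) i| = ∏ i, |A (σ i) i| := by
          rw [← Finset.abs_prod]
          rcases Int.units_eq_one_or (Equiv.Perm.sign σ) with h | h <;> simp [h]
        rw [h1]
        calc ∏ i, |A (σ i) i| ≤ ∏ i, C * (f (σ i) * f i) :=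
              Finset.prod_le_prod (fun _ _ => abs_nonneg _) fun i _ => hA _ _
          _ = _ := by
            rw [Finset.prod_mul_distrib, Finset.prod_mul_distrib, Equiv.prod_comp σ f,
              Finset.prod_const, Finset.card_univ, sq]
    _ = _ := by simp [Fintype.card_perm]

/-- The form evaluated at unit eigenvectors shows that all eigenvalues are at least `a`, and the
determinant is their product. -/
theorem pow_card_le_det {A : Matrix ι ι ℝ} (hA : A.IsSymm) {a : ℝ} (ha : 0 ≤ a)
    (h : ∀ ξ : ι → ℝ, a * ∑ i, ξ i ^ 2 ≤ ξ ⬝ᵥ (A *ᵥ ξ)) : a ^ Fintype.card ι ≤ A.det := by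
  have hH : A.IsHermitian := by rwa [Matrix.IsHermitian, Matrix.conjTranspose_eq_transpose_of_trivial]
  rw [hH.det_eq_prod_eigenvalues, ← Finset.card_univ, ← Finset.prod_const]
  refine Finset.prod_le_prod (fun _ _ => ha) fun i _ => ?_
  have h1 := h (hH.eigenvectorBasis i)
  rw [hH.mulVec_eigenvectorBasis, dotProduct_smul] at h1
  have h2 : ∑ j, (hH.eigenvectorBasis i j) ^ 2 = 1 := by
    have h3 := hH.eigenvectorBasis.orthonormal.1 i
    rw [EuclideanSpace.norm_eq, Real.sqrt_eq_one] at h3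
    simpa using h3
  have h4 : (hH.eigenvectorBasis i : ι → ℝ) ⬝ᵥ (hH.eigenvectorBasis i) = 1 := by
    rw [← h2]; simp only [dotProduct, sq]
  rw [h4, h2] at h1
  simpa using h1

/-- A bound for the entries of a positive semidefinite matrix by its diagonal. -/
theorem abs_entries_le_of_quadratic_le {A : Matrix ι ι ℝ} (hA : A.IsSymm) {C : ℝ} {f : ι → ℝ}
    (hf : ∀ i, 0 < f i) (h0 : ∀ ξ : ι → ℝ, 0 ≤ ξ ⬝ᵥ (A *ᵥ ξ))
    (hC : ∀ ξ : ι → ℝ, ξ ⬝ᵥ (A *ᵥ ξ) ≤ C * ∑ i, (f i * ξ i) ^ 2) (i j : ι) :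
    |A i j| ≤ C * (f i * f j) := by
  have hd : ∀ i, A i i ≤ C * f i ^ 2 := fun i => by
    have := hC (Pi.single i 1)
    simpa [Pi.single_apply, Finset.sum_ite_eq, mul_pow] using this
  -- The form at `s eᵢ + t eⱼ`. The choice `s = fⱼ`, `t = ±fᵢ` balances the two diagonal terms, each
  -- of which is at most `C fᵢ² fⱼ²`.
  have hpol : ∀ s t : ℝ, 0 ≤ s ^ 2 * A i i + 2 * s * t * A i j + t ^ 2 * A j j := fun s t => by
    have := h0 (Pi.single i s + Pi.single j t)
    rw [Matrix.mulVec_add, add_dotProduct, dotProduct_add, dotProduct_add] at this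
    simp only [single_dotProduct, Matrix.mulVec_single, Pi.smul_apply, MulOpposite.smul_eq_mul_unop,
      Matrix.col_apply, MulOpposite.unop_op] at this
    rw [hA.apply i j] at this
    linarith
  have hi := hf i
  have hj := hf j
  have e1 := hpol (f j) (f i)
  have e2 := hpol (f j) (-f i)
  have hii : f j ^ 2 * A i i ≤ f j ^ 2 * (C * f i ^ 2) := by gcongr; exact hd i
  have hjj : f i ^ 2 * A j j ≤ f i ^ 2 * (C * f j ^ 2) := by gcongr; exact hd j
  have hp : 0 < f i * f j := by positivity
  rw [abs_le]
  constructor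
  · refine le_of_mul_le_mul_left (a := f i * f j) ?_ hp
    nlinarith
  · refine le_of_mul_le_mul_left (a := f i * f j) ?_ hp
    nlinarith

end Determinant

/-! ### The rigid metric in the frame of generators -/

section EdgeForm

open Filter Topology Matrix

/-- The matrix, with respect to the generators `∂_x`, `∂_y`, `x⁻¹ ∂_z`, of a rigid metric
`dx² + x² A + D`, where `D` only involves `y`. -/
def rigidMatrix {b n : ℕ} (x : ℝ) (A : Matrix (Fin b ⊕ Fin n) (Fin b ⊕ Fin n) ℝ)
    (D : Matrix (Fin b) (Fin b) ℝ) : Matrix (Unit ⊕ Fin b ⊕ Fin n) (Unit ⊕ Fin b ⊕ Fin n) ℝ :=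
  Matrix.fromBlocks (of fun _ _ => 1) (of fun _ _ => 0) (of fun _ _ => 0) (Matrix.fromBlocks
    (of fun i j => x * A (Sum.inl i) (Sum.inl j) * x + D i j)
    (of fun i j => x * A (Sum.inl i) (Sum.inr j)) (of fun i j => A (Sum.inr i) (Sum.inl j) * x)
    (of fun i j => A (Sum.inr i) (Sum.inr j)))

theorem dotProduct_rigidMatrix {b n : ℕ} (x : ℝ) (A : Matrix (Fin b ⊕ Fin n) (Fin b ⊕ Fin n) ℝ)
    (D : Matrix (Fin b) (Fin b) ℝ) (ξ : Unit ⊕ Fin b ⊕ Fin n → ℝ) :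
    ξ ⬝ᵥ (rigidMatrix x A D *ᵥ ξ) = ξ (Sum.inl ()) ^ 2 +
      (Sum.elim (fun i => x * ξ (Sum.inr (Sum.inl i))) fun i => ξ (Sum.inr (Sum.inr i))) ⬝ᵥ
        (A *ᵥ Sum.elim (fun i => x * ξ (Sum.inr (Sum.inl i))) fun i => ξ (Sum.inr (Sum.inr i))) +
      (fun i => ξ (Sum.inr (Sum.inl i))) ⬝ᵥ (D *ᵥ fun i => ξ (Sum.inr (Sum.inl i))) := by
  simp only [dotProduct, mulVec, rigidMatrix, Fintype.sum_sum_type, Finset.univ_unique,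
    Finset.sum_singleton, fromBlocks_apply₁₁, fromBlocks_apply₁₂, fromBlocks_apply₂₁,
    fromBlocks_apply₂₂, of_apply, zero_mul, Sum.elim_inl, Sum.elim_inr, add_mul, Finset.sum_add_distrib, mul_add,
    Finset.mul_sum]
  have e1 : ∀ i j : Fin b, ξ (Sum.inr (Sum.inl i)) * (x * A (Sum.inl i) (Sum.inl j) * x *
      ξ (Sum.inr (Sum.inl j))) = x * ξ (Sum.inr (Sum.inl i)) * (A (Sum.inl i) (Sum.inl j) *
      (x * ξ (Sum.inr (Sum.inl j)))) := fun i j => by ring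
  have e2 : ∀ (i : Fin b) (j : Fin n), ξ (Sum.inr (Sum.inl i)) * (x * A (Sum.inl i) (Sum.inr j) *
      ξ (Sum.inr (Sum.inr j))) = x * ξ (Sum.inr (Sum.inl i)) * (A (Sum.inl i) (Sum.inr j) *
      ξ (Sum.inr (Sum.inr j))) := fun i j => by ring
  have e3 : ∀ (i : Fin n) (j : Fin b), ξ (Sum.inr (Sum.inr i)) * (A (Sum.inr i) (Sum.inl j) * x *
      ξ (Sum.inr (Sum.inl j))) = ξ (Sum.inr (Sum.inr i)) * (A (Sum.inr i) (Sum.inl j) *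
      (x * ξ (Sum.inr (Sum.inl j)))) := fun i j => by ring
  simp only [e1, e2, e3, mul_zero, Finset.sum_const_zero]
  ring

/-- The gain from passing to the generators: the degenerate form `dx² + x²A + D` becomes a form
whose matrix depends continuously on `x` up to `x = 0`. Only the components of `A` along `y` keep
factors `x`; those along `z` lose them. -/
theorem dotProduct_rigidMatrix_edgeFactor {b n : ℕ} (v ξ : Unit ⊕ Fin b ⊕ Fin n → ℝ)
    (A : Matrix (Fin b ⊕ Fin n) (Fin b ⊕ Fin n) ℝ) (D : Matrix (Fin b) (Fin b) ℝ) :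
    (fun i => edgeFactor v i * ξ i) ⬝ᵥ
      (rigidMatrix (v (Sum.inl ())) A D *ᵥ fun i => edgeFactor v i * ξ i) =
      ξ (Sum.inl ()) ^ 2 + v (Sum.inl ()) ^ 2 *
        ((fun i => ξ (Sum.inr i)) ⬝ᵥ (A *ᵥ fun i => ξ (Sum.inr i))) +
      (fun i => ξ (Sum.inr (Sum.inl i))) ⬝ᵥ (D *ᵥ fun i => ξ (Sum.inr (Sum.inl i))) := by
  rw [dotProduct_rigidMatrix]
  have e : (Sum.elim (fun i => v (Sum.inl ()) * (edgeFactor v (Sum.inr (Sum.inl i)) *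
      ξ (Sum.inr (Sum.inl i)))) fun i => edgeFactor v (Sum.inr (Sum.inr i)) *
      ξ (Sum.inr (Sum.inr i))) = v (Sum.inl ()) • fun i : Fin b ⊕ Fin n => ξ (Sum.inr i) := by
    funext i
    rcases i with i | i <;> simp [edgeFactor]
  rw [e, Matrix.mulVec_smul, dotProduct_smul, smul_dotProduct]
  simp only [edgeFactor, smul_eq_mul, one_mul]
  ring

theorem tendsto_rigidMatrix {b n : ℕ} {X : Type*} {l : Filter X} {x : X → ℝ} {x₀ : ℝ}
    {A : X → Matrix (Fin b ⊕ Fin n) (Fin b ⊕ Fin n) ℝ} {D : X → Matrix (Fin b) (Fin b) ℝ}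
    {A₀ : Matrix (Fin b ⊕ Fin n) (Fin b ⊕ Fin n) ℝ} {D₀ : Matrix (Fin b) (Fin b) ℝ}
    (hx : Tendsto x l (𝓝 x₀)) (hA : ∀ i j, Tendsto (fun a => A a i j) l (𝓝 (A₀ i j)))
    (hD : ∀ i j, Tendsto (fun a => D a i j) l (𝓝 (D₀ i j))) (i j : Unit ⊕ Fin b ⊕ Fin n) :
    Tendsto (fun a => rigidMatrix (x a) (A a) (D a) i j) l (𝓝 (rigidMatrix x₀ A₀ D₀ i j)) := by
  rcases i with i | i | i <;> rcases j with j | j | j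
  · exact tendsto_const_nhds
  · exact tendsto_const_nhds
  · exact tendsto_const_nhds
  · exact tendsto_const_nhds
  · exact ((hx.mul (hA _ _)).mul hx).add (hD _ _)
  · exact hx.mul (hA _ _)
  · exact tendsto_const_nhds
  · exact (hA _ _).mul hx
  · exact hA _ _

/-- A family of quadratic forms whose coefficients converge is bounded. -/
theorem eventually_quadratic_le {ι : Type} [Fintype ι] {X : Type*} {l : Filter X}
    {A : X → Matrix ι ι ℝ} {A₀ : Matrix ι ι ℝ}
    (hA : ∀ i j, Tendsto (fun x => A x i j) l (𝓝 (A₀ i j))) :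
    ∃ C > 0, ∀ᶠ x in l, ∀ ξ, ξ ⬝ᵥ (A x *ᵥ ξ) ≤ C * ∑ i, ξ i ^ 2 := by
  obtain ⟨η, hη, h⟩ : ∃ η > 0, ∀ i j, |A₀ i j| < η := by
    refine ⟨1 + ∑ i, ∑ j, |A₀ i j|, by positivity, fun i j => ?_⟩
    have h1 : |A₀ i j| ≤ ∑ j, |A₀ i j| :=
      Finset.single_le_sum (f := fun j => |A₀ i j|) (fun _ _ => abs_nonneg _) (Finset.mem_univ j)
    have h2 : ∑ j, |A₀ i j| ≤ ∑ i, ∑ j, |A₀ i j| :=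
      Finset.single_le_sum (f := fun i => ∑ j, |A₀ i j|)
        (fun _ _ => Finset.sum_nonneg fun _ _ => abs_nonneg _) (Finset.mem_univ i)
    linarith
  refine ⟨(Fintype.card ι : ℝ) ^ 2 * η + 1, by positivity, ?_⟩
  have hev : ∀ᶠ x in l, ∀ i j, |A x i j| < η := by
    refine eventually_all.2 fun i => eventually_all.2 fun j => ?_
    exact (hA i j).abs.eventually (Iio_mem_nhds (h i j))
  filter_upwards [hev] with x hx ξ
  have h1 := (le_abs_self _).trans (abs_dotProduct_mulVec_le (fun i j => (hx i j).le) ξ)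
  have h2 := norm_sq_le_sum_sq ξ
  have h3 : 0 ≤ ∑ i, ξ i ^ 2 := (sq_nonneg _).trans h2
  calc _ ≤ (Fintype.card ι : ℝ) ^ 2 * η * ‖ξ‖ ^ 2 := h1
    _ ≤ (Fintype.card ι : ℝ) ^ 2 * η * ∑ i, ξ i ^ 2 := by gcongr
    _ ≤ _ := by nlinarith

end EdgeForm

/-! ### Comparison of the metric with a Euclidean one near the boundary -/

section Comparison

open Filter Topology Matrix

variable {b n : ℕ}
  {M : Type*} [TopologicalSpace M] [ChartedSpace (EuclideanHalfSpace (b + n + 1)) M]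
  {Y : Type*} [TopologicalSpace Y] [ChartedSpace (EuclideanSpace ℝ (Fin (b + n))) Y]
  {B : Type*} [TopologicalSpace B] [ChartedSpace (EuclideanSpace ℝ (Fin b)) B]
  {F : Type*} [TopologicalSpace F] [ChartedSpace (EuclideanSpace ℝ (Fin n)) F]
  [IsManifold (𝓡∂ (b + n + 1)) ∞ M] [IsManifold (𝓡 (b + n)) ∞ Y] [IsManifold (𝓡 b) ∞ B]
  {S : EdgeSpace b n M Y B F}

namespace EdgeMetric

variable (G : EdgeMetric S)

/-- The metric, as a metric on the interior. -/
def interiorMetric : InteriorMetric (𝓡∂ (b + n + 1)) M where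
  g := G.g
  smooth := G.smooth
  symm := G.symm
  pos := G.pos

variable {κ : LocalCoord (𝓡 (b + n)) Y (Fin b ⊕ Fin n)} {β : LocalCoord (𝓡 b) B (Fin b)}

theorem form_edgeLocalCoord {v : Unit ⊕ Fin b ⊕ Fin n → ℝ} (hv : v ∈ EdgeSpace.edgeSource κ)
    (ξ : Unit ⊕ Fin b ⊕ Fin n → ℝ) :
    G.g (edgeCoord S κ v) ((S.edgeLocalCoord κ).frame v ξ) ((S.edgeLocalCoord κ).frame v ξ) =
      collarForm S G.g (v (Sum.inl ())) (κ.toFun fun i => v (Sum.inr i)) (ξ (Sum.inl ()))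
        (κ.frame (fun i => v (Sum.inr i)) fun i => ξ (Sum.inr i)) := by
  rw [S.frame_edgeLocalCoord κ hv]
  rfl

/-- In fibred coordinates the projection is `(y, z) ↦ y`; the identity is the chain rule for `proj ∘
κ = β ∘ pr`. -/
theorem inner_proj_frame
    (hβ : ∀ w ∈ κ.source, (fun i => w (Sum.inl i)) ∈ β.source ∧
      S.proj (κ.toFun w) = β.toFun fun i => w (Sum.inl i))
    {w : Fin b ⊕ Fin n → ℝ} (hw : w ∈ κ.source) (ξ : Fin b ⊕ Fin n → ℝ) :
    G.gB.inner (S.proj (κ.toFun w)) (mfderiv (𝓡 (b + n)) (𝓡 b) S.proj _ (κ.frame w ξ))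
      (mfderiv (𝓡 (b + n)) (𝓡 b) S.proj _ (κ.frame w ξ)) =
      G.gB.inner (β.toFun fun i => w (Sum.inl i))
        (β.frame (fun i => w (Sum.inl i)) fun i => ξ (Sum.inl i))
        (β.frame (fun i => w (Sum.inl i)) fun i => ξ (Sum.inl i)) := by
  have h1 := mfderiv_comp w ((S.proj_smooth _).mdifferentiableAt (by simp))
    (κ.mdifferentiableAt hw)
  have h2 : HasMFDerivAt 𝓘(ℝ, Fin b ⊕ Fin n → ℝ) 𝓘(ℝ, Fin b → ℝ)
      (fun v : Fin b ⊕ Fin n → ℝ => fun i => v (Sum.inl i)) w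
      (ContinuousLinearMap.pi fun i => ContinuousLinearMap.proj (Sum.inl i)) :=
    (ContinuousLinearMap.pi fun i => ContinuousLinearMap.proj (R := ℝ)
      (φ := fun _ : Fin b ⊕ Fin n => ℝ) (Sum.inl i)).hasFDerivAt.hasMFDerivAt
  have h3 := ((β.mdifferentiableAt (hβ w hw).1).hasMFDerivAt.comp w h2).mfderiv
  have hev : S.proj ∘ κ.toFun =ᶠ[𝓝 w]
      β.toFun ∘ fun v : Fin b ⊕ Fin n → ℝ => fun i => v (Sum.inl i) :=
    eventually_of_mem (κ.open_source.mem_nhds hw) fun w' hw' => (hβ w' hw').2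
  have h := pullback_congr G.gB.inner hev ξ ξ
  rw [h1, h3] at h
  exact h

theorem rigidForm_frame
    (hβ : ∀ w ∈ κ.source, (fun i => w (Sum.inl i)) ∈ β.source ∧
      S.proj (κ.toFun w) = β.toFun fun i => w (Sum.inl i))
    {v : Unit ⊕ Fin b ⊕ Fin n → ℝ} (hv : (fun i => v (Sum.inr i)) ∈ κ.source)
    (ξ : Unit ⊕ Fin b ⊕ Fin n → ℝ) :
    rigidForm S G.gF G.gB (v (Sum.inl ())) (κ.toFun fun i => v (Sum.inr i)) (ξ (Sum.inl ()))
        (κ.frame (fun i => v (Sum.inr i)) fun i => ξ (Sum.inr i)) =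
      (fun i => edgeFactor v i * ξ i) ⬝ᵥ
        (rigidMatrix (v (Sum.inl ()))
          (coordMatrix (fun q a c => G.gF q a c) κ fun i => v (Sum.inr i))
          (coordMatrix (fun y a c => G.gB.inner y a c) β fun i => v (Sum.inr (Sum.inl i))) *ᵥ
          fun i => edgeFactor v i * ξ i) := by
  rw [dotProduct_rigidMatrix_edgeFactor, dotProduct_coordMatrix, dotProduct_coordMatrix, rigidForm,
    G.inner_proj_frame hβ hv]

/-- At `x = 0` the form is the sum of the square of the `x`-component, `g^F` on the `z`-part and
`g^B` on the `y`-part. The `z`-part is tangent to a fibre, and exactly for such vectors `g^F` is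
known to be positive. -/
theorem rigidMatrix_pos
    (hβ : ∀ w ∈ κ.source, (fun i => w (Sum.inl i)) ∈ β.source ∧
      S.proj (κ.toFun w) = β.toFun fun i => w (Sum.inl i))
    {w : Fin b ⊕ Fin n → ℝ} (hw : w ∈ κ.source) {ξ : Unit ⊕ Fin b ⊕ Fin n → ℝ} (hξ : ξ ≠ 0) :
    0 < ξ ⬝ᵥ (rigidMatrix 0 (coordMatrix (fun q a c => G.gF q a c) κ w)
      (coordMatrix (fun y a c => G.gB.inner y a c) β fun i => w (Sum.inl i)) *ᵥ ξ) := by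
  rw [dotProduct_rigidMatrix, dotProduct_coordMatrix, dotProduct_coordMatrix]
  simp only [zero_mul]
  set ζ : Fin b ⊕ Fin n → ℝ := Sum.elim (fun _ => 0) fun i => ξ (Sum.inr (Sum.inr i)) with hζ
  set η : Fin b → ℝ := fun i => ξ (Sum.inr (Sum.inl i)) with hη
  have hβw := (hβ w hw).1
  have h1 : 0 ≤ ξ (Sum.inl ()) ^ 2 := sq_nonneg _
  have hB : ∀ (y : B) (a : TangentSpace (𝓡 b) y), G.gB.inner y a a = 0 → a = 0 := fun y a h => by
    by_contra ha
    exact (G.gB.pos y a ha).ne' h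
  have hBn : ∀ (y : B) (a : TangentSpace (𝓡 b) y), 0 ≤ G.gB.inner y a a := fun y a => by
    by_cases ha : a = 0
    · simp [ha]
    · exact (G.gB.pos y a ha).le
  have hvert : mfderiv (𝓡 (b + n)) (𝓡 b) S.proj _ (κ.frame w ζ) = 0 := by
    refine hB _ _ ?_
    rw [G.inner_proj_frame hβ hw]
    have : (fun i => ζ (Sum.inl i)) = (0 : Fin b → ℝ) := rfl
    rw [this, map_zero, map_zero]
  have hF : ζ ≠ 0 → 0 < G.gF (κ.toFun w) (κ.frame w ζ) (κ.frame w ζ) := fun h => by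
    refine G.gF_pos _ _ hvert fun h0 => h ?_
    exact κ.frame_injective hw (h0.trans (map_zero _).symm)
  have hFn : 0 ≤ G.gF (κ.toFun w) (κ.frame w ζ) (κ.frame w ζ) := by
    by_cases h : ζ = 0
    · rw [h, map_zero, map_zero]
    · exact (hF h).le
  have hBη := hBn _ (β.frame (fun i => w (Sum.inl i)) η)
  by_cases hζ0 : ζ = 0
  · by_cases hη0 : η = 0
    · have h0 : ξ (Sum.inl ()) ≠ 0 := fun h0 => hξ (by
        funext i
        rcases i with i | i | i
        · exact h0
        · exact congrFun hη0 i
        · exact congrFun hζ0 (Sum.inr i))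
      have : 0 < ξ (Sum.inl ()) ^ 2 := by positivity
      linarith
    · have : 0 < G.gB.inner _ (β.frame (fun i => w (Sum.inl i)) η)
          (β.frame (fun i => w (Sum.inl i)) η) := by
        refine G.gB.pos _ _ fun h0 => hη0 ?_
        exact β.frame_injective hβw (h0.trans (map_zero _).symm)
      linarith
  · linarith [hF hζ0]

theorem rigidForm_nonneg_aux {x : ℝ} {q : Y} {a : ℝ} {v : TangentSpace (𝓡 (b + n)) q}
    {ε : ℝ} (hε : 0 < ε)
    (h : |collarForm S G.g x q a v - rigidForm S G.gF G.gB x q a v| ≤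
      ε * rigidForm S G.gF G.gB x q a v) : 0 ≤ rigidForm S G.gF G.gB x q a v :=
  nonneg_of_mul_nonneg_right ((abs_nonneg _).trans h) hε

/-- Near a boundary point, the metric is uniformly equivalent to the Euclidean metric in which the
generators `∂_x`, `∂_y`, `x⁻¹ ∂_z` are orthonormal. -/
theorem exists_comparison
    (hβ : ∀ w ∈ κ.source, (fun i => w (Sum.inl i)) ∈ β.source ∧
      S.proj (κ.toFun w) = β.toFun fun i => w (Sum.inl i))
    {v₀ : Unit ⊕ Fin b ⊕ Fin n → ℝ} (h0 : v₀ (Sum.inl ()) = 0)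
    (hv₀ : (fun i => v₀ (Sum.inr i)) ∈ κ.source) :
    ∃ c > 0, ∃ C > 0, ∀ᶠ v in 𝓝 v₀, 0 < v (Sum.inl ()) → v ∈ EdgeSpace.edgeSource κ ∧ ∀ ξ,
      c * ∑ i, (edgeFactor v i * ξ i) ^ 2 ≤ G.g (edgeCoord S κ v)
        ((S.edgeLocalCoord κ).frame v ξ) ((S.edgeLocalCoord κ).frame v ξ) ∧
      G.g (edgeCoord S κ v) ((S.edgeLocalCoord κ).frame v ξ) ((S.edgeLocalCoord κ).frame v ξ) ≤
        C * ∑ i, (edgeFactor v i * ξ i) ^ 2 := by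
  -- Close to the boundary `g` lies between `g₀/2` and `3g₀/2`, so bounds for `g₀` suffice.
  obtain ⟨δ, hδ, hδ1, hvan⟩ := G.vanishing (1 / 2) (by norm_num)
  have hx : Tendsto (fun v : Unit ⊕ Fin b ⊕ Fin n → ℝ => v (Sum.inl ())) (𝓝 v₀) (𝓝 0) := by
    rw [← h0]; exact (continuous_apply _).continuousAt
  have hr : Tendsto (fun v : Unit ⊕ Fin b ⊕ Fin n → ℝ => fun i => v (Sum.inr i)) (𝓝 v₀)
      (𝓝 fun i => v₀ (Sum.inr i)) := by
    refine Continuous.continuousAt ?_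
    fun_prop
  have hl : Tendsto (fun v : Unit ⊕ Fin b ⊕ Fin n → ℝ => fun i => v (Sum.inr (Sum.inl i))) (𝓝 v₀)
      (𝓝 fun i => v₀ (Sum.inr (Sum.inl i))) := by
    refine Continuous.continuousAt ?_
    fun_prop
  have hA : ∀ i j, Tendsto (fun v : Unit ⊕ Fin b ⊕ Fin n → ℝ =>
      coordMatrix (fun q a c => G.gF q a c) κ (fun i => v (Sum.inr i)) i j) (𝓝 v₀)
      (𝓝 (coordMatrix (fun q a c => G.gF q a c) κ (fun i => v₀ (Sum.inr i)) i j)) := fun i j =>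
    ((contDiffOn_coordMatrix G.gF_smooth κ i j).continuousOn.continuousAt
      (κ.open_source.mem_nhds hv₀)).tendsto.comp hr
  have hgB : IsSmoothTensor G.gB.inner := G.gB.contMDiff
  have hD : ∀ i j, Tendsto (fun v : Unit ⊕ Fin b ⊕ Fin n → ℝ =>
      coordMatrix (fun y a c => G.gB.inner y a c) β (fun i => v (Sum.inr (Sum.inl i))) i j) (𝓝 v₀)
      (𝓝 (coordMatrix (fun y a c => G.gB.inner y a c) β (fun i => v₀ (Sum.inr (Sum.inl i))) i j)) :=
    fun i j => ((contDiffOn_coordMatrix hgB β i j).continuousOn.continuousAt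
      (β.open_source.mem_nhds (hβ _ hv₀).1)).tendsto.comp hl
  have hT := tendsto_rigidMatrix hx hA hD
  obtain ⟨c, hc, hlow⟩ := eventually_quadratic_ge hT fun ξ hξ => G.rigidMatrix_pos hβ hv₀ hξ
  obtain ⟨C, hC, hup⟩ := eventually_quadratic_le hT
  refine ⟨c / 2, by positivity, 2 * C, by positivity, ?_⟩
  filter_upwards [hlow, hup, hx.eventually (Iio_mem_nhds hδ),
    hr.eventually (κ.open_source.mem_nhds hv₀)] with v h1 h2 h3 h4 h5
  have hv : v ∈ EdgeSpace.edgeSource κ := ⟨⟨h5, lt_of_lt_of_le h3 hδ1⟩, h4⟩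
  refine ⟨hv, fun ξ => ?_⟩
  rw [G.form_edgeLocalCoord hv]
  have h6 := hvan _ ⟨h5, h3⟩ (κ.toFun fun i => v (Sum.inr i)) (ξ (Sum.inl ()))
    (κ.frame (fun i => v (Sum.inr i)) fun i => ξ (Sum.inr i))
  have h7 := G.rigidForm_nonneg_aux (by norm_num) h6
  rw [abs_le] at h6
  have e := G.rigidForm_frame hβ h4 ξ
  have h8 := h1 fun i => edgeFactor v i * ξ i
  have h9 := h2 fun i => edgeFactor v i * ξ i
  rw [← e] at h8 h9
  constructor <;> linarith

end EdgeMetric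

end Comparison

/-! ### Functions with bounded gradient near the boundary -/

section BoundedGradient

open Filter Topology Matrix

variable {b n : ℕ}
  {M : Type*} [TopologicalSpace M] [ChartedSpace (EuclideanHalfSpace (b + n + 1)) M]
  {Y : Type*} [TopologicalSpace Y] [ChartedSpace (EuclideanSpace ℝ (Fin (b + n))) Y]
  {B : Type*} [TopologicalSpace B] [ChartedSpace (EuclideanSpace ℝ (Fin b)) B]
  {F : Type*} [TopologicalSpace F] [ChartedSpace (EuclideanSpace ℝ (Fin n)) F]

/-- The coordinates of the point `(x, q)` of the collar. -/
def chartPoint (κ : LocalCoord (𝓡 (b + n)) Y (Fin b ⊕ Fin n)) (a : ℝ × Y) :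
    Unit ⊕ Fin b ⊕ Fin n → ℝ :=
  Sum.elim (fun _ => a.1) (κ.invFun a.2)

theorem edgeCoord_chartPoint (S : EdgeSpace b n M Y B F)
    {κ : LocalCoord (𝓡 (b + n)) Y (Fin b ⊕ Fin n)} {a : ℝ × Y} (ha : a.2 ∈ κ.target) :
    edgeCoord S κ (chartPoint κ a) = S.collar a := by
  have h : κ.toFun (fun i => chartPoint κ a (Sum.inr i)) = a.2 := κ.toFun_inv ha
  rw [edgeCoord, h]
  rfl

theorem continuousAt_chartPoint {κ : LocalCoord (𝓡 (b + n)) Y (Fin b ⊕ Fin n)} {a : ℝ × Y}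
    (ha : a.2 ∈ κ.target) : ContinuousAt (chartPoint κ) a := by
  refine continuousAt_pi.2 fun i => ?_
  rcases i with i | i
  · exact continuousAt_fst
  · exact ((continuous_apply i).continuousAt.comp (κ.smooth_inv.continuousOn.continuousAt
      (κ.open_target.mem_nhds ha))).comp (f := Prod.snd) continuousAt_snd

theorem inr_chartPoint_mem {κ : LocalCoord (𝓡 (b + n)) Y (Fin b ⊕ Fin n)} {a : ℝ × Y}
    (ha : a.2 ∈ κ.target) : (fun i => chartPoint κ a (Sum.inr i)) ∈ κ.source := κ.inv_mem ha

/-- A local estimate at the points of a compact space is uniform. -/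
theorem exists_uniform_of_eventually {Y : Type*} [TopologicalSpace Y] [CompactSpace Y]
    {P : ℝ → ℝ × Y → Prop} (hP : ∀ C C' a, C ≤ C' → P C a → P C' a)
    (h : ∀ q : Y, ∃ C, ∀ᶠ a in 𝓝 ((0 : ℝ), q), 0 < a.1 → P C a) :
    ∃ C > 0, ∃ δ > 0, δ ≤ 1 ∧ ∀ x ∈ Ioo 0 δ, ∀ q, P C (x, q) := by
  have key := isCompact_univ (X := Y).induction_on
    (p := fun s => ∃ C > 0, ∃ δ > 0, δ ≤ 1 ∧ ∀ x ∈ Ioo (0 : ℝ) δ, ∀ q ∈ s, P C (x, q))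
    ⟨1, one_pos, 1, one_pos, le_rfl, fun _ _ _ h => absurd h (by simp)⟩
    (fun s t hst ⟨C, hC, δ, hδ, hδ1, h⟩ => ⟨C, hC, δ, hδ, hδ1, fun x hx q hq => h x hx q (hst hq)⟩)
    (fun s t ⟨C, hC, δ, hδ, hδ1, h⟩ ⟨C', hC', δ', hδ', _, h'⟩ =>
      ⟨max C C', lt_max_of_lt_left hC, min δ δ', lt_min hδ hδ', (min_le_left _ _).trans hδ1,
        fun x hx q hq => hq.elim
          (fun hq => hP _ _ _ (le_max_left _ _)
            (h x ⟨hx.1, hx.2.trans_le (min_le_left _ _)⟩ q hq))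
          (fun hq => hP _ _ _ (le_max_right _ _)
            (h' x ⟨hx.1, hx.2.trans_le (min_le_right _ _)⟩ q hq))⟩)
    (fun q _ => by
      obtain ⟨C, hC⟩ := h q
      rw [nhds_prod_eq] at hC
      obtain ⟨U, hU, W, hW, hUW⟩ := eventually_prod_iff.1 hC
      obtain ⟨δ, hδ, hball⟩ := Metric.eventually_nhds_iff.1 hU
      refine ⟨{q' | W q'}, mem_nhdsWithin_of_mem_nhds hW, max C 1, by positivity, min δ 1,
        by positivity, min_le_right _ _, fun x hx q' hq' => hP _ _ _ (le_max_left _ _) ?_⟩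
      refine hUW (hball ?_) hq' hx.1
      rw [Real.dist_eq, sub_zero, abs_of_pos hx.1]
      exact hx.2.trans_le (min_le_left _ _))
  obtain ⟨C, hC, δ, hδ, hδ1, h⟩ := key
  exact ⟨C, hC, δ, hδ, hδ1, fun x hx q => h x hx q (mem_univ q)⟩

namespace EdgeSpace

/-- The boundary is closed in the compact space `M`, and the second component of the inverse collar
maps it onto `Y`. -/
theorem compactSpace_of_compactSpace [IsManifold (𝓡∂ (b + n + 1)) ∞ M] [CompactSpace M]
    (S : EdgeSpace b n M Y B F) :
    CompactSpace Y := by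
  have hcl : IsClosed ((𝓡∂ (b + n + 1)).boundary M) := by
    rw [← isOpen_compl_iff, ModelWithCorners.compl_boundary]
    exact (𝓡∂ (b + n + 1)).isOpen_interior (n := ∞) (by simp)
  have hsub : (𝓡∂ (b + n + 1)).boundary M ⊆ S.collar '' (Ico (0 : ℝ) 1 ×ˢ univ) := by
    rw [S.boundary_eq]
    rintro _ ⟨q, rfl⟩
    exact S.collar_mem_image ⟨le_rfl, one_pos⟩ q
  have h := hcl.isCompact.image_of_continuousOn
    (continuous_snd.comp_continuousOn (S.collarInv_smooth.continuousOn.mono hsub))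
  refine ⟨h.of_isClosed_subset isClosed_univ fun q _ => ⟨S.collar (0, q), ?_, ?_⟩⟩
  · rw [S.boundary_eq]; exact ⟨q, rfl⟩
  · simp [S.collarInv_collar (show (0 : ℝ) ∈ Ico (0 : ℝ) 1 from ⟨le_rfl, one_pos⟩)]

/-- The radial function. -/
def radius (S : EdgeSpace b n M Y B F) (p : M) : ℝ := (S.collarInv p).1

/-- A function on the base, as a function on the collar. -/
def pullback (S : EdgeSpace b n M Y B F) (h : B → ℝ) (p : M) : ℝ := h (S.proj (S.collarInv p).2)

variable (S : EdgeSpace b n M Y B F)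

theorem contMDiffOn_radius : ContMDiffOn (𝓡∂ (b + n + 1)) 𝓘(ℝ, ℝ) ∞ S.radius
    (S.collar '' (Ico (0 : ℝ) 1 ×ˢ univ)) :=
  contMDiff_fst.comp_contMDiffOn S.collarInv_smooth

theorem contMDiffOn_pullback {h : B → ℝ} (hh : ContMDiff (𝓡 b) 𝓘(ℝ, ℝ) ∞ h) :
    ContMDiffOn (𝓡∂ (b + n + 1)) 𝓘(ℝ, ℝ) ∞ (S.pullback h)
      (S.collar '' (Ico (0 : ℝ) 1 ×ˢ univ)) :=
  (hh.comp S.proj_smooth).comp_contMDiffOn (contMDiff_snd.comp_contMDiffOn S.collarInv_smooth)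

theorem radius_collar {x : ℝ} (hx : x ∈ Ico (0 : ℝ) 1) (q : Y) : S.radius (S.collar (x, q)) = x := by
  rw [radius, S.collarInv_collar hx]

theorem pullback_collar (h : B → ℝ) {x : ℝ} (hx : x ∈ Ico (0 : ℝ) 1) (q : Y) :
    S.pullback h (S.collar (x, q)) = h (S.proj q) := by
  rw [pullback, S.collarInv_collar hx]

theorem mdifferentiableAt_of_collar {k : WithTop ℕ∞} (hk : k ≠ 0) {Φ : M → ℝ}
    (hΦ : ContMDiffOn (𝓡∂ (b + n + 1)) 𝓘(ℝ, ℝ) k Φ (S.collar '' (Ico (0 : ℝ) 1 ×ˢ univ)))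
    {x : ℝ} (hx : x ∈ Ico (0 : ℝ) 1) (q : Y) :
    MDifferentiableAt (𝓡∂ (b + n + 1)) 𝓘(ℝ, ℝ) Φ (S.collar (x, q)) :=
  (hΦ.contMDiffAt (S.isOpen_collar.mem_nhds (S.collar_mem_image hx q))).mdifferentiableAt hk

end EdgeSpace

variable [IsManifold (𝓡∂ (b + n + 1)) ∞ M] [IsManifold (𝓡 (b + n)) ∞ Y] [IsManifold (𝓡 b) ∞ B]
  {S : EdgeSpace b n M Y B F}

namespace EdgeMetric

variable (G : EdgeMetric S) {κ : LocalCoord (𝓡 (b + n)) Y (Fin b ⊕ Fin n)}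

theorem exists_comparison_at (hκ : IsFibredCoord S.proj κ) {q : Y} (hq : q ∈ κ.target) :
    ∃ c > 0, ∃ C > 0, ∀ᶠ v in 𝓝 (chartPoint κ (0, q)), 0 < v (Sum.inl ()) →
      v ∈ EdgeSpace.edgeSource κ ∧ ∀ ξ,
      c * ∑ i, (edgeFactor v i * ξ i) ^ 2 ≤ G.g (edgeCoord S κ v)
        ((S.edgeLocalCoord κ).frame v ξ) ((S.edgeLocalCoord κ).frame v ξ) ∧
      G.g (edgeCoord S κ v) ((S.edgeLocalCoord κ).frame v ξ) ((S.edgeLocalCoord κ).frame v ξ) ≤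
        C * ∑ i, (edgeFactor v i * ξ i) ^ 2 := by
  obtain ⟨β, hβ⟩ := hκ
  exact G.exists_comparison hβ rfl (inr_chartPoint_mem hq)

/-- The gradient of `Φ` is bounded near the boundary. -/
def BoundedGradient (Φ : M → ℝ) : Prop :=
  ∃ C > 0, ∃ δ > 0, δ ≤ 1 ∧ ∀ x ∈ Ioo 0 δ, ∀ q, ∀ ξ : TangentSpace (𝓡∂ (b + n + 1))
    (S.collar (x, q)), differential Φ (S.collar (x, q)) ξ ^ 2 ≤ C * G.g (S.collar (x, q)) ξ ξ

/-- The `w i` are the derivatives of `Φ` along the generators `∂_x`, `∂_y`, `x⁻¹∂_z`. These are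
orthonormal for a metric comparable to `g`, so the Cauchy–Schwarz inequality bounds `|dΦ|²` locally,
and compactness of `Y` makes the bound uniform. -/
theorem boundedGradient_of_chart [CompactSpace Y] {Φ : M → ℝ}
    (h : ∀ q : Y, ∃ κ : LocalCoord (𝓡 (b + n)) Y (Fin b ⊕ Fin n), IsFibredCoord S.proj κ ∧
      q ∈ κ.target ∧ ∃ L : ℝ, ∀ᶠ v in 𝓝 (chartPoint κ (0, q)), 0 < v (Sum.inl ()) →
        ∃ w : Unit ⊕ Fin b ⊕ Fin n → ℝ, (∀ i, |w i| ≤ L) ∧ ∀ ξ,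
          differential Φ (edgeCoord S κ v) ((S.edgeLocalCoord κ).frame v ξ) =
            ∑ i, edgeFactor v i * w i * ξ i) : G.BoundedGradient Φ := by
  -- The property has to be monotone in the constant. The truncation `max · 0` ensures this, and `0
  -- ≤ g(ξ, ξ)` is carried along to remove it at the end.
  refine exists_uniform_of_eventually (P := fun C a => ∀ ξ : TangentSpace (𝓡∂ (b + n + 1))
    (S.collar a), differential Φ (S.collar a) ξ ^ 2 ≤ C * max (G.g (S.collar a) ξ ξ) 0 ∧
      0 ≤ G.g (S.collar a) ξ ξ) ?_ ?_ |>.imp ?_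
  · intro C C' a hC h ξ
    exact ⟨(h ξ).1.trans (by gcongr), (h ξ).2⟩
  · intro q
    obtain ⟨κ, hκ, hq, L, hL⟩ := h q
    obtain ⟨c, hc, C, -, hcomp⟩ := G.exists_comparison_at hκ hq
    refine ⟨Fintype.card (Unit ⊕ Fin b ⊕ Fin n) * L ^ 2 / c, ?_⟩
    have ht := continuousAt_chartPoint (κ := κ) (a := (0, q)) hq
    filter_upwards [ht.eventually (hL.and hcomp),
      continuousAt_snd.eventually (κ.open_target.mem_nhds hq)] with a ha haκ ha0
    have key : ∀ p : M, p = edgeCoord S κ (chartPoint κ a) → ∀ ξ : TangentSpace (𝓡∂ (b + n + 1)) p,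
        differential Φ p ξ ^ 2 ≤ Fintype.card (Unit ⊕ Fin b ⊕ Fin n) * L ^ 2 / c *
          max (G.g p ξ ξ) 0 ∧ 0 ≤ G.g p ξ ξ := by
      rintro _ rfl ξ
      obtain ⟨hv, hg⟩ := ha.2 ha0
      obtain ⟨w, hw, hd⟩ := ha.1 ha0
      obtain ⟨ζ, rfl⟩ := (S.edgeLocalCoord κ).frame_surjective hv ξ
      have hge := (hg ζ).1
      set v := chartPoint κ a
      have hd' : differential Φ ((S.edgeLocalCoord κ).toFun v) ((S.edgeLocalCoord κ).frame v ζ) =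
        ∑ i, w i * (edgeFactor v i * ζ i) := (hd ζ).trans
          (Finset.sum_congr rfl fun i _ => by ring)
      have hs0 : 0 ≤ ∑ i, (edgeFactor v i * ζ i) ^ 2 := Finset.sum_nonneg fun i _ => sq_nonneg _
      refine ⟨?_, (mul_nonneg hc.le hs0).trans hge⟩
      refine (congrArg (· ^ 2) hd').le.trans ?_
      have hcs := Finset.sum_mul_sq_le_sq_mul_sq Finset.univ w fun i => edgeFactor v i * ζ i
      have hws : ∑ i, w i ^ 2 ≤ Fintype.card (Unit ⊕ Fin b ⊕ Fin n) * L ^ 2 := by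
        calc ∑ i, w i ^ 2 ≤ ∑ _i : Unit ⊕ Fin b ⊕ Fin n, L ^ 2 := Finset.sum_le_sum fun i _ =>
              sq_le_sq' (by linarith [(abs_le.1 (hw i)).1]) (abs_le.1 (hw i)).2
          _ = _ := by simp
      calc _ ≤ (∑ i, w i ^ 2) * ∑ i, (edgeFactor v i * ζ i) ^ 2 := hcs
        _ ≤ Fintype.card (Unit ⊕ Fin b ⊕ Fin n) * L ^ 2 * ∑ i, (edgeFactor v i * ζ i) ^ 2 := by
          gcongr
        _ = Fintype.card (Unit ⊕ Fin b ⊕ Fin n) * L ^ 2 / c *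
            (c * ∑ i, (edgeFactor v i * ζ i) ^ 2) := by field_simp
        _ ≤ _ := by
          gcongr
          exact hge.trans (le_max_left _ _)
    exact key _ (edgeCoord_chartPoint S haκ).symm
  · rintro C ⟨hC, δ, hδ, hδ1, h⟩
    refine ⟨hC, δ, hδ, hδ1, fun x hx q ξ => (h x hx q ξ).1.trans_eq ?_⟩
    rw [max_eq_left (h x hx q ξ).2]

end EdgeMetric

namespace EdgeMetric

variable (G : EdgeMetric S)

theorem boundedGradient_radius [CompactSpace Y]
    (hcov : ∀ q : Y, ∃ κ : LocalCoord (𝓡 (b + n)) Y (Fin b ⊕ Fin n), IsFibredCoord S.proj κ ∧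
      q ∈ κ.target) : G.BoundedGradient S.radius := by
  refine G.boundedGradient_of_chart fun q => ?_
  obtain ⟨κ, hκ, hq⟩ := hcov q
  obtain ⟨c, hc, C, -, hcomp⟩ := G.exists_comparison_at hκ hq
  refine ⟨κ, hκ, hq, 1, ?_⟩
  filter_upwards [hcomp] with v hv hv0
  refine ⟨Sum.elim (fun _ => 1) (fun _ => 0), fun i => by rcases i with i | i <;> simp, fun ξ => ?_⟩
  have hvs := (hv hv0).1
  have h1 := (S.edgeLocalCoord κ).fderiv_comp hvs (S.mdifferentiableAt_of_collar (by simp)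
    S.contMDiffOn_radius (Ioo_subset_Ico_self hvs.1) _) ξ
  refine h1.symm.trans ?_
  have hev : (fun w => S.radius ((S.edgeLocalCoord κ).toFun w)) =ᶠ[𝓝 v]
      ContinuousLinearMap.proj (R := ℝ) (φ := fun _ : Unit ⊕ Fin b ⊕ Fin n => ℝ) (Sum.inl ()) :=
    eventually_of_mem ((EdgeSpace.isOpen_edgeSource κ).mem_nhds hvs) fun w hw =>
      S.radius_collar (Ioo_subset_Ico_self hw.1) _
  rw [hev.fderiv_eq, ContinuousLinearMap.fderiv]
  simp [edgeFactor]

/-- A function of `y` alone has no `z`-derivative, so the generator `x⁻¹∂_z`, whose coefficient is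
singular, does not act on it. -/
theorem boundedGradient_pullback [CompactSpace Y]
    (hcov : ∀ q : Y, ∃ κ : LocalCoord (𝓡 (b + n)) Y (Fin b ⊕ Fin n), IsFibredCoord S.proj κ ∧
      q ∈ κ.target) {h : B → ℝ} (hh : ContMDiff (𝓡 b) 𝓘(ℝ, ℝ) ∞ h) :
    G.BoundedGradient (S.pullback h) := by
  refine G.boundedGradient_of_chart fun q => ?_
  obtain ⟨κ, hκ, hq⟩ := hcov q
  obtain ⟨c, hc, C, -, hcomp⟩ := G.exists_comparison_at hκ hq
  obtain ⟨β, hβ⟩ := hκ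
  set v₀ := chartPoint κ (0, q)
  have hy₀ : (fun i => v₀ (Sum.inr (Sum.inl i))) ∈ β.source := (hβ _ (inr_chartPoint_mem hq)).1
  have hsm : ContDiffOn ℝ ∞ (fun y => h (β.toFun y)) β.source :=
    β.contDiffOn_comp le_rfl (hh.contMDiffOn (s := univ)) subset_rfl fun _ _ => mem_univ _
  have hcd : ContinuousAt (fderiv ℝ fun y => h (β.toFun y)) fun i => v₀ (Sum.inr (Sum.inl i)) :=
    ((hsm.continuousOn_fderiv_of_isOpen β.open_source (by simp)).continuousAt
      (β.open_source.mem_nhds hy₀))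
  have hl : Tendsto (fun v : Unit ⊕ Fin b ⊕ Fin n → ℝ => fun i => v (Sum.inr (Sum.inl i))) (𝓝 v₀)
      (𝓝 fun i => v₀ (Sum.inr (Sum.inl i))) := by
    refine Continuous.continuousAt ?_
    fun_prop
  have hbd := hl.eventually (hcd.norm.eventually (Iio_mem_nhds (lt_add_one _)))
  refine ⟨κ, ⟨β, hβ⟩, hq,
    ‖fderiv ℝ (fun y => h (β.toFun y)) fun i => v₀ (Sum.inr (Sum.inl i))‖ + 1, ?_⟩
  · filter_upwards [hcomp, hbd] with v hv hb hv0
    have hvs := (hv hv0).1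
    have hβv := (hβ _ hvs.2).1
    refine ⟨Sum.elim (fun _ => 0) (Sum.elim (fun i => fderiv ℝ (fun y => h (β.toFun y))
      (fun i => v (Sum.inr (Sum.inl i))) (Pi.single i 1)) fun _ => 0), fun i => ?_, fun ξ => ?_⟩
    · have h0 := (norm_nonneg _).trans hb.le
      rcases i with i | i | i
      · simpa using h0
      · refine ((fderiv ℝ (fun y => h (β.toFun y)) fun i => v (Sum.inr (Sum.inl i))).le_opNorm
          (Pi.single i 1)).trans (le_trans ?_ hb.le)
        rw [Pi.norm_single, norm_one, mul_one]
      · simpa using h0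
    · have h1 := (S.edgeLocalCoord κ).fderiv_comp hvs (S.mdifferentiableAt_of_collar (by simp)
        (S.contMDiffOn_pullback hh) (Ioo_subset_Ico_self hvs.1) _) ξ
      refine h1.symm.trans ?_
      have hev : (fun w => S.pullback h ((S.edgeLocalCoord κ).toFun w)) =ᶠ[𝓝 v]
          (fun y => h (β.toFun y)) ∘
            (ContinuousLinearMap.pi fun i : Fin b => ContinuousLinearMap.proj (R := ℝ)
            (φ := fun _ : Unit ⊕ Fin b ⊕ Fin n => ℝ) (Sum.inr (Sum.inl i))) :=
        eventually_of_mem ((EdgeSpace.isOpen_edgeSource κ).mem_nhds hvs) fun w hw =>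
          (S.pullback_collar h (Ioo_subset_Ico_self hw.1) _).trans (congrArg h (hβ _ hw.2).2)
      have hd : HasFDerivAt (fun y => h (β.toFun y)) _ (fun i => v (Sum.inr (Sum.inl i))) :=
        ((hsm.contDiffAt (β.open_source.mem_nhds hβv)).differentiableAt (by simp)).hasFDerivAt
      rw [hev.fderiv_eq, (hd.comp v (ContinuousLinearMap.pi fun i : Fin b =>
        ContinuousLinearMap.proj (R := ℝ) (φ := fun _ : Unit ⊕ Fin b ⊕ Fin n => ℝ)
        (Sum.inr (Sum.inl i))).hasFDerivAt).fderiv, ContinuousLinearMap.comp_apply,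
        map_eq_sum_single]
      simp [edgeFactor, mul_comm]

end EdgeMetric

end BoundedGradient

/-! ### Regularity of `u` and volume near the boundary -/

section Regularity

open Filter Topology Matrix

variable {b n : ℕ}
  {M : Type*} [TopologicalSpace M] [ChartedSpace (EuclideanHalfSpace (b + n + 1)) M]
  {Y : Type*} [TopologicalSpace Y] [ChartedSpace (EuclideanSpace ℝ (Fin (b + n))) Y]
  {B : Type*} [TopologicalSpace B] [ChartedSpace (EuclideanSpace ℝ (Fin b)) B]
  {F : Type*} [TopologicalSpace F] [ChartedSpace (EuclideanSpace ℝ (Fin n)) F]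

theorem tendsto_edgeCoord (S : EdgeSpace b n M Y B F)
    {κ : LocalCoord (𝓡 (b + n)) Y (Fin b ⊕ Fin n)} {q : Y} (hq : q ∈ κ.target) :
    Tendsto (edgeCoord S κ) (𝓝[{v | 0 < v (Sum.inl ())}] (chartPoint κ (0, q)))
      (𝓝 (S.collar (0, q))) := by
  have h1 : ContinuousWithinAt S.collar (Ico (0 : ℝ) 1 ×ˢ univ) (0, q) :=
    S.collar_smooth.continuousOn _ ⟨⟨le_rfl, one_pos⟩, mem_univ _⟩
  refine h1.tendsto.comp (tendsto_nhdsWithin_iff.2 ⟨?_, ?_⟩)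
  · refine Tendsto.mono_left ?_ nhdsWithin_le_nhds
    refine Tendsto.prodMk_nhds ?_ ?_
    · exact (continuous_apply (Sum.inl ())).tendsto' _ _ rfl
    · have h2 : Tendsto κ.toFun (𝓝 (κ.invFun q)) (𝓝 q) := by
        have := (κ.smooth.continuousOn.continuousAt (κ.open_source.mem_nhds (κ.inv_mem hq))).tendsto
        rwa [κ.toFun_inv hq] at this
      refine h2.comp (Continuous.tendsto' ?_ _ _ rfl)
      fun_prop
  · have h3 : ∀ᶠ v in 𝓝 (chartPoint κ (0, q)), v (Sum.inl ()) < 1 :=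
      (continuous_apply _).continuousAt.eventually (Iio_mem_nhds (by simp [chartPoint]))
    filter_upwards [nhdsWithin_le_nhds h3, self_mem_nhdsWithin] with v h4 h5
    exact ⟨⟨le_of_lt h5, h4⟩, mem_univ _⟩

variable [IsManifold (𝓡∂ (b + n + 1)) ∞ M] [IsManifold (𝓡 (b + n)) ∞ Y] [IsManifold (𝓡 b) ∞ B]
  {S : EdgeSpace b n M Y B F}

namespace EdgeMetric

variable {G : EdgeMetric S} {α : ℝ} {u : M → ℝ}

theorem EdgeDerivHolder.contMDiffOn (h : G.EdgeDerivHolder α u) (hu : Continuous u) :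
    ContMDiffOn (𝓡∂ (b + n + 1)) 𝓘(ℝ, ℝ) 1 u ((𝓡∂ (b + n + 1)).interior M) := by
  intro p hp
  obtain ⟨ψ, O, hO, hpO, hOψ, hw⟩ := h.1 p hp
  choose w hw hweak using hw
  set Ω : Set (Unit ⊕ Fin b ⊕ Fin n → ℝ) := {v | v ∈ ψ.source ∧ ψ.toFun v ∈ O} with hΩ
  have hΩo : IsOpen Ω := ψ.smooth.continuousOn.isOpen_inter_preimage ψ.open_source hO
  have hsm : ContDiffOn ℝ 1 (fun v => u (ψ.toFun v)) Ω := by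
    refine contDiffOn_of_weak hΩo ?_ (fun i => ?_) hweak
    · exact hu.comp_continuousOn (ψ.smooth.continuousOn.mono fun v hv => hv.1)
    · exact (hw i).1.comp (ψ.smooth.continuousOn.mono fun v hv => hv.1) fun v hv => hv.2
  have hpt := hOψ hpO
  have hmem : ψ.invFun p ∈ Ω := ⟨ψ.inv_mem hpt, by rwa [ψ.toFun_inv hpt]⟩
  have h1 : ContMDiffAt 𝓘(ℝ, Unit ⊕ Fin b ⊕ Fin n → ℝ) 𝓘(ℝ, ℝ) 1 (fun v => u (ψ.toFun v))
      (ψ.invFun p) := (hsm.contDiffAt (hΩo.mem_nhds hmem)).contMDiffAt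
  have h2 := h1.comp p ((ψ.contMDiffAt_inv hpt).of_le (by simp))
  refine (h2.congr_of_eventuallyEq ?_).contMDiffWithinAt
  refine eventually_of_mem (ψ.open_target.mem_nhds hpt) fun p' hp' => ?_
  exact (congrArg u (ψ.toFun_inv hp')).symm

/-- The derivatives along the generators are continuous up to the boundary, hence bounded near each
boundary point. -/
theorem EdgeDerivHolder.boundedGradient [CompactSpace Y] (h : G.EdgeDerivHolder α u)
    (hu : Continuous u) : G.BoundedGradient u := by
  refine G.boundedGradient_of_chart fun q => ?_
  obtain ⟨κ, hκ, hq, O, hO, hqO, hw⟩ := h.2 q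
  choose w hw hweak using hw
  obtain ⟨c, hc, C, -, hcomp⟩ := G.exists_comparison_at hκ hq
  have hu1 := h.contMDiffOn hu
  set Ω : Set (Unit ⊕ Fin b ⊕ Fin n → ℝ) := {v | v (Sum.inl ()) ∈ Ioo 0 1 ∧
    (fun j => v (Sum.inr j)) ∈ κ.source ∧ edgeCoord S κ v ∈ O} with hΩ
  have hcont : ContinuousOn (edgeCoord S κ) (EdgeSpace.edgeSource κ) :=
    (S.edgeLocalCoord κ).smooth.continuousOn
  have hΩo : IsOpen Ω := by
    have := hcont.isOpen_inter_preimage (EdgeSpace.isOpen_edgeSource κ) hO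
    convert this using 1
    ext v
    exact and_assoc.symm
  have hΩs : Ω ⊆ EdgeSpace.edgeSource κ := fun v hv => ⟨hv.1, hv.2.1⟩
  have hder : ∀ v ∈ Ω, HasFDerivAt (fun v => u (edgeCoord S κ v))
      (∑ i, (edgeFactor v i * w i (edgeCoord S κ v)) • ContinuousLinearMap.proj (R := ℝ)
        (φ := fun _ : Unit ⊕ Fin b ⊕ Fin n => ℝ) i) v := by
    intro v hv
    refine hasFDerivAt_of_weak hΩo (w := fun i v => edgeFactor v i * w i (edgeCoord S κ v))
      (hu.comp_continuousOn (hcont.mono hΩs)) (fun i => ?_) hweak hv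
    refine ContinuousOn.mul ?_ ((hw i).1.comp (hcont.mono hΩs) fun v hv => hv.2.2)
    refine Continuous.continuousOn ?_
    rcases i with i | i | i
    · exact continuous_const
    · exact continuous_const
    · exact continuous_apply _
  have hbd : ∀ i, ∀ᶠ p in 𝓝 (S.collar (0, q)), |w i p| < |w i (S.collar (0, q))| + 1 := fun i =>
    ((hw i).1.continuousAt (hO.mem_nhds hqO)).abs.eventually (Iio_mem_nhds (lt_add_one _))
  have hev := eventually_nhdsWithin_iff.1 ((tendsto_edgeCoord S hq).eventually
    ((show ∀ᶠ p in 𝓝 (S.collar (0, q)), p ∈ O from hO.mem_nhds hqO).and (eventually_all.2 hbd)))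
  refine ⟨κ, hκ, hq, ∑ i, |w i (S.collar (0, q))| + 1, ?_⟩
  filter_upwards [hcomp, hev] with v hv hv' hv0
  have hvs := (hv hv0).1
  have hvO := hv' hv0
  refine ⟨fun i => w i (edgeCoord S κ v), fun i => ?_, fun ξ => ?_⟩
  · have h1 := (hvO.2 i).le
    have h2 := Finset.single_le_sum (f := fun i => |w i (S.collar (0, q))|)
      (fun _ _ => abs_nonneg _) (Finset.mem_univ i)
    linarith
  · have hmd : MDifferentiableAt (𝓡∂ (b + n + 1)) 𝓘(ℝ, ℝ) u (edgeCoord S κ v) :=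
      (hu1.contMDiffAt (((𝓡∂ (b + n + 1)).isOpen_interior (n := ∞) (by simp)).mem_nhds
        (S.collar_mem_interior hvs.1 _))).mdifferentiableAt one_ne_zero
    have h1 := (S.edgeLocalCoord κ).fderiv_comp hvs hmd ξ
    refine h1.symm.trans ?_
    have h2 := (hder v ⟨hvs.1, hvs.2, hvO.1⟩).fderiv
    refine (DFunLike.congr_fun h2 ξ).trans ?_
    simp

theorem BoundedGradient.neg (h : G.BoundedGradient u) : G.BoundedGradient fun p => -u p := by
  obtain ⟨C, hC, δ, hδ, hδ1, h⟩ := h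
  refine ⟨C, hC, δ, hδ, hδ1, fun x hx q ξ => le_trans (le_of_eq ?_) (h x hx q ξ)⟩
  have e : differential (fun p => -u p) (S.collar (x, q)) ξ =
      -differential u (S.collar (x, q)) ξ := by
    have := mfderiv_neg (I := 𝓡∂ (b + n + 1)) (f := u) (x := S.collar (x, q))
    exact DFunLike.congr_fun this ξ
  rw [e, neg_sq]

variable {κ : LocalCoord (𝓡 (b + n)) Y (Fin b ⊕ Fin n)}

theorem prod_edgeFactor (v : Unit ⊕ Fin b ⊕ Fin n → ℝ) :
    ∏ i, edgeFactor v i = v (Sum.inl ()) ^ n := by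
  simp [Fintype.prod_sum_type, edgeFactor]

variable (G) in
-- By the comparison of metrics the determinant is of order `x^(2n)`. For the upper bound `n ≥ 1`
-- gives `x^n ≤ x`. For the lower bound every factor `1` or `x` is simply replaced by `x`, since any
-- power will do.
theorem exists_density_bounds (hn : 1 ≤ n) (hκ : IsFibredCoord S.proj κ) {q : Y}
    (hq : q ∈ κ.target) :
    ∃ c > 0, ∃ C > 0, ∀ᶠ v in 𝓝 (chartPoint κ (0, q)), 0 < v (Sum.inl ()) →
      v ∈ EdgeSpace.edgeSource κ ∧
      c * v (Sum.inl ()) ^ Fintype.card (Unit ⊕ Fin b ⊕ Fin n) ≤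
        coordDensity G.interiorMetric.tensor (S.edgeLocalCoord κ) v ∧
      coordDensity G.interiorMetric.tensor (S.edgeLocalCoord κ) v ≤ C * v (Sum.inl ()) := by
  obtain ⟨c, hc, C, hC, hcomp⟩ := G.exists_comparison_at hκ hq
  set N := Fintype.card (Unit ⊕ Fin b ⊕ Fin n) with hN
  refine ⟨√c ^ N, by positivity, √(N.factorial * C ^ N), by positivity, ?_⟩
  filter_upwards [hcomp] with v hv hv0
  obtain ⟨hvs, hq⟩ := hv hv0
  set x := v (Sum.inl ()) with hx
  have hx1 : x ≤ 1 := hvs.1.2.le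
  have hf0 : ∀ i, 0 < edgeFactor v i := fun i => by
    rcases i with i | i | i
    · exact one_pos
    · exact one_pos
    · exact hv0
  have hfx : ∀ i, x ≤ edgeFactor v i := fun i => by
    rcases i with i | i | i
    · exact hx1
    · exact hx1
    · exact le_rfl
  set T := coordMatrix G.interiorMetric.tensor (S.edgeLocalCoord κ) v with hT
  have hsymm : T.IsSymm := G.interiorMetric.isSymm_coordMatrix _ v
  have hquad : ∀ ξ, c * ∑ i, (edgeFactor v i * ξ i) ^ 2 ≤ ξ ⬝ᵥ (T *ᵥ ξ) ∧
      ξ ⬝ᵥ (T *ᵥ ξ) ≤ C * ∑ i, (edgeFactor v i * ξ i) ^ 2 := fun ξ => by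
    have e : ξ ⬝ᵥ (T *ᵥ ξ) = G.g (edgeCoord S κ v) ((S.edgeLocalCoord κ).frame v ξ)
      ((S.edgeLocalCoord κ).frame v ξ) := dotProduct_coordMatrix G.g (S.edgeLocalCoord κ) v ξ ξ
    rw [e]
    exact hq ξ
  refine ⟨hvs, ?_, ?_⟩
  · refine Real.le_sqrt_of_sq_le ?_
    have h1 : (√c ^ N * x ^ N) ^ 2 = (c * x ^ 2) ^ N := by
      rw [← mul_pow, ← pow_mul, mul_comm N 2, pow_mul, mul_pow, Real.sq_sqrt hc.le]
    rw [h1]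
    refine pow_card_le_det hsymm (by positivity) fun ξ => le_trans ?_ (hquad ξ).1
    rw [mul_assoc, Finset.mul_sum]
    gcongr with i
    rw [mul_pow]
    gcongr
    exact hfx i
  · have hent := abs_entries_le_of_quadratic_le hsymm hf0
      (fun ξ => le_trans (by positivity) (hquad ξ).1) fun ξ => (hquad ξ).2
    have hdet := abs_det_le_of_abs_entries_le hent
    rw [prod_edgeFactor] at hdet
    rw [coordDensity]
    have h2 : (x ^ n) ^ 2 ≤ x ^ 2 := by
      gcongr
      exact pow_le_of_le_one hv0.le hx1 (by omega)
    calc √T.det ≤ √(N.factorial * C ^ N * x ^ 2) := by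
          refine Real.sqrt_le_sqrt ((le_abs_self _).trans (hdet.trans ?_))
          rw [← mul_assoc]
          gcongr
      _ = _ := by rw [Real.sqrt_mul (by positivity), Real.sqrt_sq hv0.le]

variable [MeasurableSpace M] [BorelSpace M] {μ : Measure M}

/-- A coordinate box of height `t` has Euclidean volume of order `t`, and the density on it is at
most `C t`. The resulting order `t²` is what outweighs the gradient, of order `1/t`, of the
cut-offs. -/
theorem exists_nhds_volume_collar_le (hμ : G.interiorMetric.IsVolume (Unit ⊕ Fin b ⊕ Fin n) μ)
    (hn : 1 ≤ n) (hκ : IsFibredCoord S.proj κ) {q : Y} (hq : q ∈ κ.target) :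
    ∃ W ∈ 𝓝 q, ∃ C > 0, ∃ δ > 0, ∀ t, 0 < t → t ≤ δ →
      μ (S.collar '' (Ioo 0 t ×ˢ W)) ≤ ENNReal.ofReal (C * t ^ 2) := by
  obtain ⟨c, -, C, hC, hev⟩ := G.exists_density_bounds hn hκ hq
  set v₀ := chartPoint κ (0, q) with hv₀
  obtain ⟨r, hr, hball⟩ := Metric.eventually_nhds_iff.1 hev
  have hWc : ContinuousAt κ.invFun q := (κ.contMDiffAt_inv hq).continuousAt
  refine ⟨κ.target ∩ κ.invFun ⁻¹' Metric.ball (κ.invFun q) r, inter_mem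
    (κ.open_target.mem_nhds hq) (hWc.preimage_mem_nhds (Metric.ball_mem_nhds _ hr)),
    C * (2 * r) ^ Fintype.card (Fin b ⊕ Fin n), by positivity, r, hr, fun t ht htr => ?_⟩
  set lo : Unit ⊕ Fin b ⊕ Fin n → ℝ := Sum.elim (fun _ => 0) fun i => κ.invFun q i - r with hlo
  set hi : Unit ⊕ Fin b ⊕ Fin n → ℝ := Sum.elim (fun _ => t) fun i => κ.invFun q i + r with hhi
  set Q : Set (Unit ⊕ Fin b ⊕ Fin n → ℝ) := univ.pi fun i => Ioo (lo i) (hi i) with hQ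
  have hQo : IsOpen Q := isOpen_set_pi finite_univ fun _ _ => isOpen_Ioo
  have hQ' : ∀ v ∈ Q, dist v v₀ < r ∧ 0 < v (Sum.inl ()) ∧ v (Sum.inl ()) < t := by
    intro v hv
    have hv0 := hv (Sum.inl ()) (mem_univ _)
    refine ⟨(dist_pi_lt_iff hr).2 fun i => ?_, hv0.1, hv0.2⟩
    rcases i with i | i
    · have : dist (v (Sum.inl ())) 0 < r := by
        rw [Real.dist_eq, sub_zero, abs_of_pos hv0.1]; exact hv0.2.trans_le htr
      exact this
    · have h := hv (Sum.inr i) (mem_univ _)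
      have h1 : κ.invFun q i - r < v (Sum.inr i) := h.1
      have h2 : v (Sum.inr i) < κ.invFun q i + r := h.2
      have : dist (v (Sum.inr i)) (κ.invFun q i) < r := by
        rw [Real.dist_eq, abs_lt]; constructor <;> linarith
      exact this
  have hQs : Q ⊆ (S.edgeLocalCoord κ).source := fun v hv =>
    (hball (hQ' v hv).1 (hQ' v hv).2.1).1
  have hsub : S.collar '' (Ioo 0 t ×ˢ (κ.target ∩ κ.invFun ⁻¹' Metric.ball (κ.invFun q) r)) ⊆
      (S.edgeLocalCoord κ).toFun '' Q := by
    rintro _ ⟨⟨x, q'⟩, ⟨hx, hq', hq''⟩, rfl⟩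
    refine ⟨chartPoint κ (x, q'), fun i _ => ?_, edgeCoord_chartPoint S hq'⟩
    rcases i with i | i
    · exact hx
    · have h := (dist_pi_lt_iff hr).1 hq'' i
      rw [Real.dist_eq, abs_lt] at h
      have : κ.invFun q' i ∈ Ioo (κ.invFun q i - r) (κ.invFun q i + r) :=
        ⟨by linarith, by linarith⟩
      exact this
  calc _ ≤ μ ((S.edgeLocalCoord κ).toFun '' Q) := measure_mono hsub
    _ = ∫⁻ v in Q, ENNReal.ofReal
        (coordDensity G.interiorMetric.tensor (S.edgeLocalCoord κ) v) := hμ.apply_image _ hQo hQs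
    _ ≤ ∫⁻ _v in Q, ENNReal.ofReal (C * t) := by
        refine setLIntegral_mono' hQo.measurableSet fun v hv => ENNReal.ofReal_le_ofReal ?_
        have h1 := (hball (hQ' v hv).1 (hQ' v hv).2.1).2.2
        have h2 := (hQ' v hv).2.2.le
        exact h1.trans (by gcongr)
    _ = ENNReal.ofReal (C * t) * volume Q := setLIntegral_const _ _
    _ = _ := by
        have hv : volume Q = ENNReal.ofReal (t * (2 * r) ^ Fintype.card (Fin b ⊕ Fin n)) := by
          rw [hQ, Real.volume_pi_Ioo, Fintype.prod_sum_type]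
          have e : ∀ i : Fin b ⊕ Fin n, hi (Sum.inr i) - lo (Sum.inr i) = 2 * r := fun i => by
            simp only [hhi, hlo, Sum.elim_inr]; ring
          simp only [e, Finset.prod_const, Finset.card_univ]
          rw [ENNReal.ofReal_mul ht.le, ENNReal.ofReal_pow (by positivity)]
          simp [hhi, hlo]
        rw [hv, ← ENNReal.ofReal_mul (by positivity)]
        congr 1
        ring

theorem exists_volume_collar_le [CompactSpace Y]
    (hμ : G.interiorMetric.IsVolume (Unit ⊕ Fin b ⊕ Fin n) μ) (hn : 1 ≤ n)
    (hcov : ∀ q : Y, ∃ κ : LocalCoord (𝓡 (b + n)) Y (Fin b ⊕ Fin n), IsFibredCoord S.proj κ ∧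
      q ∈ κ.target) :
    ∃ C > 0, ∃ δ > 0, δ ≤ 1 ∧ ∀ t, 0 < t → t ≤ δ →
      μ (S.collar '' (Ioo 0 t ×ˢ univ)) ≤ ENNReal.ofReal (C * t ^ 2) := by
  refine isCompact_univ (X := Y).induction_on
    (p := fun s => ∃ C > 0, ∃ δ > 0, δ ≤ 1 ∧ ∀ t, 0 < t → t ≤ δ →
      μ (S.collar '' (Ioo 0 t ×ˢ s)) ≤ ENNReal.ofReal (C * t ^ 2)) ?_ ?_ ?_ ?_
  · exact ⟨1, one_pos, 1, one_pos, le_rfl, fun t _ _ => by simp⟩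
  · rintro s s' hs ⟨C, hC, δ, hδ, hδ1, h⟩
    exact ⟨C, hC, δ, hδ, hδ1, fun t ht htδ => (measure_mono (by gcongr)).trans (h t ht htδ)⟩
  · rintro s s' ⟨C, hC, δ, hδ, hδ1, h⟩ ⟨C', hC', δ', hδ', -, h'⟩
    refine ⟨C + C', by positivity, min δ δ', by positivity, (min_le_left _ _).trans hδ1,
      fun t ht htδ => ?_⟩
    rw [prod_union, image_union, add_mul, ENNReal.ofReal_add (by positivity) (by positivity)]
    exact (measure_union_le _ _).trans (add_le_add (h t ht (htδ.trans (min_le_left _ _)))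
      (h' t ht (htδ.trans (min_le_right _ _))))
  · intro q _
    obtain ⟨κ, hκ, hq⟩ := hcov q
    obtain ⟨W, hW, C, hC, δ, hδ, h⟩ := exists_nhds_volume_collar_le hμ hn hκ hq
    exact ⟨W, mem_nhdsWithin_of_mem_nhds hW, C, hC, min δ 1, by positivity, min_le_right _ _,
      fun t ht htδ => h t ht (htδ.trans (min_le_left _ _))⟩

end EdgeMetric

end Regularity

/-! ### Hölder functions on the fibres of the boundary -/

section FibreConstancy

open Filter Topology

variable {b n : ℕ}
  {M : Type*} [TopologicalSpace M] [ChartedSpace (EuclideanHalfSpace (b + n + 1)) M]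
  {Y : Type*} [TopologicalSpace Y] [ChartedSpace (EuclideanSpace ℝ (Fin (b + n))) Y]
  {B : Type*} [TopologicalSpace B] [ChartedSpace (EuclideanSpace ℝ (Fin b)) B]
  {F : Type*} [TopologicalSpace F] [ChartedSpace (EuclideanSpace ℝ (Fin n)) F]

/-- The length of a segment in local coordinates. -/
theorem metricDist_le_of_segment {E : Type*} [NormedAddCommGroup E] [NormedSpace ℝ E] {H : Type*}
    [TopologicalSpace H] {I : ModelWithCorners ℝ E H} {N : Type*} [TopologicalSpace N]
    [ChartedSpace H N] {ι : Type} [Fintype ι]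
    (T : ∀ p : N, TangentSpace I p → TangentSpace I p → ℝ) (ψ : LocalCoord I N ι) {v ξ : ι → ℝ}
    {L : ℝ} (hL : 0 ≤ L) (hs : ∀ t ∈ Icc (0 : ℝ) 1, v + t • ξ ∈ ψ.source)
    (hT : ∀ t ∈ Icc (0 : ℝ) 1, T (ψ.toFun (v + t • ξ)) (ψ.frame (v + t • ξ) ξ)
      (ψ.frame (v + t • ξ) ξ) ≤ L ^ 2) :
    metricDist T (ψ.toFun v) (ψ.toFun (v + ξ)) ≤ ENNReal.ofReal L := by
  have hline : ContDiff ℝ ∞ fun t : ℝ => v + t • ξ := by fun_prop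
  have hsm : ContMDiffOn 𝓘(ℝ, ℝ) I 1 (fun t : ℝ => ψ.toFun (v + t • ξ)) (Icc 0 1) :=
    (ψ.smooth.of_le (by simp)).comp (hline.contMDiff.of_le (by simp)).contMDiffOn hs
  refine (iInf₂_le (fun t : ℝ => ψ.toFun (v + t • ξ)) ⟨hsm, by simp, by simp⟩).trans ?_
  have hd : ∀ t ∈ Icc (0 : ℝ) 1, mfderivWithin 𝓘(ℝ, ℝ) I (fun t : ℝ => ψ.toFun (v + t • ξ))
      (Icc 0 1) t (1 : ℝ) = ψ.frame (v + t • ξ) ξ := by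
    intro t ht
    have h1 : HasFDerivAt (fun t : ℝ => v + t • ξ)
        ((ContinuousLinearMap.id ℝ ℝ).smulRight ξ) t := by
      simpa using ((hasFDerivAt_id (𝕜 := ℝ) t).smul_const ξ).const_add v
    have h2 := ((ψ.mdifferentiableAt (hs t ht)).hasMFDerivAt.comp t h1.hasMFDerivAt)
    have h3 := h2.hasMFDerivWithinAt (s := Icc (0 : ℝ) 1) |>.mfderivWithin
      ((uniqueDiffOn_Icc one_pos).uniqueMDiffOn t ht)
    refine (DFunLike.congr_fun h3 (1 : ℝ)).trans ?_
    have : ((ContinuousLinearMap.id ℝ ℝ).smulRight ξ) (1 : ℝ) = ξ := by simp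
    exact congrArg (ψ.frame (v + t • ξ)) this
  calc _ ≤ ∫⁻ _t in Icc (0 : ℝ) 1, ENNReal.ofReal L := by
        refine setLIntegral_mono' measurableSet_Icc fun t ht => ENNReal.ofReal_le_ofReal ?_
        rw [hd t ht]
        exact Real.sqrt_le_iff.2 ⟨hL, hT t ht⟩
    _ = _ := by simp

variable [IsManifold (𝓡∂ (b + n + 1)) ∞ M] [IsManifold (𝓡 (b + n)) ∞ Y] [IsManifold (𝓡 b) ∞ B]
  {S : EdgeSpace b n M Y B F}

namespace EdgeMetric

variable {G : EdgeMetric S} {κ : LocalCoord (𝓡 (b + n)) Y (Fin b ⊕ Fin n)}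

/-- A Hölder function is locally constant along the fibres of the boundary, as their diameter
vanishes. -/
theorem MemHolder.eventually_eq {α : ℝ} (hα : 0 < α) {f : M → ℝ} (hf : G.MemHolder α f)
    (hκ : IsFibredCoord S.proj κ) {q₀ : Y} (hq₀ : q₀ ∈ κ.target) :
    ∀ᶠ q in 𝓝 q₀, S.proj q = S.proj q₀ → f (S.collar (0, q)) = f (S.collar (0, q₀)) := by
  obtain ⟨c, -, C, hC, hev⟩ := G.exists_comparison_at hκ hq₀
  obtain ⟨β, hβ⟩ := hκ
  obtain ⟨r, hr, hball⟩ := Metric.eventually_nhds_iff.1 hev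
  have hc : ContinuousAt κ.invFun q₀ := (κ.contMDiffAt_inv hq₀).continuousAt
  filter_upwards [κ.open_target.mem_nhds hq₀, hc.preimage_mem_nhds (Metric.ball_mem_nhds _ hr)]
    with q hq hqr hproj
  obtain ⟨hfc, Cα, hα'⟩ := hf
  set ζ : Fin b ⊕ Fin n → ℝ := κ.invFun q - κ.invFun q₀ with hζ
  set ξ : Unit ⊕ Fin b ⊕ Fin n → ℝ := Sum.elim (fun _ => 0) ζ with hξ
  -- Two points of one fibre have the same `y`-coordinates.
  have hζ0 : ∀ i, ζ (Sum.inl i) = 0 := by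
    have h1 := hβ _ (κ.inv_mem hq)
    have h2 := hβ _ (κ.inv_mem hq₀)
    rw [κ.toFun_inv hq] at h1
    rw [κ.toFun_inv hq₀, ← hproj, h1.2] at h2
    have h3 := congrArg β.invFun h2.2
    rw [β.inv_toFun h1.1, β.inv_toFun h2.1] at h3
    exact fun i => sub_eq_zero.2 (congrFun h3 i)
  set D : ℝ := √(C * ∑ i, ξ i ^ 2) with hD
  have hpt : ∀ x : ℝ, chartPoint κ (x, q₀) + ξ = chartPoint κ (x, q) := fun x => by
    funext i
    rcases i with i | i <;> simp [chartPoint, hξ, hζ]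
  -- The segment at height `x` between the two points moves in the `z`-directions only, where `g ≤ C
  -- x² |·|²`, so its length is at most `x D`. As `x → 0` the Hölder bound tends to zero.
  have hdist : ∀ x ∈ Ioo 0 (min r 1),
      |f (S.collar (x, q₀)) - f (S.collar (x, q))| ≤ Cα * (x * D) ^ α := by
    intro x hx
    have hx0 := hx.1
    have hxr : x < r := hx.2.trans_le (min_le_left _ _)
    have hv : ∀ t ∈ Icc (0 : ℝ) 1, dist (chartPoint κ (x, q₀) + t • ξ) (chartPoint κ (0, q₀)) < r ∧
        (chartPoint κ (x, q₀) + t • ξ) (Sum.inl ()) = x := by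
      intro t ht
      refine ⟨(dist_pi_lt_iff hr).2 fun i => ?_, by simp [chartPoint, hξ]⟩
      rcases i with i | i
      · simpa [chartPoint, hξ, abs_of_pos hx0] using hxr
      · have h1 := (dist_pi_lt_iff hr).1 hqr i
        have h2 : |t * ζ i| ≤ |ζ i| := by
          rw [abs_mul, abs_of_nonneg ht.1]
          exact mul_le_of_le_one_left (abs_nonneg _) ht.2
        rw [Real.dist_eq] at h1
        have h3 : |t * ζ i| < r := h2.trans_lt h1
        simpa [chartPoint, hξ, Real.dist_eq] using h3
    have hlen := metricDist_le_of_segment G.tensor (S.edgeLocalCoord κ) (v := chartPoint κ (x, q₀))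
      (ξ := ξ) (L := x * D) (by positivity)
      (fun t ht => (hball (hv t ht).1 (by rw [(hv t ht).2]; exact hx0)).1) (fun t ht => by
        have h1 := ((hball (hv t ht).1 (by rw [(hv t ht).2]; exact hx0)).2 ξ).2
        refine h1.trans (le_of_eq ?_)
        have e : ∀ i, (edgeFactor (chartPoint κ (x, q₀) + t • ξ) i * ξ i) ^ 2 =
            x ^ 2 * ξ i ^ 2 := fun i => by
          rw [mul_pow]
          rcases i with i | i | i
          · simp [hξ]
          · simp [hξ, hζ0]
          · exact congrArg (fun y => y ^ 2 * ξ (Sum.inr (Sum.inr i)) ^ 2) (hv t ht).2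
        rw [mul_pow, Real.sq_sqrt (mul_nonneg hC.le (Finset.sum_nonneg fun _ _ => sq_nonneg _)),
          Finset.sum_congr rfl fun i _ => e i, ← Finset.mul_sum]
        ring)
    rw [hpt] at hlen
    have e1 : (S.edgeLocalCoord κ).toFun (chartPoint κ (x, q₀)) = S.collar (x, q₀) :=
      edgeCoord_chartPoint S hq₀
    have e2 : (S.edgeLocalCoord κ).toFun (chartPoint κ (x, q)) = S.collar (x, q) :=
      edgeCoord_chartPoint S hq
    rw [e1, e2] at hlen
    have h2 := (hα' _ (mem_univ (S.collar (x, q₀))) _ (mem_univ (S.collar (x, q)))).trans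
      (mul_le_mul_right (ENNReal.rpow_le_rpow hlen hα.le) _)
    rw [ENNReal.ofReal_rpow_of_nonneg (by positivity) hα.le, ← ENNReal.ofReal_coe_nnreal,
      ← ENNReal.ofReal_mul Cα.coe_nonneg] at h2
    exact (ENNReal.ofReal_le_ofReal_iff (by positivity)).1 h2
  have hlim : ∀ q : Y, Tendsto (fun x => f (S.collar (x, q))) (𝓝[>] 0) (𝓝 (f (S.collar (0, q)))) := by
    intro q
    have h1 : ContinuousWithinAt S.collar (Ico (0 : ℝ) 1 ×ˢ univ) (0, q) :=
      S.collar_smooth.continuousOn _ ⟨⟨le_rfl, one_pos⟩, mem_univ _⟩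
    refine ((continuousOn_univ.1 hfc).tendsto _).comp (h1.tendsto.comp
      (tendsto_nhdsWithin_iff.2 ⟨?_, ?_⟩))
    · exact (Continuous.tendsto' (by fun_prop) _ _ rfl).mono_left nhdsWithin_le_nhds
    · filter_upwards [Ioo_mem_nhdsGT (zero_lt_one' ℝ)] with x hx
      exact ⟨Ioo_subset_Ico_self hx, mem_univ _⟩
  have hr0 : Tendsto (fun x : ℝ => (Cα : ℝ) * (x * D) ^ α) (𝓝[>] 0) (𝓝 0) := by
    have hc : Continuous fun x : ℝ => (Cα : ℝ) * (x * D) ^ α :=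
      continuous_const.mul ((continuous_id.mul continuous_const).rpow_const fun _ => Or.inr hα.le)
    have := hc.tendsto 0
    rw [zero_mul, Real.zero_rpow hα.ne', mul_zero] at this
    exact this.mono_left nhdsWithin_le_nhds
  have h := le_of_tendsto_of_tendsto ((hlim q₀).sub (hlim q)).abs hr0
    (eventually_of_mem (Ioo_mem_nhdsGT (by positivity)) hdist)
  exact (sub_eq_zero.1 (abs_nonpos_iff.1 h)).symm

end EdgeMetric

end FibreConstancy

/-! ### Consequences of bounded gradients -/

section BoundaryEstimates

open Filter Topology

theorem differential_sum_sq {E : Type*} [NormedAddCommGroup E] [NormedSpace ℝ E] {H : Type*}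
    [TopologicalSpace H] {I : ModelWithCorners ℝ E H} {N : Type*} [TopologicalSpace N]
    [ChartedSpace H N] {J : Type*} {Φ : J → N → ℝ} {p : N} (t : Finset J)
    (hΦ : ∀ j ∈ t, MDifferentiableAt I 𝓘(ℝ, ℝ) (Φ j) p) (ξ : TangentSpace I p) :
    MDifferentiableAt I 𝓘(ℝ, ℝ) (fun p => ∑ j ∈ t, Φ j p ^ 2) p ∧
      differential (fun p => ∑ j ∈ t, Φ j p ^ 2) p ξ =
        2 * ∑ j ∈ t, Φ j p * differential (Φ j) p ξ := by
  classical
  induction t using Finset.induction_on with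
  | empty =>
    simp only [Finset.sum_empty, mul_zero]
    exact ⟨mdifferentiableAt_const, DFunLike.congr_fun
      (hasMFDerivAt_const (I := I) (I' := 𝓘(ℝ, ℝ)) (0 : ℝ) p).mfderiv ξ⟩
  | insert a t ha ih =>
    obtain ⟨h1, h2⟩ := ih fun j hj => hΦ j (Finset.mem_insert_of_mem hj)
    have h3 := (hΦ a (Finset.mem_insert_self a t)).hasMFDerivAt
    have h4 := (h3.mul h3).add h1.hasMFDerivAt
    have e : (fun p => ∑ j ∈ insert a t, Φ j p ^ 2) =
        Φ a * Φ a + fun p => ∑ j ∈ t, Φ j p ^ 2 := by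
      funext p
      simp [Finset.sum_insert ha, sq]
    rw [e]
    refine ⟨h4.mdifferentiableAt, (DFunLike.congr_fun h4.mfderiv ξ).trans ?_⟩
    rw [Finset.sum_insert ha, mul_add, ← h2, two_mul]
    rfl

variable {b n : ℕ}
  {M : Type*} [TopologicalSpace M] [ChartedSpace (EuclideanHalfSpace (b + n + 1)) M]
  {Y : Type*} [TopologicalSpace Y] [ChartedSpace (EuclideanSpace ℝ (Fin (b + n))) Y]
  {B : Type*} [TopologicalSpace B] [ChartedSpace (EuclideanSpace ℝ (Fin b)) B]
  {F : Type*} [TopologicalSpace F] [ChartedSpace (EuclideanSpace ℝ (Fin n)) F]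
  [IsManifold (𝓡∂ (b + n + 1)) ∞ M] [IsManifold (𝓡 (b + n)) ∞ Y] [IsManifold (𝓡 b) ∞ B]
  {S : EdgeSpace b n M Y B F}

namespace EdgeMetric

variable {G : EdgeMetric S} {κ : LocalCoord (𝓡 (b + n)) Y (Fin b ⊕ Fin n)}

/-- Functions with bounded gradient are Lipschitz in adapted coordinates at a boundary point. -/
theorem BoundedGradient.lipschitz_at {Φ : M → ℝ} (hΦ : G.BoundedGradient Φ)
    (hd : ∀ x ∈ Ioo (0 : ℝ) 1, ∀ q, MDifferentiableAt (𝓡∂ (b + n + 1)) 𝓘(ℝ, ℝ) Φ (S.collar (x, q)))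
    (hκ : IsFibredCoord S.proj κ) {q : Y} (hq : q ∈ κ.target)
    (hc : ContinuousAt Φ (S.collar (0, q))) :
    ∃ L : ℝ, 0 ≤ L ∧ ∀ᶠ v in 𝓝 (chartPoint κ (0, q)), 0 < v (Sum.inl ()) →
      |Φ (edgeCoord S κ v) - Φ (S.collar (0, q))| ≤ L * dist v (chartPoint κ (0, q)) := by
  obtain ⟨c, -, C, hC, hev⟩ := G.exists_comparison_at hκ hq
  obtain ⟨C', hC', δ, hδ, -, hgrad⟩ := hΦ
  set v₀ := chartPoint κ (0, q) with hv₀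
  obtain ⟨r₀, hr₀, hball₀⟩ := Metric.eventually_nhds_iff.1 hev
  obtain ⟨r, hr, hrr, hrδ⟩ : ∃ r > 0, r ≤ r₀ ∧ r ≤ δ :=
    ⟨min r₀ δ, by positivity, min_le_left _ _, min_le_right _ _⟩
  set d : ℝ := (Fintype.card (Unit ⊕ Fin b ⊕ Fin n) : ℝ) with hdd
  set L : ℝ := √(C' * (C * d)) with hL
  -- A convex half-ball on which the mean value inequality applies. The centre `v₀` itself lies on
  -- its boundary and is approached at the end along the points `(x, q)`, `x → 0`.
  set Ω : Set (Unit ⊕ Fin b ⊕ Fin n → ℝ) := Metric.ball v₀ r ∩ {v | 0 < v (Sum.inl ())} with hΩ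
  have hconv : Convex ℝ Ω := (convex_ball v₀ r).inter
    (convex_halfSpace_gt (f := fun v : Unit ⊕ Fin b ⊕ Fin n → ℝ => v (Sum.inl ()))
      ⟨fun _ _ => rfl, fun _ _ => rfl⟩ 0)
  have hΩs : ∀ v ∈ Ω, v ∈ EdgeSpace.edgeSource κ := fun v hv =>
    (hball₀ (lt_of_lt_of_le hv.1 hrr) hv.2).1
  have hsm : ∀ v ∈ Ω, MDifferentiableAt (𝓡∂ (b + n + 1)) 𝓘(ℝ, ℝ) Φ
      ((S.edgeLocalCoord κ).toFun v) := fun v hv => hd _ (hΩs v hv).1 _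
  have hdiff : ∀ v ∈ Ω, DifferentiableAt ℝ (fun w => Φ ((S.edgeLocalCoord κ).toFun w)) v :=
    fun v hv => mdifferentiableAt_iff_differentiableAt.1
      ((hsm v hv).comp v ((S.edgeLocalCoord κ).mdifferentiableAt (hΩs v hv)))
  have hbound : ∀ v ∈ Ω, ‖fderiv ℝ (fun w => Φ ((S.edgeLocalCoord κ).toFun w)) v‖ ≤ L := by
    intro v hv
    have hvs := hΩs v hv
    refine ContinuousLinearMap.opNorm_le_bound _ (Real.sqrt_nonneg _) fun ξ => ?_
    have h0 : fderiv ℝ (fun w => Φ ((S.edgeLocalCoord κ).toFun w)) v ξ =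
        differential Φ (S.collar (v (Sum.inl ()), κ.toFun fun i => v (Sum.inr i)))
          ((S.edgeLocalCoord κ).frame v ξ) :=
      (S.edgeLocalCoord κ).fderiv_comp hvs (hsm v hv) ξ
    rw [h0, Real.norm_eq_abs]
    have hxδ : v (Sum.inl ()) < δ := by
      have h1 := (dist_pi_lt_iff hr).1 hv.1 (Sum.inl ())
      have h2 : v₀ (Sum.inl ()) = 0 := rfl
      rw [h2, Real.dist_eq, sub_zero] at h1
      exact ((le_abs_self _).trans_lt h1).trans_le hrδ
    have h1 := hgrad _ ⟨hv.2, hxδ⟩ (κ.toFun fun i => v (Sum.inr i))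
      ((S.edgeLocalCoord κ).frame v ξ)
    have h2 := ((hball₀ (lt_of_lt_of_le hv.1 hrr) hv.2).2 ξ).2
    have h3 : ∑ i, (edgeFactor v i * ξ i) ^ 2 ≤ d * ‖ξ‖ ^ 2 := by
      refine le_trans (Finset.sum_le_sum fun i _ => ?_) (sum_sq_le_norm_sq ξ)
      rw [mul_pow]
      refine mul_le_of_le_one_left (sq_nonneg _) ?_
      rcases i with i | i | i
      · simp [edgeFactor]
      · simp [edgeFactor]
      · exact pow_le_one₀ hvs.1.1.le hvs.1.2.le
    have h4 : differential Φ (S.collar (v (Sum.inl ()), κ.toFun fun i => v (Sum.inr i)))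
        ((S.edgeLocalCoord κ).frame v ξ) ^ 2 ≤ C' * (C * d) * ‖ξ‖ ^ 2 := by
      calc _ ≤ C' * (C * ∑ i, (edgeFactor v i * ξ i) ^ 2) :=
            h1.trans (mul_le_mul_of_nonneg_left h2 hC'.le)
        _ ≤ C' * (C * (d * ‖ξ‖ ^ 2)) := by gcongr
        _ = _ := by ring
    refine (Real.abs_le_sqrt h4).trans (le_of_eq ?_)
    rw [Real.sqrt_mul (by positivity), Real.sqrt_sq (norm_nonneg _)]
  refine ⟨L, Real.sqrt_nonneg _, ?_⟩
  filter_upwards [Metric.ball_mem_nhds v₀ hr] with v hv hv0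
  have hlim : Tendsto (fun x : ℝ => chartPoint κ (x, q)) (𝓝[>] 0) (𝓝 v₀) := by
    have h1 := (continuousAt_chartPoint (κ := κ) (a := ((0 : ℝ), q)) hq).tendsto
    exact (h1.comp (Continuous.tendsto' (f := fun x : ℝ => (x, q)) (by fun_prop) 0 _ rfl)).mono_left
      nhdsWithin_le_nhds
  have hlim2 : Tendsto (fun x : ℝ => chartPoint κ (x, q)) (𝓝[>] 0)
      (𝓝[{v | 0 < v (Sum.inl ())}] v₀) :=
    tendsto_nhdsWithin_iff.2 ⟨hlim, eventually_of_mem self_mem_nhdsWithin fun x hx => hx⟩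
  have hlimΦ : Tendsto (fun x : ℝ => Φ (edgeCoord S κ (chartPoint κ (x, q)))) (𝓝[>] 0)
      (𝓝 (Φ (S.collar (0, q)))) := hc.tendsto.comp ((tendsto_edgeCoord S hq).comp hlim2)
  refine le_of_tendsto_of_tendsto (hlimΦ.const_sub (Φ (edgeCoord S κ v))).abs
    ((tendsto_const_nhds (x := v)).dist hlim |>.const_mul L) ?_
  filter_upwards [hlim2 (inter_mem (nhdsWithin_le_nhds (Metric.ball_mem_nhds v₀ hr))
    self_mem_nhdsWithin)] with x hx
  have h := hconv.norm_image_sub_le_of_norm_fderiv_le (𝕜 := ℝ) hdiff hbound hx ⟨hv, hv0⟩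
  rw [← dist_eq_norm v] at h
  exact h

/-- The differential is `2 ∑ Φⱼ dΦⱼ`, and the Cauchy–Schwarz inequality separates `∑ Φⱼ²` from the
bounded sum of the `|dΦⱼ|²`. This is the gradient bound `|dρ|² ≤ Kρ` for barriers. -/
theorem BoundedGradient.sum_sq {J : Type*} [Fintype J] {Φ : J → M → ℝ}
    (hΦ : ∀ j, G.BoundedGradient (Φ j)) (hd : ∀ j, ∀ x ∈ Ioo (0 : ℝ) 1, ∀ q,
      MDifferentiableAt (𝓡∂ (b + n + 1)) 𝓘(ℝ, ℝ) (Φ j) (S.collar (x, q))) :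
    ∃ K ≥ 0, ∃ δ > 0, δ ≤ 1 ∧ ∀ x ∈ Ioo 0 δ, ∀ q, ∀ ξ : TangentSpace (𝓡∂ (b + n + 1))
      (S.collar (x, q)), differential (fun p => ∑ j, Φ j p ^ 2) (S.collar (x, q)) ξ ^ 2 ≤
        K * (∑ j, Φ j (S.collar (x, q)) ^ 2) * G.g (S.collar (x, q)) ξ ξ := by
  choose C hC δ hδ hδ1 h using hΦ
  have hev : ∀ᶠ x in 𝓝[>] (0 : ℝ), ∀ j, x ∈ Ioo 0 (δ j) :=
    eventually_all.2 fun j => Ioo_mem_nhdsGT (hδ j)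
  obtain ⟨ε, hε, hsub⟩ := (mem_nhdsGT_iff_exists_Ioo_subset).1 hev
  refine ⟨4 * ∑ j, C j, mul_nonneg (by norm_num) (Finset.sum_nonneg fun j _ => (hC j).le),
    min ε 1, lt_min hε one_pos, min_le_right _ _, fun x hx q => ?_⟩
  have hxj : ∀ j, x ∈ Ioo 0 (δ j) := hsub ⟨hx.1, hx.2.trans_le (min_le_left _ _)⟩
  have hx1 : x ∈ Ioo (0 : ℝ) 1 := ⟨hx.1, hx.2.trans_le (min_le_right _ _)⟩
  set p := S.collar (x, q) with hp
  intro ξ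
  have he := (differential_sum_sq Finset.univ (fun j _ => hd j x hx1 q) ξ).2
  have hcs := Finset.sum_mul_sq_le_sq_mul_sq Finset.univ (fun j => Φ j p)
    fun j => differential (Φ j) p ξ
  have hsum : ∑ j, differential (Φ j) p ξ ^ 2 ≤ (∑ j, C j) * G.g p ξ ξ := by
    rw [Finset.sum_mul]
    exact Finset.sum_le_sum fun j _ => h j x (hxj j) q ξ
  have h0 : 0 ≤ ∑ j, Φ j p ^ 2 := Finset.sum_nonneg fun j _ => sq_nonneg _
  rw [he, mul_pow]
  calc _ ≤ 2 ^ 2 * ((∑ j, Φ j p ^ 2) * ((∑ j, C j) * G.g p ξ ξ)) := by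
        gcongr
        exact hcs.trans (by gcongr)
    _ = _ := by ring

theorem BoundedGradient.abs_pairing_le {u Φ : M → ℝ} (hu : G.BoundedGradient u)
    (hΦ : G.BoundedGradient Φ)
    (hu1 : ContMDiffOn (𝓡∂ (b + n + 1)) 𝓘(ℝ, ℝ) 1 u ((𝓡∂ (b + n + 1)).interior M))
    (hcov : ∀ p ∈ (𝓡∂ (b + n + 1)).interior M,
      ∃ ψ : LocalCoord (𝓡∂ (b + n + 1)) M (Unit ⊕ Fin b ⊕ Fin n), p ∈ ψ.target) :
    ∃ C ≥ 0, ∃ δ > 0, δ ≤ 1 ∧ ∀ x ∈ Ioo 0 δ, ∀ q,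
      |G.interiorMetric.pairing u Φ (S.collar (x, q))| ≤ C := by
  obtain ⟨C, hC, δ, hδ, hδ1, h⟩ := hu
  obtain ⟨C', hC', δ', hδ', -, h'⟩ := hΦ
  refine ⟨√(C' * C), Real.sqrt_nonneg _, min δ δ', by positivity, (min_le_left _ _).trans hδ1,
    fun x hx q => Real.abs_le_sqrt ?_⟩
  have hxδ : x ∈ Ioo 0 δ := ⟨hx.1, hx.2.trans_le (min_le_left _ _)⟩
  have hxδ' : x ∈ Ioo 0 δ' := ⟨hx.1, hx.2.trans_le (min_le_right _ _)⟩
  have hint := S.collar_mem_interior ⟨hx.1, hxδ.2.trans_le hδ1⟩ q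
  have hmd := (hu1.contMDiffAt (((𝓡∂ (b + n + 1)).isOpen_interior (n := ∞) (by simp)).mem_nhds
    hint)).mdifferentiableAt one_ne_zero
  have h1 := h x hxδ q (G.interiorMetric.grad u (S.collar (x, q)))
  have h2 := h' x hxδ' q (G.interiorMetric.grad u (S.collar (x, q)))
  have h3 : differential u (S.collar (x, q)) (G.interiorMetric.grad u (S.collar (x, q))) =
    G.g (S.collar (x, q)) (G.interiorMetric.grad u (S.collar (x, q)))
      (G.interiorMetric.grad u (S.collar (x, q))) :=
    InteriorMetric.pairing_self (m := G.interiorMetric) hcov hint hmd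
  rw [h3] at h1
  set s := G.g (S.collar (x, q)) (G.interiorMetric.grad u (S.collar (x, q)))
      (G.interiorMetric.grad u (S.collar (x, q)))
  -- With `ξ = ∇u` the bound for `du` reads `s² ≤ C s`, where `s = |∇u|²`.
  have hs : s ≤ C := by
    by_contra hlt
    push Not at hlt
    nlinarith
  exact h2.trans (by gcongr)

end EdgeMetric

end BoundaryEstimates

/-! ### Barrier and cut-off functions at the boundary -/

section BoundaryPoint

open Filter Topology

variable {b n : ℕ}
  {M : Type*} [TopologicalSpace M] [ChartedSpace (EuclideanHalfSpace (b + n + 1)) M]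
  {Y : Type*} [TopologicalSpace Y] [ChartedSpace (EuclideanSpace ℝ (Fin (b + n))) Y]
  {B : Type*} [TopologicalSpace B] [ChartedSpace (EuclideanSpace ℝ (Fin b)) B]
  {F : Type*} [TopologicalSpace F] [ChartedSpace (EuclideanSpace ℝ (Fin n)) F]

/-- A closed manifold carries finitely many smooth functions whose only common zero is `y₀`. -/
theorem exists_smooth_common_zero [IsManifold (𝓡 b) ∞ B] [T2Space B] [CompactSpace B] (y₀ : B) :
    ∃ (k : ℕ) (h : Fin k → B → ℝ), (∀ i, ContMDiff (𝓡 b) 𝓘(ℝ, ℝ) ∞ (h i)) ∧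
      ∀ y, (∀ i, h i y = 0) ↔ y = y₀ := by
  -- The functions are the components of an embedding into Euclidean space, shifted to vanish at
  -- `y₀`.
  obtain ⟨k, e, he, hemb, -⟩ := exists_embedding_euclidean_of_compact (I := 𝓡 b) (M := B)
  refine ⟨k, fun i y => e y i - e y₀ i, fun i => ?_, fun y => ⟨fun hy => ?_, ?_⟩⟩
  · exact ((EuclideanSpace.proj (𝕜 := ℝ) i).contDiff.contMDiff.comp he).sub contMDiff_const
  · refine hemb.injective ?_
    ext i
    exact sub_eq_zero.1 (hy i)
  · rintro rfl i
    exact sub_self _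

namespace EdgeSpace

variable (S : EdgeSpace b n M Y B F)

theorem continuous_collar_zero : Continuous fun q : Y => S.collar (0, q) := by
  rw [← continuousOn_univ]
  exact S.collar_smooth.continuousOn.comp (by fun_prop) fun q _ => ⟨⟨le_rfl, one_pos⟩, mem_univ _⟩

theorem eq_collar {p : M} (hp : p ∈ S.collar '' (Ico (0 : ℝ) 1 ×ˢ univ)) :
    p = S.collar (S.radius p, (S.collarInv p).2) := (S.collar_collarInv hp).symm

/-- A function on the collar that vanishes exactly on a fibre of the boundary has small sublevel
sets. -/
theorem exists_sublevel_subset [CompactSpace Y] {ρ : M → ℝ} {y₀ : B}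
    (hρ : ContinuousOn ρ (S.collar '' (Ico (0 : ℝ) 1 ×ˢ univ)))
    (hx : ∀ x ∈ Ico (0 : ℝ) 1, ∀ q, x ^ 2 ≤ ρ (S.collar (x, q)))
    (h0 : ∀ q, ρ (S.collar (0, q)) = 0 → S.proj q = y₀) {V : Set M} (hV : IsOpen V)
    (hVy : ∀ q, S.proj q = y₀ → S.collar (0, q) ∈ V) {δ : ℝ} (hδ : 0 < δ) (hδ1 : δ < 1) :
    ∃ r > 0, ∀ x ∈ Ico (0 : ℝ) 1, ∀ q, ρ (S.collar (x, q)) < r → x < δ ∧ S.collar (x, q) ∈ V := by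
  have hsub : Icc (0 : ℝ) δ ×ˢ (univ : Set Y) ⊆ Ico (0 : ℝ) 1 ×ˢ univ :=
    prod_mono (fun x hx => ⟨hx.1, hx.2.trans_lt hδ1⟩) subset_rfl
  have hc : ContinuousOn S.collar (Icc (0 : ℝ) δ ×ˢ univ) := S.collar_smooth.continuousOn.mono hsub
  have hcl := hc.preimage_isClosed_of_isClosed (isClosed_Icc.prod isClosed_univ) hV.isClosed_compl
  have hcomp : IsCompact (Icc (0 : ℝ) δ ×ˢ (univ : Set Y) ∩ S.collar ⁻¹' Vᶜ) :=
    (isCompact_Icc.prod isCompact_univ).of_isClosed_subset hcl inter_subset_left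
  have hρc : ContinuousOn (fun a => ρ (S.collar a))
      (Icc (0 : ℝ) δ ×ˢ (univ : Set Y) ∩ S.collar ⁻¹' Vᶜ) :=
    hρ.comp (hc.mono inter_subset_left) fun a ha => mem_image_of_mem _ (hsub ha.1)
  -- On the compact part of the collar outside `V` the function `ρ` is positive: a zero would have
  -- `x = 0` by `x² ≤ ρ`, would lie on the fibre over `y₀`, and hence in `V`.
  obtain ⟨r, hr, hmin⟩ : ∃ r > 0, ∀ a ∈ Icc (0 : ℝ) δ ×ˢ (univ : Set Y) ∩ S.collar ⁻¹' Vᶜ,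
      r ≤ ρ (S.collar a) := by
    rcases (Icc (0 : ℝ) δ ×ˢ (univ : Set Y) ∩ S.collar ⁻¹' Vᶜ).eq_empty_or_nonempty with he | hne
    · exact ⟨1, one_pos, fun a ha => by rw [he] at ha; exact absurd ha (notMem_empty a)⟩
    · obtain ⟨a, ha, hmin⟩ := hcomp.exists_isMinOn hne hρc
      refine ⟨_, ?_, fun a' ha' => hmin ha'⟩
      obtain ⟨x, q⟩ := a
      have hx1 := hx x (hsub ha.1).1 q
      refine lt_of_le_of_ne ((sq_nonneg x).trans hx1) fun h => ha.2 ?_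
      have hx0 : x = 0 := by
        have h' : 0 = ρ (S.collar (x, q)) := h
        rw [← h'] at hx1
        exact pow_eq_zero_iff two_ne_zero |>.1 (le_antisymm hx1 (sq_nonneg x))
      subst hx0
      exact hVy q (h0 q h.symm)
  refine ⟨min r (δ ^ 2), by positivity, fun x hx01 q hlt => ?_⟩
  have hxδ : x < δ := by
    refine lt_of_pow_lt_pow_left₀ 2 hδ.le ?_
    exact (hx x hx01 q).trans_lt (hlt.trans_le (min_le_right _ _))
  refine ⟨hxδ, by_contra fun hV' => ?_⟩
  have := hmin (x, q) ⟨⟨⟨hx01.1, hxδ.le⟩, mem_univ _⟩, hV'⟩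
  exact absurd (hlt.trans_le (min_le_left _ _)) (not_lt.2 this)

end EdgeSpace

variable [IsManifold (𝓡∂ (b + n + 1)) ∞ M] [IsManifold (𝓡 (b + n)) ∞ Y] [IsManifold (𝓡 b) ∞ B]
  {S : EdgeSpace b n M Y B F}

namespace EdgeMetric

variable {G : EdgeMetric S}

variable (G) in
-- The functions are the radius and pull-backs of functions on the base. Functions of the fibre
-- variable are avoided, as `x⁻¹∂_z` of them would be unbounded; hence the common zero set is a
-- whole fibre and not a point.
theorem exists_barrier [CompactSpace Y] [T2Space B] [CompactSpace B]
    (hfib : ∀ q : Y, ∃ κ : LocalCoord (𝓡 (b + n)) Y (Fin b ⊕ Fin n), IsFibredCoord S.proj κ ∧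
      q ∈ κ.target) (y₀ : B) :
    ∃ (k : ℕ) (Φ : Unit ⊕ Fin k → M → ℝ),
      (∀ j, ContMDiffOn (𝓡∂ (b + n + 1)) 𝓘(ℝ, ℝ) ∞ (Φ j) (S.collar '' (Ico (0 : ℝ) 1 ×ˢ univ))) ∧
      (∀ j, G.BoundedGradient (Φ j)) ∧
      (∀ x ∈ Ico (0 : ℝ) 1, ∀ q, x ^ 2 ≤ ∑ j, Φ j (S.collar (x, q)) ^ 2) ∧
      ∀ q, (∑ j, Φ j (S.collar (0, q)) ^ 2 = 0) ↔ S.proj q = y₀ := by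
  obtain ⟨k, h, hsm, hzero⟩ := exists_smooth_common_zero (b := b) y₀
  refine ⟨k, Sum.elim (fun _ => S.radius) fun i => S.pullback (h i), fun j => ?_, fun j => ?_,
    fun x hx q => ?_, fun q => ?_⟩
  · rcases j with j | j
    · exact S.contMDiffOn_radius
    · exact S.contMDiffOn_pullback (hsm j)
  · rcases j with j | j
    · exact G.boundedGradient_radius hfib
    · exact G.boundedGradient_pullback hfib (hsm j)
  · simp only [Fintype.sum_sum_type, Sum.elim_inl, Sum.elim_inr, S.radius_collar hx]
    have : 0 ≤ ∑ i, S.pullback (h i) (S.collar (x, q)) ^ 2 :=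
      Finset.sum_nonneg fun _ _ => sq_nonneg _
    simpa using this
  · have h0 : (0 : ℝ) ∈ Ico (0 : ℝ) 1 := ⟨le_rfl, one_pos⟩
    simp only [Fintype.sum_sum_type, Sum.elim_inl, Sum.elim_inr, S.radius_collar h0,
      S.pullback_collar _ h0]
    rw [← hzero]
    rw [zero_pow two_ne_zero, Finset.sum_const_zero, zero_add,
      Finset.sum_eq_zero_iff_of_nonneg fun _ _ => sq_nonneg _]
    simp

variable [MeasurableSpace M] [BorelSpace M] {μ : Measure M}

/-- Cut-off functions near the boundary, depending on the radius only. -/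
theorem exists_cutoffSequence [CompactSpace Y] [T2Space M]
    {u : M → ℝ} {R s : Set M} {δ : ℝ} (hδ1 : δ < 1) {C : ℝ} (hC : 0 ≤ C)
    (hpair : ∀ x ∈ Ioo 0 δ, ∀ q, |G.interiorMetric.pairing u S.radius (S.collar (x, q))| ≤ C)
    {Cv δv : ℝ} (hδv : 0 < δv) (hvol : ∀ t, 0 < t → t ≤ δv →
      μ (S.collar '' (Ioo 0 t ×ˢ univ)) ≤ ENNReal.ofReal (Cv * t ^ 2)) (hCv : 0 ≤ Cv)
    (hR : IsOpen R) (hRU : R ⊆ S.collar '' (Ico (0 : ℝ) 1 ×ˢ univ))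
    (hRδ : ∀ p ∈ R, S.radius p < δ) (hRfin : μ R < ⊤) (hsR : s ⊆ R) :
    Nonempty (InteriorMetric.CutoffSequence G.interiorMetric μ u R s) := by
  have hrad : ContinuousOn S.radius R := S.contMDiffOn_radius.continuousOn.mono hRU
  have hcd : ContDiff ℝ ∞ Real.smoothTransition := Real.smoothTransition.contDiff
  obtain ⟨D, hD⟩ := (isCompact_Icc (a := (-1 : ℝ)) (b := 2)).exists_bound_of_continuousOn
    ((hcd.continuous_deriv (by simp)).continuousOn)
  have hpos : ∀ p ∈ R ∩ (𝓡∂ (b + n + 1)).interior M, S.radius p ∈ Ioo 0 δ := fun p hp =>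
    ⟨S.collarInv_pos_of_interior (hRU hp.1) hp.2, hRδ p hp.1⟩
  have hmd : ∀ p ∈ R, MDifferentiableAt (𝓡∂ (b + n + 1)) 𝓘(ℝ, ℝ) S.radius p := fun p hp =>
    (S.contMDiffOn_radius.contMDiffAt (S.isOpen_collar.mem_nhds (hRU hp))).mdifferentiableAt
      (by simp)
  have hAo : ∀ k : ℕ, IsOpen (R ∩ S.radius ⁻¹' Ioo 0 (3 / (k + 1))) := fun k =>
    hrad.isOpen_inter_preimage hR isOpen_Ioo
  have hD0 : 0 ≤ D := (norm_nonneg _).trans (hD 0 ⟨by norm_num, by norm_num⟩)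
  refine ⟨{
    -- The cut-off is `0` for `x ≤ 1/(k+1)` and `1` for `x ≥ 2/(k+1)`.
    θ := fun k p => Real.smoothTransition ((k + 1) * S.radius p - 1)
    contMDiffOn := fun k => ?_
    nonneg := fun k p => Real.smoothTransition.nonneg _
    le_one := fun k p => Real.smoothTransition.le_one _
    tendsto_one := fun p hp => ?_
    K := fun k => S.collar '' (Icc (1 / ((k : ℝ) + 1)) δ ×ˢ univ)
    isClosed_K := fun k => ?_
    K_subset := fun k => ?_
    eq_zero := fun k p hp hpK => ?_
    -- With `3` in place of `2` the cut-off is constant near every point of `R` in the interior that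
    -- is outside this set. On the set the argument of `smoothTransition` is in `[-1, 2]`, where `D`
    -- bounds its derivative.
    A := fun k => R ∩ S.radius ⁻¹' Ioo 0 (3 / (k + 1))
    measurableSet_A := fun k => (hAo k).measurableSet
    A_lt_top := fun k => lt_of_le_of_lt (measure_mono inter_subset_left) hRfin
    b := fun k => D * (k + 1) * C
    b_nonneg := fun k => by positivity
    pairing_le := fun k p hp => ?_
    tendsto_zero := ?_ }⟩
  · have h1 : ContDiff ℝ 1 fun t : ℝ => Real.smoothTransition ((k + 1) * t - 1) :=
      (hcd.of_le (by simp)).comp (by fun_prop)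
    exact h1.contMDiff.comp_contMDiffOn
      ((S.contMDiffOn_radius.of_le (by simp)).mono (inter_subset_left.trans hRU))
  · have hp0 := (hpos p ⟨hsR hp.1, hp.2⟩).1
    refine tendsto_const_nhds.congr' ?_
    have h1 : Tendsto (fun k : ℕ => ((k : ℝ) + 1) * S.radius p) atTop atTop :=
      (tendsto_natCast_atTop_atTop.atTop_add tendsto_const_nhds).atTop_mul_const hp0
    filter_upwards [h1.eventually_ge_atTop 2] with k hk
    exact (Real.smoothTransition.one_of_one_le (by linarith)).symm
  · have hsub : Icc (1 / ((k : ℝ) + 1)) δ ×ˢ (univ : Set Y) ⊆ Ico (0 : ℝ) 1 ×ˢ univ :=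
      prod_mono (fun x hx => ⟨le_trans (by positivity) hx.1, hx.2.trans_lt hδ1⟩) subset_rfl
    exact ((isCompact_Icc.prod isCompact_univ).image_of_continuousOn
      (S.collar_smooth.continuousOn.mono hsub)).isClosed
  · rintro _ ⟨-, ⟨⟨x, q⟩, ⟨hx, -⟩, rfl⟩⟩
    exact S.collar_mem_interior ⟨lt_of_lt_of_le (by positivity) hx.1, hx.2.trans_lt hδ1⟩ q
  · have hlt : S.radius p < 1 / ((k : ℝ) + 1) := by
      by_contra hge
      exact hpK ⟨(S.radius p, (S.collarInv p).2), ⟨⟨not_lt.1 hge, (hRδ p (hsR hp)).le⟩,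
        mem_univ _⟩, (S.eq_collar (hRU (hsR hp))).symm⟩
    rw [lt_div_iff₀ (by positivity)] at hlt
    exact Real.smoothTransition.zero_of_nonpos (by linarith)
  · have hp' := hpos p hp
    have hk : (0 : ℝ) < (k : ℝ) + 1 := by positivity
    by_cases hpA : p ∈ R ∩ S.radius ⁻¹' Ioo 0 (3 / ((k : ℝ) + 1))
    · rw [indicator_of_mem hpA]
      have h1 : HasDerivAt (fun t : ℝ => Real.smoothTransition ((k + 1) * t - 1))
          (deriv Real.smoothTransition ((k + 1) * S.radius p - 1) * (k + 1)) (S.radius p) := by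
        have h2 : HasDerivAt (fun t : ℝ => ((k : ℝ) + 1) * t - 1) ((k : ℝ) + 1) (S.radius p) := by
          simpa using ((hasDerivAt_id (S.radius p)).const_mul ((k : ℝ) + 1)).sub_const 1
        exact ((hcd.differentiable (by simp)) _).hasDerivAt.comp (S.radius p) h2
      rw [G.interiorMetric.pairing_comp u h1 (hmd p hp.1), abs_mul, abs_mul, abs_of_pos hk]
      have hx3 := hpA.2.2
      rw [lt_div_iff₀ hk] at hx3
      have hkx : 0 < ((k : ℝ) + 1) * S.radius p := mul_pos hk hp'.1
      have h3 := hD (((k : ℝ) + 1) * S.radius p - 1) ⟨by linarith, by linarith⟩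
      rw [Real.norm_eq_abs] at h3
      have h4 := hpair _ hp' (S.collarInv p).2
      rw [← S.eq_collar (hRU hp.1)] at h4
      gcongr
    · rw [indicator_of_notMem hpA]
      have hge : 3 / ((k : ℝ) + 1) ≤ S.radius p := by
        by_contra hlt
        exact hpA ⟨hp.1, hp'.1, not_le.1 hlt⟩
      rw [div_le_iff₀ hk] at hge
      have hev : (fun p => Real.smoothTransition ((k + 1) * S.radius p - 1)) =ᶠ[𝓝 p]
          fun _ => (1 : ℝ) := by
        have hca : ContinuousAt (fun p => ((k : ℝ) + 1) * S.radius p - 1) p :=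
          (continuousAt_const.mul (hrad.continuousAt (hR.mem_nhds hp.1))).sub continuousAt_const
        filter_upwards [hca.eventually (Ioi_mem_nhds (show 1 < ((k : ℝ) + 1) * S.radius p - 1 by
          linarith))] with p' hp1
        exact Real.smoothTransition.one_of_one_le (le_of_lt hp1)
      rw [G.interiorMetric.pairing_congr u hev,
        G.interiorMetric.pairing_of_hasMFDerivAt u (D := 0) (hasMFDerivAt_const _ _)]
      simp
  -- Gradient times volume: `D (k+1) C · Cv (3/(k+1))² = 9 D C Cv / (k+1)`.
  · have hlim : Tendsto (fun k : ℕ => 9 * D * C * Cv * (1 / ((k : ℝ) + 1))) atTop (𝓝 0) := by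
      simpa using tendsto_one_div_add_atTop_nhds_zero_nat.const_mul (9 * D * C * Cv)
    have h3 : Tendsto (fun k : ℕ => 3 / ((k : ℝ) + 1)) atTop (𝓝 0) := by
      have := (tendsto_one_div_add_atTop_nhds_zero_nat (𝕜 := ℝ)).const_mul 3
      simpa [div_eq_mul_inv] using this
    refine squeeze_zero' (Eventually.of_forall fun k => by positivity) ?_ hlim
    filter_upwards [h3.eventually (Iio_mem_nhds hδv)] with k hk
    have hk0 : (0 : ℝ) < (k : ℝ) + 1 := by positivity
    have hsub : R ∩ S.radius ⁻¹' Ioo 0 (3 / ((k : ℝ) + 1)) ⊆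
        S.collar '' (Ioo 0 (3 / ((k : ℝ) + 1)) ×ˢ univ) := fun p hp =>
      ⟨(S.radius p, (S.collarInv p).2), ⟨hp.2, mem_univ _⟩, (S.eq_collar (hRU hp.1)).symm⟩
    have hm : μ.real (R ∩ S.radius ⁻¹' Ioo 0 (3 / ((k : ℝ) + 1))) ≤
        Cv * (3 / ((k : ℝ) + 1)) ^ 2 := by
      refine ENNReal.toReal_le_of_le_ofReal (by positivity) ?_
      exact (measure_mono hsub).trans (hvol _ (by positivity) (le_of_lt hk))
    calc _ ≤ D * ((k : ℝ) + 1) * C * (Cv * (3 / ((k : ℝ) + 1)) ^ 2) := by gcongr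
      _ = _ := by field_simp; ring

end EdgeMetric

end BoundaryPoint

/-! ### Minima on the boundary -/

section BoundaryMinimum

open Filter Topology

variable {b n : ℕ}
  {M : Type*} [TopologicalSpace M] [ChartedSpace (EuclideanHalfSpace (b + n + 1)) M]
  {Y : Type*} [TopologicalSpace Y] [ChartedSpace (EuclideanSpace ℝ (Fin (b + n))) Y]
  {B : Type*} [TopologicalSpace B] [ChartedSpace (EuclideanSpace ℝ (Fin b)) B]
  {F : Type*} [TopologicalSpace F] [ChartedSpace (EuclideanSpace ℝ (Fin n)) F]
  [IsManifold (𝓡∂ (b + n + 1)) ∞ M] [IsManifold (𝓡 (b + n)) ∞ Y] [IsManifold (𝓡 b) ∞ B]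
  {S : EdgeSpace b n M Y B F}

namespace EdgeMetric

variable {G : EdgeMetric S}

/-- The part of a fibre of the boundary where a Hölder function takes a given value can be separated
from the rest of the fibre. -/
theorem MemHolder.exists_separation [CompactSpace Y] [T2Space M] [T2Space B] {α : ℝ} (hα : 0 < α)
    {f : M → ℝ} (hf : G.MemHolder α f)
    (hfib : ∀ q : Y, ∃ κ : LocalCoord (𝓡 (b + n)) Y (Fin b ⊕ Fin n), IsFibredCoord S.proj κ ∧
      q ∈ κ.target) (q₀ : Y) :
    ∃ O₁ O₂ : Set M, IsOpen O₁ ∧ IsOpen O₂ ∧ Disjoint O₁ O₂ ∧ S.collar (0, q₀) ∈ O₁ ∧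
      ∀ q, S.proj q = S.proj q₀ →
        f (S.collar (0, q)) = f (S.collar (0, q₀)) ∧ S.collar (0, q) ∈ O₁ ∨
          S.collar (0, q) ∈ O₂ := by
  have hfc : Continuous f := continuousOn_univ.1 hf.1
  have hc0 := S.continuous_collar_zero
  have hpc : Continuous S.proj := S.proj_smooth.continuous
  set a := f (S.collar (0, q₀)) with ha
  set Z : Set Y := {q | S.proj q = S.proj q₀ ∧ f (S.collar (0, q)) = a} with hZ
  set Z' : Set Y := {q | S.proj q = S.proj q₀ ∧ f (S.collar (0, q)) ≠ a} with hZ'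
  have hZc : IsClosed Z := (isClosed_eq hpc continuous_const).inter
    (isClosed_eq (hfc.comp hc0) continuous_const)
  -- Closedness of the set where the value differs is the point: `f` is locally constant along the
  -- fibre. The fibre need not be connected.
  have hZ'c : IsClosed Z' := by
    refine ⟨isOpen_iff_mem_nhds.2 fun q hq => ?_⟩
    by_cases hpq : S.proj q = S.proj q₀
    · obtain ⟨κ, hκ, hqκ⟩ := hfib q
      have hfq : f (S.collar (0, q)) = a := by
        by_contra h
        exact hq ⟨hpq, h⟩
      filter_upwards [hf.eventually_eq hα hκ hqκ] with q' hq' hmem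
      exact hmem.2 ((hq' (hmem.1.trans hpq.symm)).trans hfq)
    · filter_upwards [(isOpen_ne.preimage hpc).mem_nhds hpq] with q' hq' hmem
      exact hq' hmem.1
  have hdisj : Disjoint ((fun q => S.collar (0, q)) '' Z) ((fun q => S.collar (0, q)) '' Z') := by
    rw [disjoint_left]
    rintro _ ⟨q, hq, rfl⟩ ⟨q', hq', hqq⟩
    exact hq'.2 ((congrArg f hqq).trans hq.2)
  obtain ⟨O₁, O₂, h1, h2, hO1, hO2, hO⟩ := SeparatedNhds.of_isCompact_isCompact
    (hZc.isCompact.image hc0) (hZ'c.isCompact.image hc0) hdisj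
  refine ⟨O₁, O₂, h1, h2, hO, hO1 ⟨q₀, ⟨rfl, rfl⟩, rfl⟩, fun q hq => ?_⟩
  by_cases hfq : f (S.collar (0, q)) = a
  · exact Or.inl ⟨hfq, hO1 ⟨q, ⟨hq, hfq⟩, rfl⟩⟩
  · exact Or.inr (hO2 ⟨q, ⟨hq, hfq⟩, rfl⟩)

variable [MeasurableSpace M] [BorelSpace M] {μ : Measure M}

/-- A polynomial lower bound for the volume of sublevel sets near a boundary point. -/
theorem exists_volume_sublevel_ge (hμ : G.interiorMetric.IsVolume (Unit ⊕ Fin b ⊕ Fin n) μ)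
    (hn : 1 ≤ n) {κ : LocalCoord (𝓡 (b + n)) Y (Fin b ⊕ Fin n)} (hκ : IsFibredCoord S.proj κ)
    {q : Y} (hq : q ∈ κ.target) {R : Set M} (hR : R ∈ 𝓝 (S.collar (0, q))) (hRfin : μ R < ⊤)
    {u ρ : M → ℝ} {L L' : ℝ} (hL : 0 ≤ L) (hL' : 0 ≤ L')
    (hu : ∀ᶠ v in 𝓝 (chartPoint κ (0, q)), 0 < v (Sum.inl ()) →
      |u (edgeCoord S κ v) - u (S.collar (0, q))| ≤ L * dist v (chartPoint κ (0, q)))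
    (hρ : ∀ᶠ v in 𝓝 (chartPoint κ (0, q)), 0 < v (Sum.inl ()) →
      ρ (edgeCoord S κ v) ≤ L' * dist v (chartPoint κ (0, q))) :
    ∃ c > 0, ∃ d : ℕ, ∀ t, 0 < t → t ≤ 1 →
      c * t ^ d ≤ μ.real {p | p ∈ R ∧ u p - u (S.collar (0, q)) < t ∧ ρ p < t} := by
  obtain ⟨c, hc, C₀, -, hden⟩ := G.exists_density_bounds hn hκ hq
  have hRev := eventually_nhdsWithin_iff.1 ((tendsto_edgeCoord S hq).eventually
    (show ∀ᶠ p in 𝓝 (S.collar (0, q)), p ∈ R from hR))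
  set v₀ := chartPoint κ (0, q) with hv₀
  obtain ⟨r, hr, hball⟩ := Metric.eventually_nhds_iff.1 ((hden.and hRev).and (hu.and hρ))
  set N := Fintype.card (Unit ⊕ Fin b ⊕ Fin n) with hN
  -- Points at distance less than `s = ηt` from `v₀` satisfy both inequalities, as `D s ≤ t`. The
  -- ball used has radius `s/4` and centre at height `s/2`, so that it stays at heights above `s/4`.
  -- There the density is at least `c (s/4)^N`, and the product with the Euclidean volume `(s/2)^N`
  -- is `c (s²/8)^N`; hence the exponent `2N`.
  set D : ℝ := L + L' + 1 with hD
  have hD1 : 1 ≤ D := by linarith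
  set η : ℝ := min r 1 / D with hη
  have hη0 : 0 < η := by positivity
  have hηr : η ≤ r := (div_le_self (by positivity) hD1).trans (min_le_left _ _)
  have hηD : D * η ≤ 1 := by
    rw [hη, mul_div_cancel₀ _ (by positivity)]
    exact min_le_right _ _
  refine ⟨c * (η ^ 2 / 8) ^ N, by positivity, 2 * N, fun t ht ht1 => ?_⟩
  set s := η * t with hs
  have hs0 : 0 < s := by positivity
  have hsr : s ≤ r := by
    calc s ≤ η * 1 := mul_le_mul_of_nonneg_left ht1 hη0.le
      _ ≤ r := by rw [mul_one]; exact hηr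
  have hDs : D * s ≤ t := by
    calc D * s = D * η * t := by ring
      _ ≤ 1 * t := by gcongr
      _ = t := one_mul t
  have hcen : dist (chartPoint κ (s / 2, q)) v₀ ≤ s / 2 := by
    refine (dist_pi_le_iff (by positivity)).2 fun i => ?_
    rcases i with i | i
    · simp [chartPoint, hv₀, abs_of_pos hs0]
    · simp [chartPoint, hv₀]; positivity
  have hw : ∀ w ∈ Metric.ball (chartPoint κ (s / 2, q)) (s / 4),
      dist w v₀ < s ∧ s / 4 < w (Sum.inl ()) := by
    intro w hw
    have h1 : dist w v₀ < s := by
      have := dist_triangle w (chartPoint κ (s / 2, q)) v₀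
      have h2 : dist w (chartPoint κ (s / 2, q)) < s / 4 := hw
      linarith
    refine ⟨h1, ?_⟩
    have h3 := (dist_pi_lt_iff (by positivity)).1 hw (Sum.inl ())
    have h4 : chartPoint κ (s / 2, q) (Sum.inl ()) = s / 2 := rfl
    rw [h4, Real.dist_eq, abs_lt] at h3
    linarith
  have key := hμ.le_measureReal_of_ball (S.edgeLocalCoord κ) (v := chartPoint κ (s / 2, q))
    (r := s / 4) (A := {p | p ∈ R ∧ u p - u (S.collar (0, q)) < t ∧ ρ p < t})
    (lt_of_le_of_lt (measure_mono fun p hp => hp.1) hRfin) (by positivity)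
    (fun w hwb => ((hball ((hw w hwb).1.trans_le hsr)).1.1
      ((by positivity : 0 < s / 4).trans (hw w hwb).2)).1)
    (fun w hwb => ?_) (a := c * (s / 4) ^ N) (by positivity) (fun w hwb => ?_)
  · refine le_trans (le_of_eq ?_) key
    rw [mul_assoc, mul_assoc, ← mul_pow, pow_mul, ← mul_pow]
    congr 2
    rw [hs]; ring
  · have hwp : 0 < w (Sum.inl ()) := (by positivity : 0 < s / 4).trans (hw w hwb).2
    have hd := (hw w hwb).1
    have hb := hball (hd.trans_le hsr)
    have h1 := (le_abs_self _).trans (hb.2.1 hwp)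
    have h2 := hb.2.2 hwp
    have h3 : L * dist w v₀ ≤ L * s := by gcongr
    have h4 : L' * dist w v₀ ≤ L' * s := by gcongr
    have h5 : 0 ≤ L * s := by positivity
    have h6 : 0 ≤ L' * s := by positivity
    have h7 : D * s = L * s + L' * s + s := by rw [hD]; ring
    refine ⟨hb.1.2 hwp, ?_, ?_⟩
    · exact lt_of_le_of_lt h1 (by linarith)
    · exact lt_of_le_of_lt h2 (by linarith)
  · have hwp : 0 < w (Sum.inl ()) := (by positivity : 0 < s / 4).trans (hw w hwb).2
    refine le_trans ?_ ((hball ((hw w hwb).1.trans_le hsr)).1.1 hwp).2.1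
    gcongr
    exact (hw w hwb).2.le

/-- The Laplacian is nonnegative at a minimum on the boundary. -/
theorem nonneg_of_boundary_min [T2Space M] [CompactSpace M] [CompactSpace Y] [T2Space B]
    [CompactSpace B] (hμ : G.interiorMetric.IsVolume (Unit ⊕ Fin b ⊕ Fin n) μ) (hn : 1 ≤ n)
    (hcov : ∀ p ∈ (𝓡∂ (b + n + 1)).interior M,
      ∃ ψ : LocalCoord (𝓡∂ (b + n + 1)) M (Unit ⊕ Fin b ⊕ Fin n), p ∈ ψ.target)
    (hfib : ∀ q : Y, ∃ κ : LocalCoord (𝓡 (b + n)) Y (Fin b ⊕ Fin n), IsFibredCoord S.proj κ ∧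
      q ∈ κ.target) {u f : M → ℝ}
    (hu1 : ContMDiffOn (𝓡∂ (b + n + 1)) 𝓘(ℝ, ℝ) 1 u ((𝓡∂ (b + n + 1)).interior M))
    (huc : Continuous u) (hug : G.BoundedGradient u) {α : ℝ} (hα : 0 < α) (hf : G.MemHolder α f)
    (hΔ : IsWeakLaplacian G.tensor u f) {q₀ : Y} (hmin : ∀ p, u (S.collar (0, q₀)) ≤ u p) :
    0 ≤ f (S.collar (0, q₀)) := by
  by_contra hneg
  push Not at hneg
  have hfc : Continuous f := continuousOn_univ.1 hf.1
  have hint := (𝓡∂ (b + n + 1)).isOpen_interior (M := M) (n := ∞) (by simp)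
  set U : Set M := S.collar '' (Ico (0 : ℝ) 1 ×ˢ univ) with hU
  have h01 : (0 : ℝ) ∈ Ico (0 : ℝ) 1 := ⟨le_rfl, one_pos⟩
  obtain ⟨O₁, O₂, hO₁, hO₂, hO, hq₀O, hsep⟩ := hf.exists_separation hα hfib q₀
  obtain ⟨k, Φ, hΦs, hΦg, hΦx, hΦ0⟩ := G.exists_barrier hfib (S.proj q₀)
  obtain ⟨Cv, hCv, δv, hδv, -, hvol⟩ := exists_volume_collar_le hμ hn hfib
  obtain ⟨Cp, hCp, δp, hδp, -, hpair⟩ := hug.abs_pairing_le (G.boundedGradient_radius hfib) hu1 hcov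
  have hΦd : ∀ j, ∀ x ∈ Ioo (0 : ℝ) 1, ∀ q,
      MDifferentiableAt (𝓡∂ (b + n + 1)) 𝓘(ℝ, ℝ) (Φ j) (S.collar (x, q)) := fun j x hx q =>
    S.mdifferentiableAt_of_collar (by simp) (hΦs j) (Ioo_subset_Ico_self hx) q
  obtain ⟨K, hK, δs, hδs, -, hρK⟩ := BoundedGradient.sum_sq hΦg hΦd
  set ρ : M → ℝ := fun p => ∑ j, Φ j p ^ 2 with hρ
  have hρ1 : ContMDiffOn (𝓡∂ (b + n + 1)) 𝓘(ℝ, ℝ) 1 ρ U :=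
    contMDiffOn_finsetSum fun j _ => ((hΦs j).of_le (by simp)).pow 2
  have hρc : ContinuousOn ρ U := hρ1.continuousOn
  have hρ0 : ∀ p, 0 ≤ ρ p := fun p => Finset.sum_nonneg fun _ _ => sq_nonneg _
  obtain ⟨δ, hδ, hδ1, hδv', hδp', hδs'⟩ : ∃ δ > 0, δ < 1 ∧ δ ≤ δv ∧ δ ≤ δp ∧ δ ≤ δs := by
    refine ⟨min (1 / 2) (min δv (min δp δs)), by positivity,
      (min_le_left _ _).trans_lt (by norm_num), ?_, ?_, ?_⟩
    · exact (min_le_right _ _).trans (min_le_left _ _)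
    · exact (min_le_right _ _).trans ((min_le_right _ _).trans (min_le_left _ _))
    · exact (min_le_right _ _).trans ((min_le_right _ _).trans (min_le_right _ _))
  set c : ℝ := -f (S.collar (0, q₀)) / 2 with hc
  have hc0 : 0 < c := by rw [hc]; linarith
  set P : Set M := O₁ ∩ {p | f p < -c} with hP
  have hPo : IsOpen P := hO₁.inter (isOpen_lt hfc continuous_const)
  -- Every point of the fibre lies either in `P`, where `f < -c`, or in `O₂`; so does a whole
  -- sublevel set of `ρ`. Its part in `P` is taken as `R`.
  obtain ⟨r, hr, hsubl⟩ := S.exists_sublevel_subset (ρ := ρ) hρc hΦx (fun q h => (hΦ0 q).1 h)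
    (hPo.union hO₂) (fun q hq => by
      rcases hsep q hq with ⟨h1, h2⟩ | h
      · refine Or.inl ⟨h2, ?_⟩
        rw [mem_ofPred_eq, h1, hc]
        linarith
      · exact Or.inr h) hδ hδ1
  set R : Set M := U ∩ ρ ⁻¹' Iio r ∩ P with hR
  have hRo : IsOpen R := (hρc.isOpen_inter_preimage S.isOpen_collar isOpen_Iio).inter hPo
  have hRU : R ⊆ U := fun p hp => hp.1.1
  have hRδ : ∀ p ∈ R, S.radius p < δ := fun p hp => by
    refine (hsubl _ (S.collarInv_mem hp.1.1) (S.collarInv p).2 ?_).1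
    have h1 := hp.1.2
    rwa [mem_preimage, mem_Iio, S.eq_collar hp.1.1] at h1
  have hRfin : μ R < ⊤ := by
    have hsub : R ⊆ ((𝓡∂ (b + n + 1)).interior M)ᶜ ∪ S.collar '' (Ioo 0 δ ×ˢ univ) := by
      intro p hp
      by_cases hpi : p ∈ (𝓡∂ (b + n + 1)).interior M
      · exact Or.inr ⟨(S.radius p, (S.collarInv p).2), ⟨⟨S.collarInv_pos_of_interior hp.1.1 hpi,
          hRδ p hp⟩, mem_univ _⟩, (S.eq_collar hp.1.1).symm⟩
      · exact Or.inl hpi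
    refine lt_of_le_of_lt ((measure_mono hsub).trans (measure_union_le _ _)) ?_
    rw [hμ.2, zero_add]
    exact (hvol δ hδ hδv').trans_lt ENNReal.ofReal_lt_top
  have hIcc : Icc (0 : ℝ) δ ×ˢ (univ : Set Y) ⊆ Ico (0 : ℝ) 1 ×ˢ univ :=
    prod_mono (fun x hx => ⟨hx.1, hx.2.trans_lt hδ1⟩) subset_rfl
  have hcc : ContinuousOn S.collar (Icc (0 : ℝ) δ ×ˢ univ) := S.collar_smooth.continuousOn.mono hIcc
  -- Removing the open set `O₂` leaves a compact set, and within `{ρ < r}` what remains lies in `P`.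
  -- Conversely `R` does not meet `O₂`, so a point of `R` outside `s` has `ρ > r/2`.
  set A : Set (ℝ × Y) := (Icc (0 : ℝ) δ ×ˢ univ ∩ (fun a => ρ (S.collar a)) ⁻¹' Iic (r / 2)) ∩
    (Icc (0 : ℝ) δ ×ˢ univ ∩ S.collar ⁻¹' O₂ᶜ) with hA
  have hAc : IsCompact A := by
    refine (isCompact_Icc.prod isCompact_univ).of_isClosed_subset ?_
      (inter_subset_left.trans inter_subset_left)
    refine IsClosed.inter ?_ (hcc.preimage_isClosed_of_isClosed (isClosed_Icc.prod isClosed_univ)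
      hO₂.isClosed_compl)
    exact (hρc.comp hcc fun a ha => mem_image_of_mem _ (hIcc ha)).preimage_isClosed_of_isClosed
      (isClosed_Icc.prod isClosed_univ) isClosed_Iic
  set s : Set M := S.collar '' A with hs
  have hsc : IsCompact s := hAc.image_of_continuousOn
    (hcc.mono (inter_subset_left.trans inter_subset_left))
  have hsR : s ⊆ R := by
    rintro _ ⟨⟨x, q⟩, ha, rfl⟩
    have hρr : ρ (S.collar (x, q)) < r := lt_of_le_of_lt ha.1.2 (half_lt_self hr)
    refine ⟨⟨mem_image_of_mem _ (hIcc ha.1.1), hρr⟩, ?_⟩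
    exact ((hsubl x (hIcc ha.1.1).1 q hρr).2).resolve_right ha.2.2
  obtain ⟨C⟩ := exists_cutoffSequence (u := u) hδ1 hCp
    (fun x hx q => hpair x ⟨hx.1, hx.2.trans_le hδp'⟩ q) hδv hvol hCv.le hRo hRU hRδ hRfin hsR
  obtain ⟨κ, hκ, hq₀⟩ := hfib q₀
  have hud : ∀ x ∈ Ioo (0 : ℝ) 1, ∀ q,
      MDifferentiableAt (𝓡∂ (b + n + 1)) 𝓘(ℝ, ℝ) u (S.collar (x, q)) := fun x hx q =>
    (hu1.contMDiffAt (hint.mem_nhds (S.collar_mem_interior hx q))).mdifferentiableAt one_ne_zero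
  obtain ⟨L, hL, hLu⟩ := hug.lipschitz_at hud hκ hq₀ huc.continuousAt
  have hp₀U : S.collar (0, q₀) ∈ U := S.collar_mem_image h01 q₀
  have hΦL : ∀ j, ∃ L : ℝ, 0 ≤ L ∧ ∀ᶠ v in 𝓝 (chartPoint κ (0, q₀)), 0 < v (Sum.inl ()) →
      |Φ j (edgeCoord S κ v) - Φ j (S.collar (0, q₀))| ≤ L * dist v (chartPoint κ (0, q₀)) :=
    fun j => (hΦg j).lipschitz_at (hΦd j) hκ hq₀
      ((hΦs j).continuousOn.continuousAt (S.isOpen_collar.mem_nhds hp₀U))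
  choose L' hL' hLΦ using hΦL
  have hρp₀ : ρ (S.collar (0, q₀)) = 0 := (hΦ0 q₀).2 rfl
  have hΦp₀ : ∀ j, Φ j (S.collar (0, q₀)) = 0 := fun j => by
    have h1 := (Finset.sum_eq_zero_iff_of_nonneg fun j _ => sq_nonneg _).1 hρp₀ j
      (Finset.mem_univ j)
    exact pow_eq_zero_iff two_ne_zero |>.1 h1
  have hp₀R : S.collar (0, q₀) ∈ R := by
    refine ⟨⟨hp₀U, ?_⟩, ?_⟩
    · rw [mem_preimage, hρp₀]; exact hr
    · have hfp : f (S.collar (0, q₀)) < -c := by rw [hc]; linarith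
      exact ⟨hq₀O, hfp⟩
  -- All `Φⱼ` vanish at the base point, so `ρ` is even quadratic in the distance; at distance at
  -- most `1` this is weakened to a linear bound.
  have hLρ : ∀ᶠ v in 𝓝 (chartPoint κ (0, q₀)), 0 < v (Sum.inl ()) →
      ρ (edgeCoord S κ v) ≤ (∑ j, L' j ^ 2) * dist v (chartPoint κ (0, q₀)) := by
    filter_upwards [eventually_all.2 hLΦ, Metric.ball_mem_nhds _ one_pos] with v hv hv1 hv0
    rw [Finset.sum_mul]
    refine Finset.sum_le_sum fun j _ => ?_
    have h1 := hv j hv0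
    rw [hΦp₀ j, sub_zero] at h1
    have hd1 : dist v (chartPoint κ (0, q₀)) ≤ 1 := le_of_lt hv1
    have hd0 : 0 ≤ dist v (chartPoint κ (0, q₀)) := dist_nonneg
    calc Φ j (edgeCoord S κ v) ^ 2 = |Φ j (edgeCoord S κ v)| ^ 2 := (sq_abs _).symm
      _ ≤ (L' j * dist v (chartPoint κ (0, q₀))) ^ 2 := by gcongr
      _ = L' j ^ 2 * (dist v (chartPoint κ (0, q₀)) * dist v (chartPoint κ (0, q₀))) := by ring
      _ ≤ L' j ^ 2 * (dist v (chartPoint κ (0, q₀)) * 1) := by gcongr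
      _ = _ := by rw [mul_one]
  obtain ⟨c', hc', d, hlow⟩ := exists_volume_sublevel_ge hμ hn hκ hq₀ (hRo.mem_nhds hp₀R) hRfin
    hL (Finset.sum_nonneg fun j _ => sq_nonneg (L' j)) hLu hLρ
  refine hμ.false_of_supersolution hcov hu1 huc hfc.continuousOn hΔ hRo hRfin hsc hsR C hc0
    (fun p hp => le_of_lt hp.2.2) hmin (fun p _ => hρ0 p) (hρc.mono hRU)
    (hρ1.mono (inter_subset_left.trans hRU)) (half_pos hr) (fun p hp hps => ?_) hK
    (fun p hp => ?_) hc' one_pos hlow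
  · by_contra hlt
    push Not at hlt
    have hcol := S.eq_collar (hRU hp)
    refine hps ⟨(S.radius p, (S.collarInv p).2), ⟨⟨⟨⟨(S.collarInv_mem (hRU hp)).1, (hRδ p hp).le⟩,
      mem_univ _⟩, ?_⟩, ⟨⟨(S.collarInv_mem (hRU hp)).1, (hRδ p hp).le⟩, mem_univ _⟩, ?_⟩, hcol.symm⟩
    · rw [mem_preimage, ← hcol]; exact hlt.le
    · rw [mem_preimage, ← hcol]
      exact fun h2 => disjoint_left.1 hO hp.2.1 h2
  · have h1 := hρK (S.radius p) ⟨S.collarInv_pos_of_interior (hRU hp.1) hp.2,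
      (hRδ p hp.1).trans_le hδs'⟩ (S.collarInv p).2
    have key : ∀ p' : M, p = p' → (∀ ξ : TangentSpace (𝓡∂ (b + n + 1)) p',
        differential ρ p' ξ ^ 2 ≤ K * ρ p' * G.g p' ξ ξ) →
        ∀ ξ : TangentSpace (𝓡∂ (b + n + 1)) p, differential ρ p ξ ^ 2 ≤ K * ρ p * G.g p ξ ξ := by
      rintro _ rfl h; exact h
    exact key _ (S.eq_collar (hRU hp.1)) h1

end EdgeMetric

end BoundaryMinimum

/-! ### The maximum principle -/

section MaximumPrinciple

variable {b n : ℕ}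
  {M : Type*} [TopologicalSpace M] [ChartedSpace (EuclideanHalfSpace (b + n + 1)) M]
  {Y : Type*} [TopologicalSpace Y] [ChartedSpace (EuclideanSpace ℝ (Fin (b + n))) Y]
  {B : Type*} [TopologicalSpace B] [ChartedSpace (EuclideanSpace ℝ (Fin b)) B]
  {F : Type*} [TopologicalSpace F] [ChartedSpace (EuclideanSpace ℝ (Fin n)) F]
  [IsManifold (𝓡∂ (b + n + 1)) ∞ M] [IsManifold (𝓡 (b + n)) ∞ Y] [IsManifold (𝓡 b) ∞ B]
  {S : EdgeSpace b n M Y B F}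

theorem IsWeakLaplacian.neg {E : Type*} [NormedAddCommGroup E] [NormedSpace ℝ E] {H : Type*}
    [TopologicalSpace H] {I : ModelWithCorners ℝ E H} {N : Type*} [TopologicalSpace N]
    [ChartedSpace H N] {T : ∀ p : N, TangentSpace I p → TangentSpace I p → ℝ} {u f : N → ℝ}
    (h : IsWeakLaplacian T u f) : IsWeakLaplacian T (fun p => -u p) fun p => -f p := by
  intro ι _ _ ψ η hη
  simpa only [neg_mul, integral_neg, neg_inj] using h ι ψ η hη

namespace EdgeMetric

variable {G : EdgeMetric S}

theorem MemHolder.neg {α : ℝ} {f : M → ℝ} (h : G.MemHolder α f) :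
    G.MemHolder α fun p => -f p := by
  obtain ⟨hc, C, hC⟩ := h
  refine ⟨hc.neg, C, fun p hp q hq => ?_⟩
  rw [neg_sub_neg, abs_sub_comm]
  exact hC p hp q hq

/-- The Laplacian is nonnegative at a minimum, in the interior or on the boundary. -/
theorem nonneg_of_min [T2Space M] [CompactSpace M] [T2Space B] [CompactSpace B] (hn : 1 ≤ n)
    (hcov : ∀ p ∈ (𝓡∂ (b + n + 1)).interior M,
      ∃ ψ : LocalCoord (𝓡∂ (b + n + 1)) M (Unit ⊕ Fin b ⊕ Fin n), p ∈ ψ.target)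
    (hfib : ∀ q : Y, ∃ κ : LocalCoord (𝓡 (b + n)) Y (Fin b ⊕ Fin n), IsFibredCoord S.proj κ ∧
      q ∈ κ.target) {u f : M → ℝ}
    (hu1 : ContMDiffOn (𝓡∂ (b + n + 1)) 𝓘(ℝ, ℝ) 1 u ((𝓡∂ (b + n + 1)).interior M))
    (huc : Continuous u) (hug : G.BoundedGradient u) {α : ℝ} (hα : 0 < α) (hf : G.MemHolder α f)
    (hΔ : IsWeakLaplacian G.tensor u f) {p : M} (hmin : ∀ q, u p ≤ u q) : 0 ≤ f p := by
  have := S.compactSpace_of_compactSpace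
  let : MeasurableSpace M := borel M
  have : BorelSpace M := ⟨rfl⟩
  have : SecondCountableTopology (EuclideanHalfSpace (b + n + 1)) :=
    inferInstanceAs (SecondCountableTopology {x : EuclideanSpace ℝ (Fin (b + n + 1)) // 0 ≤ x 0})
  have : SecondCountableTopology M :=
    ChartedSpace.secondCountable_of_sigmaCompact (EuclideanHalfSpace (b + n + 1)) M
  by_cases hp : p ∈ (𝓡∂ (b + n + 1)).interior M
  · have : Nonempty (LocalCoord (𝓡∂ (b + n + 1)) M (Unit ⊕ Fin b ⊕ Fin n)) :=
      ⟨(hcov p hp).choose⟩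
    obtain ⟨μ, hμ⟩ := G.interiorMetric.exists_isVolume hcov
    exact hμ.nonneg_of_interior_min hcov hu1 huc (hf.1.mono (subset_univ _)) hΔ hp hmin
  · rw [← mem_compl_iff, ModelWithCorners.compl_interior, S.boundary_eq] at hp
    obtain ⟨q, rfl⟩ := hp
    have : Nonempty (LocalCoord (𝓡∂ (b + n + 1)) M (Unit ⊕ Fin b ⊕ Fin n)) :=
      ⟨S.edgeLocalCoord (hfib q).choose⟩
    obtain ⟨μ, hμ⟩ := G.interiorMetric.exists_isVolume hcov
    exact nonneg_of_boundary_min hμ hn hcov hfib hu1 huc hug hα hf hΔ hmin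

end EdgeMetric

end MaximumPrinciple

end EdgeGeometry

end

open EdgeGeometry in
theorem mainTheorem1 (b n : ℕ) (hn : 1 ≤ n)
    (M : Type*) [TopologicalSpace M] [T2Space M] [CompactSpace M]
    [ChartedSpace (EuclideanHalfSpace (b + n + 1)) M] [IsManifold (𝓡∂ (b + n + 1)) ∞ M]
    (Y : Type*) [TopologicalSpace Y]
    [ChartedSpace (EuclideanSpace ℝ (Fin (b + n))) Y] [IsManifold (𝓡 (b + n)) ∞ Y]
    (B : Type*) [TopologicalSpace B] [T2Space B] [CompactSpace B]
    [ChartedSpace (EuclideanSpace ℝ (Fin b)) B] [IsManifold (𝓡 b) ∞ B]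
    (F : Type*) [TopologicalSpace F] [T2Space F] [CompactSpace F]
    [ChartedSpace (EuclideanSpace ℝ (Fin n)) F] [IsManifold (𝓡 n) ∞ F]
    (S : EdgeSpace b n M Y B F) (G : EdgeMetric S) (hG : G.Feasible)
    (α : ℝ) (hα : α ∈ Set.Ioo (0 : ℝ) 1)
    (u : M → ℝ) (hu : G.MemHybridHolder α u)
    (f : M → ℝ) (hf : G.MemHolder α f) (hΔ : IsWeakLaplacian G.tensor u f)
    (p : M) :
    ((∀ q, u p ≤ u q) → 0 ≤ f p) ∧ ((∀ q, u q ≤ u p) → f p ≤ 0) := by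
  have huc : Continuous u := continuousOn_univ.1 hu.1.1
  have : CompactSpace Y := S.compactSpace_of_compactSpace
  have hu1 := hu.2.2.contMDiffOn huc
  have hug := hu.2.2.boundedGradient huc
  -- Coordinates around interior points, and adapted ones around boundary points, are part of the
  -- data in the regularity assumption on `u`.
  have hcov : ∀ p ∈ (𝓡∂ (b + n + 1)).interior M,
      ∃ ψ : LocalCoord (𝓡∂ (b + n + 1)) M (Unit ⊕ Fin b ⊕ Fin n), p ∈ ψ.target := fun p hp => by
    obtain ⟨ψ, O, -, hpO, hO, -⟩ := hu.2.2.1 p hp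
    exact ⟨ψ, hO hpO⟩
  have hfib : ∀ q : Y, ∃ κ : LocalCoord (𝓡 (b + n)) Y (Fin b ⊕ Fin n),
      IsFibredCoord S.proj κ ∧ q ∈ κ.target := fun q => by
    obtain ⟨κ, hκ, hq, -⟩ := hu.2.2.2 q
    exact ⟨κ, hκ, hq⟩
  refine ⟨EdgeMetric.nonneg_of_min hn hcov hfib hu1 huc hug hα.1 hf hΔ, fun hmax => ?_⟩
  exact neg_nonneg.1 (EdgeMetric.nonneg_of_min hn hcov hfib hu1.neg huc.neg hug.neg hα.1 hf.neg hΔ.neg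
    fun q => neg_le_neg (hmax q))
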